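/- **Theorem (Guiding Centre Regime with variable strong magnetic field).** For $y\in\mathbb R^3$ with $y_1^2+y_2^2\neq0$ put $\Omega(y)=\sqrt{y_1^2+y_2^2}$, $\mathcal M(y)=\Omega^{-1}(-y_2,y_1,0)^T$, $r(y)=\Omega^{-1}(y_1,y_2,0)^T$, $e_3=(0,0,1)^T$, $$\rho(y)=\begin{pmatrix}-y_2/\Omega&y_1/\Omega&0\\-y_1/\Omega&-y_2/\Omega&0\\0&0&1\end{pmatrix},\qquad R(\theta)=\begin{pmatrix}1&0&0\\0&\cos\theta&\sin\theta\\0&-\sin\theta&\cos\theta\end{pmatrix},\qquad A(\theta,y)=\rho(y)^TR(\theta)\rho(y).$$ Let $E=E(t,x):\mathbb R\times\mathbb R^3\to\mathbb R^3$ be $C^2$ with bounded derivatives of orders $0,1,2$, let $s\in\mathbb R$, $T\ge0$, $x,v\in\mathbb R^3$ with $x_1^2+x_2^2\ne0$. For $\varepsilon>0$ consider on $[s,s+T]$, away from the axis $\{x_1=x_2=0\}$, $$\frac{dX_\varepsilon}{dt}=V_\varepsilon,\quad \frac{dV_\varepsilon}{dt}=E(t,X_\varepsilon)+V_\varepsilon\times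 e_3+\frac1\varepsilon V_\varepsilon\times\mathcal M(X_\varepsilon),\quad X_\varepsilon(s)=x,\ V_\varepsilon(s)=v. \tag{1}$$ *(i) Well-posedness.* For all sufficiently small $\varepsilon>0$, (1) has exactly one solution on $[s,s+T]$. *(ii) Order 0.* Let $$\overline A(y)=\frac1{\Omega^2}\begin{pmatrix}y_2^2&-y_1y_2&0\\-y_1y_2&y_1^2&0\\0&0&0\end{pmatrix},\qquad \overline\beta(y,u)=\frac1{\Omega^2}\begin{pmatrix}(y_2u_1-y_1u_2)u_2\\(y_1u_2-y_2u_1)u_1\\0\end{pmatrix},\qquad E_\parallel=(E\cdot\mathcal M)\mathcal M .$$ The system $$\frac{dY^0}{dt}=\overline A(Y^0)U^0,\quad\frac{dU^0}{dt}=\overline\beta(Y^0,U^0)+\overline A(Y^0)E_\parallel(t,Y^0)+U^0\times\overline A(Y^0)e_3,\quad Y^0(s)=x,\ U^0(s)=v$$ has exactly one solution on $[s,s+T]$ (off the axis), and with $X^0=Y^0(t)$, $V^0(t,\theta)=A(\theta,Y^0(t))\,U^0(t)$, $$\sup_{t\in[s,s+T]}\Big(|X_\varepsilon(t)-X^0(t)|+|V_\varepsilon(t)-V^0(t,\tfrac{t-s}\varepsilon)|\Big)\to0\quad(\varepsilon\to0^+).$$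 *(iii) Order 1.* Write $y,u,\eta,\mu$ for $Y^0,U^0,Y^1,U^1$ at time $t$, $\Omega=\Omega(y)$, $r=r(y)$, $\mathcal M=\mathcal M(y)$; let $E$, $\partial_tE$ and the Jacobian $D=\nabla_xE$ be evaluated at $(t,y)$, and put $\kappa=y_1u_2-y_2u_1$, $\sigma=y_1u_1+y_2u_2$. The following linear system with $\eta(s)=\mu(s)=0$ has exactly one solution $(Y^1,U^1)=(\eta,\mu)$ on $[s,s+T]$: $$\begin{aligned} \Omega^4\dot\eta_1&=(-\Omega^2y_2u_2+2y_1y_2\kappa)\eta_1+\big((2u_1y_2-u_2y_1)\Omega^2+2y_2^2\kappa\big)\eta_2+y_2^2\Omega^2\mu_1-y_1y_2\Omega^2\mu_2-\Omega^3y_1E_3-y_2u_3\Omega^3-2y_2u_3\kappa\Omega,\\ \Omega^4\dot\eta_2&=\big((2u_2y_1-u_1y_2)\Omega^2-2y_1^2\kappa\big)\eta_1+(-\Omega^2y_1u_1-2y_1y_2\kappa)\eta_2-y_1y_2\Omega^2\mu_1+y_1^2\Omega^2\mu_2-\Omega^3y_2E_3+\Omega^3y_1u_3+2y_1u_3\kappa\Omega,\\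 \Omega^3\dot\eta_3&=\Omega^2y_1E_1+\Omega^2y_2E_2+(\kappa+u_1^2+u_2^2)\Omega^2-\sigma^2, \end{aligned}$$ and, writing $c_r=c\cdot r$, $c_\varphi=c\cdot\mathcal M$, $c_3=c\cdot e_3$ for the components of a vector $c$ in the orthonormal frame $(r,\mathcal M,e_3)$ at $y$, and $D_{ab}$ ($a,b\in\{r,\varphi,3\}$) for the entries of $D$ in this frame ($D_{ab}$ is the $a$-component of $D$ applied to the $b$-th frame vector), $\dot\mu=m_r\,r+m_\varphi\,\mathcal M+m_3\,e_3$ with $$\begin{aligned} m_r={}&-\tfrac12u_3-\tfrac{5u_\varphi u_3}{2\Omega}-\tfrac{7u_\varphi^2u_3}{2\Omega^2}+\tfrac{u_\varphi(u_\varphi\eta_r+u_r\eta_\varphi)}{\Omega^2}-\tfrac{2u_\varphi\mu_\varphi}{\Omega}-\tfrac{E_\varphi\eta_\varphi}{\Omega}-\partial_tE_3\\&+\tfrac{u_3}2(D_{rr}+D_{33})+\tfrac{u_r}2(D_{3r}-D_{r3})-u_\varphi D_{3\varphi},\\ m_\varphi={}&\tfrac{u_ru_3}{\Omega}+\tfrac{2u_ru_\varphi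 u_3}{\Omega^2}-\tfrac{u_r(u_\varphi\eta_r+u_r\eta_\varphi)}{\Omega^2}+\tfrac{u_\varphi\mu_r+u_r\mu_\varphi}{\Omega}-\tfrac{u_3E_\varphi}{\Omega}-\tfrac{E_r\eta_\varphi}{\Omega}+E_3\big(1+\tfrac{u_\varphi}\Omega\big)\\&-u_3D_{\varphi r}+u_rD_{\varphi3}+(D\eta)_\varphi,\\ m_3={}&\tfrac12u_r+\tfrac{3u_ru_\varphi}{2\Omega}+\tfrac{3u_ru_\varphi^2}{2\Omega^2}+E_\varphi\big(1+\tfrac{3u_\varphi}\Omega\big)+(\partial_tE)_r-\tfrac{u_r}2(D_{rr}+D_{33})+u_\varphi D_{r\varphi}+\tfrac{u_3}2(D_{3r}-D_{r3}). \end{aligned}$$ Define $X^1(t,\theta)$ by $$\begin{aligned} X^1_1&=\tfrac1{\Omega^2}\big(y_1\Omega(\cos\theta-1)u_3+y_1\sigma\sin\theta+\eta_1\Omega^2\big),\qquad X^1_2=\tfrac1{\Omega^2}\big(y_2\Omega(\cos\theta-1)u_3+y_2\sigma\sin\theta+\eta_2\Omega^2\big),\\ X^1_3&=\tfrac1{\Omega}\big(-\sigma(\cos\theta-1)+\eta_3\Omega+\sin\theta\,u_3\Omega\big),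 \end{aligned}$$ and $V^1(t,\theta)$ by $$\begin{aligned} \Omega^4V^1_1={}&\Big[\big((2y_1u_1+y_2u_2)\Omega^2-2y_1^2\sigma\big)\eta_1+\big(y_1u_2\Omega^2-2y_1y_2\sigma\big)\eta_2+y_1^2\Omega^2\mu_1+y_1y_2\Omega^2\mu_2+\Omega^3y_1E_3+\Omega^3y_2u_3+y_2u_3\kappa\Omega\Big]\cos\theta\\ &+\Big[(-\Omega^3u_3+\Omega u_3y_1^2)\eta_1+y_1y_2u_3\Omega\eta_2-y_1\Omega^3\mu_3+\Omega^2y_1^2E_1+\Omega^2y_1y_2E_2+u_2\Omega^4+u_2\kappa\Omega^2\Big]\sin\theta\\ &+(-\Omega^2y_2u_2+2y_1y_2\kappa)\eta_1+\big((2u_1y_2-y_1u_2)\Omega^2+2y_2^2\kappa\big)\eta_2+y_2^2\Omega^2\mu_1-y_1y_2\Omega^2\mu_2-\Omega^3y_1E_3-\Omega^3y_2u_3-y_2u_3\kappa\Omega,\\ \Omega^4V^1_2={}&\Big[\big(u_1y_2\Omega^2-2y_1y_2\sigma\big)\eta_1+\big((y_1u_1+2y_2u_2)\Omega^2-2y_2^2\sigma\big)\eta_2+y_1y_2\Omega^2\mu_1+y_2^2\Omega^2\mu_2+\Omega^3y_2E_3-\Omega^3y_1u_3-y_1u_3\kappa\Omega\Big]\cos\theta\\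 &+\Big[y_1y_2u_3\Omega\eta_1+(-\Omega^3u_3+\Omega u_3y_2^2)\eta_2-y_2\Omega^3\mu_3+\Omega^2y_1y_2E_1+\Omega^2y_2^2E_2-u_1\Omega^4-u_1\kappa\Omega^2\Big]\sin\theta\\ &+\big((2y_1u_2-u_1y_2)\Omega^2-2y_1^2\kappa\big)\eta_1+(-\Omega^2y_1u_1-2y_1y_2\kappa)\eta_2-y_1y_2\Omega^2\mu_1+y_1^2\Omega^2\mu_2-\Omega^3y_2E_3+\Omega^3y_1u_3+y_1u_3\kappa\Omega,\\ \Omega^3V^1_3={}&\Big[\Omega^3\mu_3-\Omega^2y_1E_1-\Omega^2y_2E_2-\kappa\Omega^2-\kappa^2\Big]\cos\theta\\ &+\Big[(u_1\Omega^2-y_1\sigma)\eta_1+(u_2\Omega^2-y_2\sigma)\eta_2+y_1\Omega^2\mu_1+y_2\Omega^2\mu_2+\Omega^3E_3\Big]\sin\theta\\ &+\Omega^2y_1E_1+\Omega^2y_2E_2+(u_1^2+u_2^2+\kappa)\Omega^2-\sigma^2 . \end{aligned}$$ Then $$\sup_{t\in[s,s+T]}\left(\Big|\frac{X_\varepsilon(t)-X^0(t)}{\varepsilon}-X^1(t,\tfrac{t-s}\varepsilon)\Big|+\Big|\frac{V_\varepsilon(t)-V^0(t,\frac{t-s}\varepsilon)}{\varepsilon}-V^1(t,\tfrac{t-s}\varepsilon)\Big|\right)\to0\quad(\varepsilon\to0^+).$$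 *(iv) The terms are those of the averaging recurrence.* Let $Z(\theta;z,w)=(z,A(\theta,z)w)$, $a(t,z,w)=(w,E(t,z)+w\times e_3)$, and for $p=(y,u)$ off the axis and $q=(\eta,\mu)$ in $\mathbb R^3\times\mathbb R^3$ let $\alpha^0(t,\theta,p)=\{\nabla Z(\theta;p)\}^{-1}a(t,Z(\theta;p))$, $a^0(t,p)=\frac1{2\pi}\int_0^{2\pi}\alpha^0(t,\theta,p)\,d\theta$, $B(t,\theta,p)=\int_0^\theta\alpha^0(t,\sigma,p)\,d\sigma-\theta a^0(t,p)$, $\alpha^1(t,\theta,p,q)=\{\nabla_p\alpha^0\}\{q+B\}-\{\nabla_pB\}\{a^0\}-\partial_tB$, $a^1(t,p,q)=\frac1{2\pi}\int_0^{2\pi}\alpha^1(t,\theta,p,q)\,d\theta$. Then, for all such $t,\theta,p,q$, $a^0(t,p)$ is the right-hand side of the system in (ii), $a^1(t,p,q)$ is the right-hand side of the system in (iii), and $\{\nabla Z(\theta;p)\}\{q+B(t,\theta,p)\}$ is the pair $(X^1,V^1)$ of (iii). -/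

import Mathlib

open scoped Matrix Topology

namespace GuidingCentre

noncomputable section

/-! ### General averaging recipe

`W` is the phase space, `a t θ x` the slow field, and `Z t θ z` the flow of the fast field. -/

section Recipe

variable {W : Type*} [NormedAddCommGroup W] [NormedSpace ℝ W]

/-- `α⁰(t,θ,y) = {∇_z Z(t,θ;y)}⁻¹ { a(t,θ,Z(t,θ;y)) - ∂_t Z(t,θ;y) }`. -/
def alphaZero (a Z : ℝ → ℝ → W → W) (t θ : ℝ) (y : W) : W :=
  (fderiv ℝ (Z t θ) y).inverse (a t θ (Z t θ y) - deriv (fun τ => Z τ θ y) t)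

/-- `a⁰(t,y)`, the mean of `α⁰(t,·,y)` over a period. -/
def aZero (a Z : ℝ → ℝ → W → W) (t : ℝ) (y : W) : W :=
  (2 * Real.pi)⁻¹ • ∫ θ in (0 : ℝ)..(2 * Real.pi), alphaZero a Z t θ y

/-- `θ A⁰(t,θ,y) = ∫₀^θ α⁰(t,σ,y) dσ - θ a⁰(t,y)`. -/
def thetaAZero (a Z : ℝ → ℝ → W → W) (t θ : ℝ) (y : W) : W :=
  (∫ σ in (0 : ℝ)..θ, alphaZero a Z t σ y) - θ • aZero a Z t y

/-- `α¹(t,θ,y⁰,y¹) = {∇α⁰}{y¹ + θA⁰} - θ ( {∇A⁰}{a⁰} + ∂_t A⁰ )`. -/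
def alphaOne (a Z : ℝ → ℝ → W → W) (t θ : ℝ) (y₀ y₁ : W) : W :=
  fderiv ℝ (alphaZero a Z t θ) y₀ (y₁ + thetaAZero a Z t θ y₀)
    - (fderiv ℝ (thetaAZero a Z t θ) y₀ (aZero a Z t y₀)
        + deriv (fun τ => thetaAZero a Z τ θ y₀) t)

/-- `a¹(t,y⁰,y¹)`, the mean of `α¹(t,·,y⁰,y¹)` over a period. -/
def aOne (a Z : ℝ → ℝ → W → W) (t : ℝ) (y₀ y₁ : W) : W :=
  (2 * Real.pi)⁻¹ • ∫ θ in (0 : ℝ)..(2 * Real.pi), alphaOne a Z t θ y₀ y₁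

/-- The order-one term `{∇_z Z(t,θ;y⁰)} { y¹ + θA⁰(t,θ,y⁰) }` of the expansion. -/
def xOne (a Z : ℝ → ℝ → W → W) (t θ : ℝ) (y₀ y₁ : W) : W :=
  fderiv ℝ (Z t θ) y₀ (y₁ + thetaAZero a Z t θ y₀)

end Recipe

/-! ### The toroidal field

Vectors of `ℝ³` are functions `Fin 3 → ℝ`; the coordinates `1, 2, 3` are the indices `0, 1, 2`.
Only notions that do not depend on the choice of a norm on `ℝ³` are used. -/

/-- `C²_b(ℝ × ℝ³)`: twice continuously differentiable, with bounded derivatives of orders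
`0, 1, 2`. -/
def IsCbTwo (f : ℝ × (Fin 3 → ℝ) → (Fin 3 → ℝ)) : Prop :=
  ContDiff ℝ 2 f ∧ ∀ k : ℕ, k ≤ 2 → ∃ C : ℝ, ∀ p, ‖iteratedFDeriv ℝ k f p‖ ≤ C

/-- Distance to the axis, `Ω(y) = √(y₁² + y₂²)`. -/
def rad (y : Fin 3 → ℝ) : ℝ := Real.sqrt (y 0 ^ 2 + y 1 ^ 2)

/-- The direction `𝓜(y) = (-y₂, y₁, 0) / Ω(y)` of the strong magnetic field. -/
def tor (y : Fin 3 → ℝ) : Fin 3 → ℝ := ![-y 1 / rad y, y 0 / rad y, 0]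

/-- The radial unit vector `(y₁, y₂, 0) / Ω(y)`. -/
def eRad (y : Fin 3 → ℝ) : Fin 3 → ℝ := ![y 0 / rad y, y 1 / rad y, 0]

/-- The vertical unit vector `e₃`. -/
def eZ : Fin 3 → ℝ := ![0, 0, 1]

/-- The orthogonal matrix `ρ(y)`, with `ρ(y)ᵀ e₁ = 𝓜(y)`. -/
def rho (y : Fin 3 → ℝ) : Matrix (Fin 3) (Fin 3) ℝ :=
  !![-y 1 / rad y, y 0 / rad y, 0;
     -y 0 / rad y, -y 1 / rad y, 0;
     0, 0, 1]

/-- The rotation `R(θ)` about the first axis. -/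
def rotOne (θ : ℝ) : Matrix (Fin 3) (Fin 3) ℝ :=
  !![1, 0, 0;
     0, Real.cos θ, Real.sin θ;
     0, -Real.sin θ, Real.cos θ]

/-- `A(θ,y) = ρ(y)ᵀ R(θ) ρ(y)`. -/
def gyro (θ : ℝ) (y : Fin 3 → ℝ) : Matrix (Fin 3) (Fin 3) ℝ := (rho y)ᵀ * rotOne θ * rho y

/-- The flow of the fast field, `Z(θ; z, w) = (z, ρ(z)ᵀ R(θ) ρ(z) w)`. -/
def flowZ (_t θ : ℝ) (p : (Fin 3 → ℝ) × (Fin 3 → ℝ)) : (Fin 3 → ℝ) × (Fin 3 → ℝ) :=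
  (p.1, gyro θ p.1 *ᵥ p.2)

/-- The slow field, `a(t, x, v) = (v, E(t,x) + v × e₃)`. -/
def slowField (E : ℝ → (Fin 3 → ℝ) → (Fin 3 → ℝ)) (t _θ : ℝ)
    (p : (Fin 3 → ℝ) × (Fin 3 → ℝ)) : (Fin 3 → ℝ) × (Fin 3 → ℝ) :=
  (p.2, E t p.1 + p.2 ⨯₃ eZ)

/-! ### Order zero -/

/-- `Ā(y)`. -/
def Abar (y : Fin 3 → ℝ) : Matrix (Fin 3) (Fin 3) ℝ :=
  (1 / (y 0 ^ 2 + y 1 ^ 2)) •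
    !![y 1 ^ 2, -(y 0 * y 1), 0;
       -(y 0 * y 1), y 0 ^ 2, 0;
       0, 0, 0]

/-- `β̄(y,u)`. -/
def betaBar (y u : Fin 3 → ℝ) : Fin 3 → ℝ :=
  ![(y 1 * u 0 - y 0 * u 1) * u 1 / (y 0 ^ 2 + y 1 ^ 2),
    (y 0 * u 1 - y 1 * u 0) * u 0 / (y 0 ^ 2 + y 1 ^ 2),
    0]

/-- `e_∥ = (e · 𝓜(y)) 𝓜(y)`. -/
def parallelPart (y e : Fin 3 → ℝ) : Fin 3 → ℝ := (e ⬝ᵥ tor y) • tor y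

/-- Right-hand side of the equation for `Y⁰`. -/
def rhsYZero (y u : Fin 3 → ℝ) : Fin 3 → ℝ := Abar y *ᵥ u

/-- Right-hand side of the equation for `U⁰`; `e` is the value of the electric field. -/
def rhsUZero (y u e : Fin 3 → ℝ) : Fin 3 → ℝ :=
  betaBar y u + Abar y *ᵥ parallelPart y e + u ⨯₃ (Abar y *ᵥ eZ)

/-! ### Order one

Below `y, u, η, μ` stand for `Y⁰, U⁰, Y¹, U¹` and `e` for the value of the electric field. -/

/-- The position term `X¹` of order one. -/
def posOne (θ : ℝ) (y u η : Fin 3 → ℝ) : Fin 3 → ℝ :=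
  ![1 / rad y ^ 2 *
      (y 0 * rad y * (Real.cos θ - 1) * u 2
        + y 0 * (y 0 * u 0 + y 1 * u 1) * Real.sin θ + η 0 * rad y ^ 2),
    1 / rad y ^ 2 *
      (y 1 * rad y * (Real.cos θ - 1) * u 2
        + y 1 * (y 0 * u 0 + y 1 * u 1) * Real.sin θ + η 1 * rad y ^ 2),
    1 / rad y *
      ((-(y 0 * u 0) - y 1 * u 1) * (Real.cos θ - 1) + η 2 * rad y
        + Real.sin θ * u 2 * rad y)]

/-- The velocity term `V¹` of order one. -/
def velOne (θ : ℝ) (y u η μ e : Fin 3 → ℝ) : Fin 3 → ℝ :=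
  ![((((2 * y 0 * u 0 + y 1 * u 1) * rad y ^ 2
            - 2 * y 0 ^ 2 * (y 0 * u 0 + y 1 * u 1)) * η 0
          + (y 0 * u 1 * rad y ^ 2 - 2 * y 0 * y 1 * (y 0 * u 0 + y 1 * u 1)) * η 1
          + y 0 ^ 2 * μ 0 * rad y ^ 2 + y 0 * y 1 * rad y ^ 2 * μ 1
          + rad y ^ 3 * y 0 * e 2 + rad y ^ 3 * y 1 * u 2
          + y 1 * u 2 * (-(u 0 * y 1) + y 0 * u 1) * rad y) * Real.cos θ
      + ((-(rad y ^ 3 * u 2) + rad y * u 2 * y 0 ^ 2) * η 0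
          + y 0 * u 2 * y 1 * rad y * η 1 - y 0 * rad y ^ 3 * μ 2
          + rad y ^ 2 * y 0 ^ 2 * e 0 + rad y ^ 2 * y 0 * e 1 * y 1 + u 1 * rad y ^ 4
          + u 1 * (-(u 0 * y 1) + y 0 * u 1) * rad y ^ 2) * Real.sin θ
      + (-(rad y ^ 2 * y 1 * u 1) + 2 * y 0 * y 1 * (-(u 0 * y 1) + y 0 * u 1)) * η 0
      + ((2 * u 0 * y 1 - y 0 * u 1) * rad y ^ 2
          + 2 * y 1 ^ 2 * (-(u 0 * y 1) + y 0 * u 1)) * η 1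
      + y 1 ^ 2 * μ 0 * rad y ^ 2 - y 0 * y 1 * rad y ^ 2 * μ 1
      - rad y ^ 3 * y 0 * e 2 - rad y ^ 3 * y 1 * u 2
      - y 1 * u 2 * (-(u 0 * y 1) + y 0 * u 1) * rad y) / rad y ^ 4,
    (((u 0 * y 1 * rad y ^ 2 - 2 * y 0 * y 1 * (y 0 * u 0 + y 1 * u 1)) * η 0
          + ((y 0 * u 0 + 2 * y 1 * u 1) * rad y ^ 2
              - 2 * y 1 ^ 2 * (y 0 * u 0 + y 1 * u 1)) * η 1
          + y 0 * y 1 * rad y ^ 2 * μ 0 + y 1 ^ 2 * μ 1 * rad y ^ 2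
          + rad y ^ 3 * y 1 * e 2 - rad y ^ 3 * y 0 * u 2
          - y 0 * u 2 * (-(u 0 * y 1) + y 0 * u 1) * rad y) * Real.cos θ
      + (y 0 * u 2 * y 1 * rad y * η 0
          + (-(rad y ^ 3 * u 2) + rad y * u 2 * y 1 ^ 2) * η 1 - y 1 * rad y ^ 3 * μ 2
          + rad y ^ 2 * y 0 * y 1 * e 0 + rad y ^ 2 * y 1 ^ 2 * e 1 - u 0 * rad y ^ 4
          - u 0 * (-(u 0 * y 1) + y 0 * u 1) * rad y ^ 2) * Real.sin θ
      + ((2 * y 0 * u 1 - u 0 * y 1) * rad y ^ 2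
          - 2 * y 0 ^ 2 * (-(u 0 * y 1) + y 0 * u 1)) * η 0
      + (-(rad y ^ 2 * y 0 * u 0) - 2 * y 0 * y 1 * (-(u 0 * y 1) + y 0 * u 1)) * η 1
      - y 0 * y 1 * rad y ^ 2 * μ 0 + y 0 ^ 2 * μ 1 * rad y ^ 2
      - rad y ^ 3 * y 1 * e 2 + rad y ^ 3 * y 0 * u 2
      + y 0 * u 2 * (-(u 0 * y 1) + y 0 * u 1) * rad y) / rad y ^ 4,
    ((rad y ^ 3 * μ 2 - rad y ^ 2 * y 0 * e 0 - rad y ^ 2 * y 1 * e 1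
          + (u 0 * y 1 - y 0 * u 1) * rad y ^ 2
          - (-(u 0 * y 1) + y 0 * u 1) ^ 2) * Real.cos θ
      + ((u 0 * rad y ^ 2 - y 0 * (y 0 * u 0 + y 1 * u 1)) * η 0
          + (u 1 * rad y ^ 2 - y 1 * (y 0 * u 0 + y 1 * u 1)) * η 1
          + y 1 * rad y ^ 2 * μ 1 + rad y ^ 3 * e 2 + y 0 * rad y ^ 2 * μ 0) * Real.sin θ
      + rad y ^ 2 * y 0 * e 0 + rad y ^ 2 * y 1 * e 1
      + (u 0 ^ 2 + y 0 * u 1 - u 0 * y 1 + u 1 ^ 2) * rad y ^ 2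
      - (y 0 * u 0 + y 1 * u 1) ^ 2) / rad y ^ 3]

/-- Right-hand side of the equation for `Y¹`. -/
def rhsYOne (y u η μ e : Fin 3 → ℝ) : Fin 3 → ℝ :=
  ![((-(rad y ^ 2 * y 1 * u 1) + 2 * y 0 * y 1 * (-(u 0 * y 1) + u 1 * y 0)) * η 0
      + ((2 * u 0 * y 1 - u 1 * y 0) * rad y ^ 2
          + 2 * y 1 ^ 2 * (-(u 0 * y 1) + u 1 * y 0)) * η 1
      + y 1 ^ 2 * μ 0 * rad y ^ 2 - y 0 * y 1 * rad y ^ 2 * μ 1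
      - rad y ^ 3 * y 0 * e 2 - y 1 * u 2 * rad y ^ 3
      - 2 * y 1 * u 2 * (-(u 0 * y 1) + u 1 * y 0) * rad y) / rad y ^ 4,
    (((2 * u 1 * y 0 - u 0 * y 1) * rad y ^ 2
          - 2 * y 0 ^ 2 * (-(u 0 * y 1) + u 1 * y 0)) * η 0
      + (-(rad y ^ 2 * y 0 * u 0) - 2 * y 0 * y 1 * (-(u 0 * y 1) + u 1 * y 0)) * η 1
      - y 0 * y 1 * rad y ^ 2 * μ 0 + y 0 ^ 2 * μ 1 * rad y ^ 2
      - rad y ^ 3 * y 1 * e 2 + rad y ^ 3 * y 0 * u 2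
      + 2 * y 0 * u 2 * (-(u 0 * y 1) + u 1 * y 0) * rad y) / rad y ^ 4,
    (rad y ^ 2 * y 0 * e 0 + rad y ^ 2 * y 1 * e 1
      + (u 1 * y 0 + u 0 ^ 2 - u 0 * y 1 + u 1 ^ 2) * rad y ^ 2
      - (y 0 * u 0 + y 1 * u 1) ^ 2) / rad y ^ 3]

/-- Radial component of a vector at the point `y`. -/
def cr (y c : Fin 3 → ℝ) : ℝ := c ⬝ᵥ eRad y

/-- Toroidal component of a vector at the point `y`. -/
def ct (y c : Fin 3 → ℝ) : ℝ := c ⬝ᵥ tor y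

/-- Right-hand side of the equation for `U¹`, in the orthonormal frame
`(eRad y, tor y, eZ)`; `e`, `e'` and `D` are the values at `(t, Y⁰)` of the electric field, of
its time derivative and of its Jacobian in space. -/
def rhsUOne (y u η μ e e' : Fin 3 → ℝ) (D : (Fin 3 → ℝ) →L[ℝ] (Fin 3 → ℝ)) : Fin 3 → ℝ :=
  (-(u 2 / 2) - 5 * ct y u * u 2 / (2 * rad y) - 7 * ct y u ^ 2 * u 2 / (2 * rad y ^ 2)
      + ct y u * (ct y u * cr y η + cr y u * ct y η) / rad y ^ 2
      - 2 * ct y u * ct y μ / rad y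
      - ct y e * ct y η / rad y - e' 2
      + u 2 / 2 * (cr y (D (eRad y)) + D eZ 2)
      + cr y u / 2 * (D (eRad y) 2 - cr y (D eZ))
      - ct y u * D (tor y) 2) • eRad y
  + (cr y u * u 2 / rad y + 2 * cr y u * ct y u * u 2 / rad y ^ 2
      - cr y u * (ct y u * cr y η + cr y u * ct y η) / rad y ^ 2
      + (ct y u * cr y μ + cr y u * ct y μ) / rad y
      - u 2 * ct y e / rad y - cr y e * ct y η / rad y + e 2 * (1 + ct y u / rad y)
      - u 2 * ct y (D (eRad y)) + cr y u * ct y (D eZ) + ct y (D η)) • tor y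
  + (cr y u / 2 + 3 * cr y u * ct y u / (2 * rad y)
      + 3 * cr y u * ct y u ^ 2 / (2 * rad y ^ 2)
      + ct y e * (1 + 3 * ct y u / rad y) + cr y e'
      - cr y u / 2 * (cr y (D (eRad y)) + D eZ 2)
      + ct y u * cr y (D (tor y))
      + u 2 / 2 * (D (eRad y) 2 - cr y (D eZ))) • eZ

/-! ### Solutions -/

/-- `(X, V)` solves, on `[s, s+T]` and away from the axis, `dX/dt = V`,
`dV/dt = E(t,X) + V × e₃ + ε⁻¹ V × 𝓜(X)`, `X(s) = x`, `V(s) = v`. -/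
structure IsTrajectory (E : ℝ → (Fin 3 → ℝ) → (Fin 3 → ℝ)) (s T : ℝ) (x v : Fin 3 → ℝ) (ε : ℝ)
    (X V : ℝ → Fin 3 → ℝ) : Prop where
  pos_init : X s = x
  vel_init : V s = v
  off_axis : ∀ t ∈ Set.Icc s (s + T), X t 0 ^ 2 + X t 1 ^ 2 ≠ 0
  pos_deriv : ∀ t ∈ Set.Icc s (s + T), HasDerivWithinAt X (V t) (Set.Icc s (s + T)) t
  vel_deriv : ∀ t ∈ Set.Icc s (s + T),
    HasDerivWithinAt V (E t (X t) + V t ⨯₃ eZ + ε⁻¹ • (V t ⨯₃ tor (X t)))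
      (Set.Icc s (s + T)) t

/-- `(Y, U) = (Y⁰, U⁰)` solves the order-zero system on `[s, s+T]`. -/
structure IsOrderZero (E : ℝ → (Fin 3 → ℝ) → (Fin 3 → ℝ)) (s T : ℝ) (x v : Fin 3 → ℝ)
    (Y U : ℝ → Fin 3 → ℝ) : Prop where
  pos_init : Y s = x
  vel_init : U s = v
  off_axis : ∀ t ∈ Set.Icc s (s + T), Y t 0 ^ 2 + Y t 1 ^ 2 ≠ 0
  pos_deriv : ∀ t ∈ Set.Icc s (s + T),
    HasDerivWithinAt Y (rhsYZero (Y t) (U t)) (Set.Icc s (s + T)) t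
  vel_deriv : ∀ t ∈ Set.Icc s (s + T),
    HasDerivWithinAt U (rhsUZero (Y t) (U t) (E t (Y t))) (Set.Icc s (s + T)) t

/-- `(η, μ) = (Y¹, U¹)` solves on `[s, s+T]` the order-one system along `(Y, U) = (Y⁰, U⁰)`. -/
structure IsOrderOne (E : ℝ → (Fin 3 → ℝ) → (Fin 3 → ℝ)) (s T : ℝ) (Y U : ℝ → Fin 3 → ℝ)
    (η μ : ℝ → Fin 3 → ℝ) : Prop where
  pos_init : η s = 0
  vel_init : μ s = 0
  pos_deriv : ∀ t ∈ Set.Icc s (s + T),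
    HasDerivWithinAt η (rhsYOne (Y t) (U t) (η t) (μ t) (E t (Y t))) (Set.Icc s (s + T)) t
  vel_deriv : ∀ t ∈ Set.Icc s (s + T),
    HasDerivWithinAt μ
      (rhsUOne (Y t) (U t) (η t) (μ t) (E t (Y t)) (deriv (fun τ => E τ (Y t)) t)
        (fderiv ℝ (E t) (Y t)))
      (Set.Icc s (s + T)) t

end

end GuidingCentre

namespace GuidingCentre

open Set Metric
open scoped NNReal

/-! ### Ordinary differential equations: existence and uniqueness by truncation -/

section ODE

variable {W : Type*} [NormedAddCommGroup W] [NormedSpace ℝ W]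

/-! The fast part of the equation rotates the velocity about `tor` at fixed position, and its flow
`flowZ` is explicit. Writing the trajectory as `flowZ` at angle `θ = (t - s) / ε` applied to a slow
unknown `P` removes the singular term (`hasDerivWithinAt_gyro`, `isTrajectory_of_averaged`) and
leaves `P' = α⁰(t, θ, P)`. In the orthonormal frame `eRad, tor, eZ` one finds that `α⁰` is a
trigonometric polynomial of degree one in `θ`, with coefficients `meanField`, `cosField`, `sinField`
(`flowDeriv_alphaZero`, `alphaZero_eq`).

For such an equation, `P' = f₀ + cos θ f₁ + sin θ f₂`, take `p' = f₀` and the ansatz `p + ε (q + sin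
θ f₁ + (1 - cos θ) f₂) + ε² C`. Matching the terms of order `ε` gives the linear equation `avgOne`
for `q` and an explicit bounded `C`; the algebra is `corrector_identity`. The residual is `O(ε²)`,
so Gronwall's inequality gives an error `O(ε²)` (`exists_norm_sub_averaging_le`). The same identity,
averaged over a period, shows that the recurrence of the statement produces `avgOne`
(`aOne_eq_of_trig`).

The coefficients are singular on the axis. They are therefore cut off near the graph of `p`, and the
error estimate itself shows that, for small `ε`, the solution stays where the cut-off equals one
(`exists_averaging`). This yields existence for the original equation; uniqueness is the local
Lipschitz property off the axis (`isTrajectory_eqOn`). The order-zero solution is global because it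
conserves the distance to the axis, the height, and the radial and vertical components of `U`, while
the toroidal component grows at most linearly (`orderZero_bounds`, `exists_orderZero`).

It remains to transport the expansion of `P` through the rotation (`exists_norm_velocity_sub_le`)
and to identify the fields with the announced Cartesian formulas by comparing frame components
(`meanCoeff_eq`, `flowDeriv_eq`, `rhsYOne_eq`, `avgOne_eq`). -/

theorem hasDerivWithinAt_Ici_of_Icc {f : ℝ → W} {f' : W} {a b t : ℝ} (ht : t ∈ Ico a b)
    (h : HasDerivWithinAt f f' (Icc a b) t) : HasDerivWithinAt f f' (Ici t) t :=
  h.mono_of_mem_nhdsWithin (Icc_mem_nhdsGE_of_mem ht)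

/-- A bounded, globally Lipschitz field has solutions on every compact interval. -/
theorem exists_hasDerivWithinAt_of_lipschitzWith_of_norm_le [CompleteSpace W] {F : ℝ → W → W}
    {K L : ℝ≥0} {a b : ℝ} (hab : a ≤ b) (hK : ∀ t ∈ Icc a b, LipschitzWith K (F t))
    (hc : ∀ x, ContinuousOn (F · x) (Icc a b)) (hL : ∀ t ∈ Icc a b, ∀ x, ‖F t x‖ ≤ L) (x₀ : W) :
    ∃ γ : ℝ → W, γ a = x₀ ∧
      ∀ t ∈ Icc a b, HasDerivWithinAt γ (F t (γ t)) (Icc a b) t := by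
  -- The bounds are global, so the ball may have radius `L (b - a)`, which a curve of speed at most
  -- `L` cannot leave before time `b`.
  have h : IsPicardLindelof F (tmin := a) (tmax := b) ⟨a, left_mem_Icc.2 hab⟩ x₀
      (L * (b - a).toNNReal) 0 L K :=
    { lipschitzOnWith := fun t ht => (hK t ht).lipschitzOnWith
      continuousOn := fun x _ => hc x
      norm_le := fun t ht x _ => hL t ht x
      mul_max_le := by
        simp [Real.coe_toNNReal _ (sub_nonneg.2 hab), hab] }
  exact h.exists_eq_forall_mem_Icc_hasDerivWithinAt₀

/-- Smooth cut-off functions. -/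
theorem exists_contDiff_cutoff {V : Type*} [NormedAddCommGroup V] [NormedSpace ℝ V]
    [FiniteDimensional ℝ V] {K U : Set V} (hK : IsCompact K) (hU : IsOpen U) (hKU : K ⊆ U) :
    ∃ χ : V → ℝ, ContDiff ℝ 2 χ ∧ HasCompactSupport χ ∧ tsupport χ ⊆ U ∧
      (∀ z, χ z ∈ Icc (0 : ℝ) 1) ∧ ∃ O, IsOpen O ∧ K ⊆ O ∧ ∀ z ∈ O, χ z = 1 := by
  -- Two nested compact neighbourhoods of `K`: the outer one carries the support, and `χ = 1` on the
  -- inner one. Thus `χ = 1` on an open set around `K`, so that multiplication by `χ` preserves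
  -- derivatives there as well as values.
  obtain ⟨L, hL, hKL, hLU⟩ := exists_compact_between hK hU hKU
  obtain ⟨L', hL', hKL', hLL'⟩ := exists_compact_between hK isOpen_interior hKL
  obtain ⟨χ, hχ, hr, hs, h1⟩ := exists_contMDiff_support_eq_eq_one_iff
    (I := modelWithCornersSelf ℝ V) (n := 2) (isOpen_interior (s := L)) hL'.isClosed hLL'
  have hts : tsupport χ ⊆ L := by
    rw [tsupport, hs]
    exact closure_minimal interior_subset hL.isClosed
  exact ⟨χ, hχ.contDiff, hL.of_isClosed_subset (isClosed_tsupport χ) hts, hts.trans hLU,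
    fun z => hr (mem_range_self z), interior L', isOpen_interior, hKL',
    fun z hz => (h1 z).1 (interior_subset hz)⟩

/-- A point outside `U` has a neighbourhood disjoint from the closed support of `χ`, where the
product vanishes identically, whatever `f` does. -/
theorem contDiff_cutoff_smul {V : Type*} [NormedAddCommGroup V] [NormedSpace ℝ V] {n : WithTop ℕ∞}
    {χ : V → ℝ} {f : V → W} {U : Set V} (hU : IsOpen U) (hχ : ContDiff ℝ n χ)
    (hs : tsupport χ ⊆ U) (hf : ContDiffOn ℝ n f U) : ContDiff ℝ n (fun z => χ z • f z) := by
  refine contDiff_iff_contDiffAt.2 fun z => ?_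
  by_cases hz : z ∈ U
  · exact hχ.contDiffAt.smul (hf.contDiffAt (hU.mem_nhds hz))
  · refine (contDiffAt_const (c := (0 : W))).congr_of_eventuallyEq ?_
    have : z ∉ tsupport χ := fun h => hz (hs h)
    filter_upwards [(isClosed_tsupport χ).isOpen_compl.mem_nhds this] with w hw
    rw [image_eq_zero_of_notMem_tsupport hw, zero_smul]

/-- Two solutions of an ordinary differential equation with continuously differentiable right-hand
side agree when they have the same initial value. -/
theorem eqOn_of_hasDerivWithinAt_of_contDiffOn [FiniteDimensional ℝ W] {F : ℝ × W → W}
    {S : Set (ℝ × W)} (hS : IsOpen S) (hF : ContDiffOn ℝ 1 F S) {a b : ℝ} {γ δ : ℝ → W}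
    (hγ : ∀ t ∈ Icc a b, HasDerivWithinAt γ (F (t, γ t)) (Icc a b) t)
    (hγS : ∀ t ∈ Icc a b, (t, γ t) ∈ S)
    (hδ : ∀ t ∈ Icc a b, HasDerivWithinAt δ (F (t, δ t)) (Icc a b) t)
    (hδS : ∀ t ∈ Icc a b, (t, δ t) ∈ S) (h0 : γ a = δ a) : EqOn γ δ (Icc a b) := by
  have cγ : ContinuousOn γ (Icc a b) := fun t ht => (hγ t ht).continuousWithinAt
  have cδ : ContinuousOn δ (Icc a b) := fun t ht => (hδ t ht).continuousWithinAt
  have hK : IsCompact ((fun t => (t, γ t)) '' Icc a b ∪ (fun t => (t, δ t)) '' Icc a b) :=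
    (isCompact_Icc.image_of_continuousOn (continuousOn_id.prodMk cγ)).union
      (isCompact_Icc.image_of_continuousOn (continuousOn_id.prodMk cδ))
  obtain ⟨χ, hχ, hχc, hχS, -, O, -, hKO, hO⟩ := exists_contDiff_cutoff hK hS
    (by rintro _ (⟨t, ht, rfl⟩ | ⟨t, ht, rfl⟩); exacts [hγS t ht, hδS t ht])
  -- Cut off around both graphs, the field becomes globally Lipschitz, and both curves still solve
  -- the truncated equation.
  obtain ⟨K, hK⟩ := ContDiff.lipschitzWith_of_hasCompactSupport (𝕂 := ℝ)
    (hχc.smul_right (f' := F)) (contDiff_cutoff_smul hS (hχ.of_le (by norm_num)) hχS hF)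
    one_ne_zero
  refine ODE_solution_unique (v := fun t x => χ (t, x) • F (t, x)) (K := K) (fun t => ?_) cγ
    (fun t ht => ?_) cδ (fun t ht => ?_) h0
  · refine LipschitzWith.of_dist_le_mul fun x y => (hK.dist_le_mul (t, x) (t, y)).trans ?_
    simp [Prod.dist_eq]
  · have ht' := Ico_subset_Icc_self ht
    rw [hO _ (hKO (Or.inl ⟨t, ht', rfl⟩)), one_smul]
    exact hasDerivWithinAt_Ici_of_Icc ht (hγ t ht')
  · have ht' := Ico_subset_Icc_self ht
    rw [hO _ (hKO (Or.inr ⟨t, ht', rfl⟩)), one_smul]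
    exact hasDerivWithinAt_Ici_of_Icc ht (hδ t ht')

/-- Inhomogeneous linear equations have solutions on every compact interval. -/
theorem exists_hasDerivWithinAt_linear [FiniteDimensional ℝ W] {A : ℝ → W →L[ℝ] W} {g : ℝ → W}
    {a b : ℝ} (hab : a ≤ b) (hA : ContinuousOn A (Icc a b)) (hg : ContinuousOn g (Icc a b))
    (x₀ : W) :
    ∃ γ : ℝ → W, γ a = x₀ ∧
      ∀ t ∈ Icc a b, HasDerivWithinAt γ (A t (γ t) + g t) (Icc a b) t := by
  have := FiniteDimensional.complete ℝ W
  obtain ⟨CA, hCA⟩ := isCompact_Icc.exists_bound_of_continuousOn hA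
  obtain ⟨Cg, hCg⟩ := isCompact_Icc.exists_bound_of_continuousOn hg
  have hCA0 : 0 ≤ CA := (norm_nonneg _).trans (hCA a (left_mem_Icc.2 hab))
  have hCg0 : 0 ≤ Cg := (norm_nonneg _).trans (hCg a (left_mem_Icc.2 hab))
  -- The radius is the Gronwall bound of the untruncated equation. Since `0 ≤ χ ≤ 1`, the truncated
  -- equation obeys the same bound, so its solution stays where `χ = 1`.
  obtain ⟨χ, hχ, hχc, -, hχI, O, -, hKO, hO⟩ := exists_contDiff_cutoff
    (isCompact_closedBall (0 : W) (gronwallBound ‖x₀‖ CA Cg (b - a))) isOpen_univ (subset_univ _)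
  have hc2 : ContDiff ℝ 2 (fun x : W => χ x • x) := hχ.smul contDiff_id
  have hcs : HasCompactSupport (fun x : W => χ x • x) := hχc.smul_right
  obtain ⟨K, hK⟩ := ContDiff.lipschitzWith_of_hasCompactSupport (𝕂 := ℝ) hcs hc2 two_ne_zero
  obtain ⟨M, hM⟩ := hcs.exists_bound_of_continuous hc2.continuous
  have hM0 : 0 ≤ M := (norm_nonneg _).trans (hM 0)
  have hl : ∀ t ∈ Icc a b, LipschitzWith (CA.toNNReal * K) fun x => A t (χ x • x) + g t := by
    intro t ht
    refine LipschitzWith.of_dist_le_mul fun x y => ?_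
    rw [dist_add_right, dist_eq_norm, ← map_sub]
    refine ((A t).le_opNorm _).trans ?_
    rw [NNReal.coe_mul, Real.coe_toNNReal _ hCA0, mul_assoc]
    refine mul_le_mul (hCA t ht) ?_ (norm_nonneg _) hCA0
    rw [← dist_eq_norm]
    exact hK.dist_le_mul x y
  obtain ⟨γ, h0, hγ⟩ := exists_hasDerivWithinAt_of_lipschitzWith_of_norm_le
    (L := ⟨CA * M + Cg, by positivity⟩) hab hl
    (fun x => (hA.clm_apply continuousOn_const).add hg)
    (fun t ht x => (norm_add_le _ _).trans (add_le_add (((A t).le_opNorm _).trans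
      (mul_le_mul (hCA t ht) (hM x) (norm_nonneg _) hCA0)) (hCg t ht))) x₀
  have hγ' : ∀ t ∈ Icc a b, ‖γ t‖ ≤ gronwallBound ‖x₀‖ CA Cg (t - a) := by
    refine norm_le_gronwallBound_of_norm_deriv_right_le
      (fun t ht => (hγ t ht).continuousWithinAt)
      (fun t ht => hasDerivWithinAt_Ici_of_Icc ht (hγ t (Ico_subset_Icc_self ht)))
      (by rw [h0]) (fun t ht => ?_)
    have ht' := Ico_subset_Icc_self ht
    refine (norm_add_le _ _).trans (add_le_add ?_ (hCg t ht'))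
    refine ((A t).le_opNorm _).trans ?_
    refine mul_le_mul (hCA t ht') ?_ (norm_nonneg _) hCA0
    rw [norm_smul, Real.norm_of_nonneg (hχI _).1]
    exact mul_le_of_le_one_left (norm_nonneg _) (hχI _).2
  refine ⟨γ, h0, fun t ht => ?_⟩
  have h1 : χ (γ t) = 1 := by
    refine hO _ (hKO ?_)
    rw [mem_closedBall_zero_iff]
    exact (hγ' t ht).trans (gronwallBound_mono (norm_nonneg _) hCg0 hCA0 (by linarith [ht.2]))
  have := hγ t ht
  simpa only [h1, one_smul] using this

end ODE

/-! ### Second-order averaging with compactly supported coefficients -/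

section Averaging

variable {W : Type*} [NormedAddCommGroup W] [NormedSpace ℝ W]

/-- Second-order Taylor estimate for compactly supported functions. -/
theorem exists_norm_taylor_le {V : Type*} [NormedAddCommGroup V] [NormedSpace ℝ V] {f : V → W}
    (hf : ContDiff ℝ 2 f) (hc : HasCompactSupport f) :
    ∃ C : ℝ, 0 ≤ C ∧ ∀ z h, ‖f (z + h) - f z - fderiv ℝ f z h‖ ≤ C * ‖h‖ ^ 2 := by
  obtain ⟨K, hK⟩ := ContDiff.lipschitzWith_of_hasCompactSupport (𝕂 := ℝ) (hc.fderiv ℝ)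
    (hf.fderiv_right (m := 1) (by norm_num)) one_ne_zero
  refine ⟨K, K.2, fun z h => ?_⟩
  -- On the ball of radius `‖h‖` the derivative varies by at most `K ‖h‖`, because it is itself
  -- Lipschitz; the mean value inequality supplies the second factor `‖h‖`.
  have := (convex_closedBall z ‖h‖).norm_image_sub_le_of_norm_fderiv_le' (𝕜 := ℝ) (f := f)
    (φ := fderiv ℝ f z) (C := K * ‖h‖) (x := z) (y := z + h)
    (fun x _ => (hf.differentiable two_ne_zero) x)
    (fun x hx => ?_) (mem_closedBall_self (norm_nonneg _)) (by simp)
  · rw [add_sub_cancel_left] at this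
    rwa [pow_two, ← mul_assoc]
  · rw [← dist_eq_norm]
    exact (hK.dist_le_mul x z).trans (mul_le_mul_of_nonneg_left hx K.2)

/-- The order-one averaged field of `f₀ + cos θ • f₁ + sin θ • f₂`. -/
noncomputable def avgOne (f₀ f₁ f₂ : ℝ × W → W) (z : ℝ × W) (q : W) : W :=
  fderiv ℝ f₀ z (0, q + f₂ z) - fderiv ℝ f₂ z (1, f₀ z)
    + (1 / 2 : ℝ) • (fderiv ℝ f₂ z (0, f₁ z) - fderiv ℝ f₁ z (0, f₂ z))

/-- Here `Xibj` stands for the derivative of `fᵢ` in the direction `fⱼ`, `Xiq` for that in the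
direction `q`, and `Ei` for the derivative of `fᵢ` along the averaged flow. On the left is the order
`ε` part of the oscillating field. On the right it is split into the mean, the terms already
produced by differentiating `f₁` and `f₂` in the first corrector, and terms in `cos θ`, `sin θ`,
`sin 2θ`, `cos 2θ`, which have bounded primitives. The two sides differ by a multiple of `c² + s² -
1`. -/
theorem corrector_identity {c s : ℝ} (hcs : c ^ 2 + s ^ 2 = 1)
    (X0q X0b1 X0b2 X1q X1b1 X1b2 X2q X2b1 X2b2 E1 E2 : W) :
    (X0q + s • X0b1 + (1 - c) • X0b2) + c • (X1q + s • X1b1 + (1 - c) • X1b2)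
        + s • (X2q + s • X2b1 + (1 - c) • X2b2)
      = (X0q + X0b2 - E2 + (1 / 2 : ℝ) • (X2b1 - X1b2)) + s • E1 + (1 - c) • E2
        + c • (X1q + X1b2 - X0b2 + E2) + s • (X2q + X2b2 + X0b1 - E1)
        + (2 * s * c) • ((1 / 2 : ℝ) • (X1b1 - X2b2))
        - (c ^ 2 - s ^ 2) • ((1 / 2 : ℝ) • (X1b2 + X2b1)) := by
  have h : (c ^ 2 + s ^ 2 - 1) • ((1 / 2 : ℝ) • (X2b1 - X1b2)) = 0 := by
    rw [hcs, sub_self, zero_smul]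
  rw [← sub_eq_zero, ← h]
  module

/-- With zero initial error the Gronwall bound is homogeneous in the source term, so the factor `ε²`
can be taken out. -/
theorem gronwallBound_zero_mul (K e r x : ℝ) :
    gronwallBound 0 K (e * r) x = gronwallBound 0 K e x * r := by
  unfold gronwallBound
  split_ifs <;> ring

theorem exists_hasDerivWithinAt_of_contDiffOn {g : ℝ → W} {a b : ℝ} (hab : a < b)
    (hg : ContDiffOn ℝ 1 g (Icc a b)) :
    ∃ (g' : ℝ → W) (M : ℝ), 0 ≤ M ∧ ∀ t ∈ Icc a b,
      HasDerivWithinAt g (g' t) (Icc a b) t ∧ ‖g t‖ ≤ M ∧ ‖g' t‖ ≤ M := by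
  obtain ⟨C, hC⟩ := isCompact_Icc.exists_bound_of_continuousOn hg.continuousOn
  obtain ⟨C', hC'⟩ := isCompact_Icc.exists_bound_of_continuousOn
    (hg.continuousOn_derivWithin (uniqueDiffOn_Icc hab) le_rfl)
  refine ⟨derivWithin g (Icc a b), max C C', ?_, fun t ht => ⟨?_, ?_, ?_⟩⟩
  · exact ((norm_nonneg _).trans (hC a (left_mem_Icc.2 hab.le))).trans (le_max_left _ _)
  · exact ((hg t ht).differentiableWithinAt one_ne_zero).hasDerivWithinAt
  · exact (hC t ht).trans (le_max_left _ _)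
  · exact (hC' t ht).trans (le_max_right _ _)

theorem contDiffOn_one_of_hasDerivWithinAt {g g' : ℝ → W} {a b : ℝ} (hab : a < b)
    (hg : ∀ t ∈ Icc a b, HasDerivWithinAt g (g' t) (Icc a b) t)
    (hg' : ContinuousOn g' (Icc a b)) : ContDiffOn ℝ 1 g (Icc a b) := by
  have h1 : (1 : WithTop ℕ∞) = 0 + 1 := by norm_num
  rw [h1, contDiffOn_succ_iff_derivWithin (uniqueDiffOn_Icc hab)]
  refine ⟨fun t ht => (hg t ht).differentiableWithinAt, by simp, contDiffOn_zero.2 ?_⟩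
  exact hg'.congr fun t ht => (hg t ht).derivWithin (uniqueDiffOn_Icc hab t ht)

theorem contDiffOn_fderiv_apply {V : Type*} [NormedAddCommGroup V] [NormedSpace ℝ V] {f : V → W}
    (hf : ContDiff ℝ 2 f) {s : Set ℝ} {n : WithTop ℕ∞} (hn : n ≤ 1) {z w : ℝ → V}
    (hz : ContDiffOn ℝ n z s) (hw : ContDiffOn ℝ n w s) :
    ContDiffOn ℝ n (fun t => fderiv ℝ f (z t) (w t)) s :=
  ((hf.fderiv_right (m := n) ((add_le_add_left hn 1).trans (by norm_num))).comp_contDiffOn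
    hz).clm_apply hw

/-- The factor is `5 = 1 + 2 + 1 + 1`, the `2` coming from `1 - c`. The combination is the second
corrector, or the part of its derivative in which the angle is held fixed. -/
theorem norm_trig_combination_le {c s : ℝ} (hc : |c| ≤ 1) (hs : |s| ≤ 1) {M : ℝ} {g₁ g₂ g₃ g₄ : W}
    (h₁ : ‖g₁‖ ≤ M) (h₂ : ‖g₂‖ ≤ M) (h₃ : ‖g₃‖ ≤ M) (h₄ : ‖g₄‖ ≤ M) :
    ‖s • g₁ + (1 - c) • g₂ + s ^ 2 • g₃ - (s * c) • g₄‖ ≤ 5 * M := by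
  have hM : 0 ≤ M := (norm_nonneg _).trans h₁
  have e1 : ‖s • g₁‖ ≤ 1 * M := by
    rw [norm_smul]; exact mul_le_mul hs h₁ (norm_nonneg _) zero_le_one
  have e2 : ‖(1 - c) • g₂‖ ≤ 2 * M := by
    rw [norm_smul]
    refine mul_le_mul ?_ h₂ (norm_nonneg _) zero_le_two
    rw [Real.norm_eq_abs, abs_le]
    constructor <;> linarith [(abs_le.1 hc).1, (abs_le.1 hc).2]
  have e3 : ‖s ^ 2 • g₃‖ ≤ 1 * M := by
    rw [norm_smul, norm_pow]
    exact mul_le_mul (pow_le_one₀ (norm_nonneg _) hs) h₃ (norm_nonneg _) zero_le_one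
  have e4 : ‖(s * c) • g₄‖ ≤ 1 * M := by
    rw [norm_smul, norm_mul]
    exact mul_le_mul (mul_le_one₀ hs (norm_nonneg _) hc) h₄ (norm_nonneg _) zero_le_one
  refine (norm_sub_le _ _).trans ?_
  linarith [norm_add₃_le (a := s • g₁) (b := (1 - c) • g₂) (c := s ^ 2 • g₃)]

theorem lipschitzWith_trig {f₀ f₁ f₂ : ℝ × W → W} {K₀ K₁ K₂ : ℝ≥0} (hf₀ : LipschitzWith K₀ f₀)
    (hf₁ : LipschitzWith K₁ f₁) (hf₂ : LipschitzWith K₂ f₂) (t : ℝ) {c s : ℝ} (hc : |c| ≤ 1)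
    (hs : |s| ≤ 1) :
    LipschitzWith (K₀ + K₁ + K₂) (fun x => f₀ (t, x) + c • f₁ (t, x) + s • f₂ (t, x)) := by
  have hsc : ∀ (k : ℝ) (K : ℝ≥0) (f : ℝ × W → W), |k| ≤ 1 → LipschitzWith K f →
      LipschitzWith K (fun x => k • f (t, x)) := fun k K f hk hf =>
    LipschitzWith.of_dist_le_mul fun x y => by
      rw [dist_smul₀]
      refine (mul_le_of_le_one_left dist_nonneg hk).trans ((hf.dist_le_mul _ _).trans ?_)
      simp [Prod.dist_eq]
  have h0 := hsc 1 K₀ f₀ (by simp) hf₀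
  simp only [one_smul] at h0
  exact (h0.add (hsc _ _ _ hc hf₁)).add (hsc _ _ _ hs hf₂)

/-- Second-order averaging: the expansion to order one of a solution of the oscillating
equation. -/
theorem exists_norm_sub_averaging_le {f₀ f₁ f₂ : ℝ × W → W}
    (hf₀ : ContDiff ℝ 2 f₀) (hf₁ : ContDiff ℝ 2 f₁) (hf₂ : ContDiff ℝ 2 f₂)
    (hc₀ : HasCompactSupport f₀) (hc₁ : HasCompactSupport f₁) (hc₂ : HasCompactSupport f₂)
    {a b : ℝ} (hab : a < b) {p q : ℝ → W}
    (hp : ∀ t ∈ Icc a b, HasDerivWithinAt p (f₀ (t, p t)) (Icc a b) t)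
    (hq : ∀ t ∈ Icc a b,
      HasDerivWithinAt q (avgOne f₀ f₁ f₂ (t, p t) (q t)) (Icc a b) t) (hq0 : q a = 0) :
    ∃ M, 0 ≤ M ∧ ∀ ε : ℝ, 0 < ε → ε ≤ 1 → ∀ P : ℝ → W, P a = p a →
      (∀ t ∈ Icc a b, HasDerivWithinAt P (f₀ (t, P t) + Real.cos ((t - a) / ε) • f₁ (t, P t)
        + Real.sin ((t - a) / ε) • f₂ (t, P t)) (Icc a b) t) →
      ∀ t ∈ Icc a b, ‖P t - (p t + ε • (q t + Real.sin ((t - a) / ε) • f₁ (t, p t)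
        + (1 - Real.cos ((t - a) / ε)) • f₂ (t, p t)))‖ ≤ M * ε ^ 2 := by
  -- regularity of the ingredients
  have cp : ContinuousOn p (Icc a b) := fun t ht => (hp t ht).continuousWithinAt
  have cq : ContinuousOn q (Icc a b) := fun t ht => (hq t ht).continuousWithinAt
  have cz : ContinuousOn (fun t => (t, p t)) (Icc a b) := continuousOn_id.prodMk cp
  have dp : ContDiffOn ℝ 1 p (Icc a b) := contDiffOn_one_of_hasDerivWithinAt hab hp
    (hf₀.continuous.comp_continuousOn cz)
  have dz : ContDiffOn ℝ 1 (fun t => (t, p t)) (Icc a b) := contDiffOn_id.prodMk dp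
  have db : ∀ f : ℝ × W → W, ContDiff ℝ 2 f → ContDiffOn ℝ 1 (fun t => f (t, p t)) (Icc a b) :=
    fun f hf => (hf.of_le (by norm_num)).comp_contDiffOn dz
  have dX : ∀ f : ℝ × W → W, ContDiff ℝ 2 f → ∀ (c : ℝ) (w : ℝ → W), ContDiffOn ℝ 1 w (Icc a b) →
      ContDiffOn ℝ 1 (fun t => fderiv ℝ f (t, p t) (c, w t)) (Icc a b) := fun f hf c w hw =>
    contDiffOn_fderiv_apply hf le_rfl dz (contDiffOn_const.prodMk hw)
  have kX : ∀ f : ℝ × W → W, ContDiff ℝ 2 f → ∀ (c : ℝ) (w : ℝ → W), ContinuousOn w (Icc a b) →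
      ContinuousOn (fun t => fderiv ℝ f (t, p t) (c, w t)) (Icc a b) := fun f hf c w hw =>
    contDiffOn_zero.1 (contDiffOn_fderiv_apply hf zero_le_one (contDiffOn_zero.2 cz)
      (contDiffOn_const.prodMk (contDiffOn_zero.2 hw)))
  have d0 := db f₀ hf₀
  have d1 := db f₁ hf₁
  have d2 := db f₂ hf₂
  have dq : ContDiffOn ℝ 1 q (Icc a b) := by
    refine contDiffOn_one_of_hasDerivWithinAt hab hq ?_
    unfold avgOne
    exact ((kX f₀ hf₀ 0 _ (cq.add d2.continuousOn)).sub (kX f₂ hf₂ 1 _ d0.continuousOn)).add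
      (((kX f₂ hf₂ 0 _ d1.continuousOn).sub (kX f₁ hf₁ 0 _ d2.continuousOn)).const_smul _)
  have hb : ∀ f : ℝ × W → W, ContDiff ℝ 2 f → ∀ t ∈ Icc a b,
      HasDerivWithinAt (fun t => f (t, p t)) (fderiv ℝ f (t, p t) (1, f₀ (t, p t)))
        (Icc a b) t := fun f hf t ht =>
    ((hf.differentiable two_ne_zero) (t, p t)).hasFDerivAt.comp_hasDerivWithinAt t
      ((hasDerivWithinAt_id t _).prodMk (hp t ht))
  -- The four `gᵢ` are the coefficients of `cos θ`, `sin θ`, `sin 2θ` and `-cos 2θ` in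
  -- `corrector_identity`. They involve first derivatives of the `fᵢ`, so the `C²` hypothesis leaves
  -- them `C¹` in time, as differentiating the second corrector requires.
  obtain ⟨g₁, eg₁⟩ : ∃ g : ℝ → W, g = fun t => fderiv ℝ f₁ (t, p t) (0, q t)
      + fderiv ℝ f₁ (t, p t) (0, f₂ (t, p t)) - fderiv ℝ f₀ (t, p t) (0, f₂ (t, p t))
      + fderiv ℝ f₂ (t, p t) (1, f₀ (t, p t)) := ⟨_, rfl⟩
  obtain ⟨g₂, eg₂⟩ : ∃ g : ℝ → W, g = fun t => fderiv ℝ f₂ (t, p t) (0, q t)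
      + fderiv ℝ f₂ (t, p t) (0, f₂ (t, p t)) + fderiv ℝ f₀ (t, p t) (0, f₁ (t, p t))
      - fderiv ℝ f₁ (t, p t) (1, f₀ (t, p t)) := ⟨_, rfl⟩
  obtain ⟨g₃, eg₃⟩ : ∃ g : ℝ → W, g = fun t => (1 / 2 : ℝ) •
      (fderiv ℝ f₁ (t, p t) (0, f₁ (t, p t)) - fderiv ℝ f₂ (t, p t) (0, f₂ (t, p t))) := ⟨_, rfl⟩
  obtain ⟨g₄, eg₄⟩ : ∃ g : ℝ → W, g = fun t => (1 / 2 : ℝ) •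
      (fderiv ℝ f₁ (t, p t) (0, f₂ (t, p t)) + fderiv ℝ f₂ (t, p t) (0, f₁ (t, p t))) := ⟨_, rfl⟩
  obtain ⟨g₁', M₁, hM₁, hg₁⟩ := exists_hasDerivWithinAt_of_contDiffOn hab (g := g₁)
    (eg₁ ▸ ((((dX f₁ hf₁ 0 q dq).add (dX f₁ hf₁ 0 _ d2)).sub (dX f₀ hf₀ 0 _ d2)).add
      (dX f₂ hf₂ 1 _ d0)))
  obtain ⟨g₂', M₂, hM₂, hg₂⟩ := exists_hasDerivWithinAt_of_contDiffOn hab (g := g₂)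
    (eg₂ ▸ ((((dX f₂ hf₂ 0 q dq).add (dX f₂ hf₂ 0 _ d2)).add (dX f₀ hf₀ 0 _ d1)).sub
      (dX f₁ hf₁ 1 _ d0)))
  obtain ⟨g₃', M₃, hM₃, hg₃⟩ := exists_hasDerivWithinAt_of_contDiffOn hab (g := g₃)
    (eg₃ ▸ (((dX f₁ hf₁ 0 _ d1).sub (dX f₂ hf₂ 0 _ d2)).const_smul (1 / 2 : ℝ)))
  obtain ⟨g₄', M₄, hM₄, hg₄⟩ := exists_hasDerivWithinAt_of_contDiffOn hab (g := g₄)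
    (eg₄ ▸ (((dX f₁ hf₁ 0 _ d2).add (dX f₂ hf₂ 0 _ d1)).const_smul (1 / 2 : ℝ)))
  obtain ⟨_, M₅, hM₅, hbq⟩ := exists_hasDerivWithinAt_of_contDiffOn hab dq
  obtain ⟨_, M₆, hM₆, hb1⟩ := exists_hasDerivWithinAt_of_contDiffOn hab d1
  obtain ⟨_, M₇, hM₇, hb2⟩ := exists_hasDerivWithinAt_of_contDiffOn hab d2
  obtain ⟨K₀, hK₀⟩ := ContDiff.lipschitzWith_of_hasCompactSupport (𝕂 := ℝ) hc₀ hf₀ two_ne_zero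
  obtain ⟨K₁, hK₁⟩ := ContDiff.lipschitzWith_of_hasCompactSupport (𝕂 := ℝ) hc₁ hf₁ two_ne_zero
  obtain ⟨K₂, hK₂⟩ := ContDiff.lipschitzWith_of_hasCompactSupport (𝕂 := ℝ) hc₂ hf₂ two_ne_zero
  obtain ⟨T₀, hT₀0, hT₀⟩ := exists_norm_taylor_le hf₀ hc₀
  obtain ⟨T₁, hT₁0, hT₁⟩ := exists_norm_taylor_le hf₁ hc₁
  obtain ⟨T₂, hT₂0, hT₂⟩ := exists_norm_taylor_le hf₂ hc₂
  -- `Mg` bounds all the `gᵢ` and their derivatives, `Mh` bounds the displacement divided by `ε`,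
  -- and `N ε²` bounds the residual: the three terms of `N` come from `C'`, from the linear effect
  -- of `C`, and from the Taylor remainders.
  obtain ⟨Mg, eMg⟩ : ∃ Mg, Mg = M₁ + M₂ + M₃ + M₄ := ⟨_, rfl⟩
  obtain ⟨Mh, eMh⟩ : ∃ Mh, Mh = (M₅ + M₆ + 2 * M₇) + 5 * Mg := ⟨_, rfl⟩
  obtain ⟨N, eN⟩ : ∃ N, N = 5 * Mg + ((K₀ + K₁ + K₂ : ℝ≥0) : ℝ) * (5 * Mg)
    + (T₀ + T₁ + T₂) * Mh ^ 2 := ⟨_, rfl⟩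
  have hMg : 0 ≤ Mg := by rw [eMg]; positivity
  have hMh : 0 ≤ Mh := by rw [eMh]; positivity
  have hN : 0 ≤ N := by rw [eN]; positivity
  refine ⟨gronwallBound 0 (K₀ + K₁ + K₂ : ℝ≥0) N (b - a) + 5 * Mg, ?_, ?_⟩
  · refine add_nonneg ?_ (by positivity)
    exact (gronwallBound_x0 0 _ N).symm.le.trans
      (gronwallBound_mono le_rfl hN (NNReal.coe_nonneg _) (sub_nonneg.2 hab.le))
  intro ε hε hε1 P hPa hP t ht
  have cP : ContinuousOn P (Icc a b) := fun t ht => (hP t ht).continuousWithinAt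
  -- the second-order approximation
  obtain ⟨C, eC⟩ : ∃ C : ℝ → W, C = fun t => Real.sin ((t - a) / ε) • g₁ t
      + (1 - Real.cos ((t - a) / ε)) • g₂ t + Real.sin ((t - a) / ε) ^ 2 • g₃ t
      - (Real.sin ((t - a) / ε) * Real.cos ((t - a) / ε)) • g₄ t := ⟨_, rfl⟩
  obtain ⟨C', eC'⟩ : ∃ C' : ℝ → W, C' = fun t => Real.sin ((t - a) / ε) • g₁' t
      + (1 - Real.cos ((t - a) / ε)) • g₂' t + Real.sin ((t - a) / ε) ^ 2 • g₃' t
      - (Real.sin ((t - a) / ε) * Real.cos ((t - a) / ε)) • g₄' t := ⟨_, rfl⟩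
  obtain ⟨B, eB⟩ : ∃ B : ℝ → W, B = fun t => q t + Real.sin ((t - a) / ε) • f₁ (t, p t)
      + (1 - Real.cos ((t - a) / ε)) • f₂ (t, p t) := ⟨_, rfl⟩
  have nC : ∀ t ∈ Icc a b, ‖C t‖ ≤ 5 * Mg := fun t ht => by
    rw [eC]
    exact norm_trig_combination_le (Real.abs_cos_le_one _) (Real.abs_sin_le_one _)
      (by linarith [(hg₁ t ht).2.1]) (by linarith [(hg₂ t ht).2.1])
      (by linarith [(hg₃ t ht).2.1]) (by linarith [(hg₄ t ht).2.1])
  have nC' : ∀ t ∈ Icc a b, ‖C' t‖ ≤ 5 * Mg := fun t ht => by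
    rw [eC']
    exact norm_trig_combination_le (Real.abs_cos_le_one _) (Real.abs_sin_le_one _)
      (by linarith [(hg₁ t ht).2.2]) (by linarith [(hg₂ t ht).2.2])
      (by linarith [(hg₃ t ht).2.2]) (by linarith [(hg₄ t ht).2.2])
  have nB : ∀ t ∈ Icc a b, ‖B t‖ ≤ M₅ + M₆ + 2 * M₇ := fun t ht => by
    rw [eB]
    refine (norm_add₃_le).trans (add_le_add (add_le_add (hbq t ht).2.1 ?_) ?_)
    · rw [norm_smul]
      exact (mul_le_of_le_one_left (norm_nonneg _) (Real.abs_sin_le_one _)).trans (hb1 t ht).2.1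
    · rw [norm_smul]
      refine mul_le_mul ?_ (hb2 t ht).2.1 (norm_nonneg _) zero_le_two
      have := Real.neg_one_le_cos ((t - a) / ε)
      rw [Real.norm_of_nonneg (by linarith [Real.cos_le_one ((t - a) / ε)])]
      linarith
  have hsin : ∀ t, HasDerivAt (fun t => Real.sin ((t - a) / ε))
      (Real.cos ((t - a) / ε) * (1 / ε)) t := fun t =>
    (((hasDerivAt_id t).sub_const a).div_const ε).sin
  have hcos : ∀ t, HasDerivAt (fun t => Real.cos ((t - a) / ε))
      (-Real.sin ((t - a) / ε) * (1 / ε)) t := fun t =>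
    (((hasDerivAt_id t).sub_const a).div_const ε).cos
  have hB' : ∀ t ∈ Icc a b, HasDerivWithinAt B (avgOne f₀ f₁ f₂ (t, p t) (q t)
      + Real.sin ((t - a) / ε) • fderiv ℝ f₁ (t, p t) (1, f₀ (t, p t))
      + (1 - Real.cos ((t - a) / ε)) • fderiv ℝ f₂ (t, p t) (1, f₀ (t, p t))
      + (1 / ε) • (Real.cos ((t - a) / ε) • f₁ (t, p t)
        + Real.sin ((t - a) / ε) • f₂ (t, p t))) (Icc a b) t := fun t ht => by
    rw [eB]
    refine (((hq t ht).add ((hsin t).hasDerivWithinAt.smul (hb f₁ hf₁ t ht))).add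
      (((hcos t).hasDerivWithinAt.const_sub 1).smul (hb f₂ hf₂ t ht))).congr_deriv ?_
    module
  have hC' : ∀ t ∈ Icc a b, HasDerivWithinAt C (C' t + (1 / ε) • (Real.cos ((t - a) / ε) • g₁ t
      + Real.sin ((t - a) / ε) • g₂ t
      + (2 * Real.sin ((t - a) / ε) * Real.cos ((t - a) / ε)) • g₃ t
      - (Real.cos ((t - a) / ε) ^ 2 - Real.sin ((t - a) / ε) ^ 2) • g₄ t))
      (Icc a b) t := fun t ht => by
    rw [eC, eC']
    refine (((((hsin t).hasDerivWithinAt.smul (hg₁ t ht).1).add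
      (((hcos t).hasDerivWithinAt.const_sub 1).smul (hg₂ t ht).1)).add
      (((hsin t).hasDerivWithinAt.pow 2).smul (hg₃ t ht).1)).sub
      (((hsin t).hasDerivWithinAt.mul (hcos t).hasDerivWithinAt).smul
        (hg₄ t ht).1)).congr_deriv ?_
    simp only [Nat.cast_ofNat, Nat.add_one_sub_one, pow_one, Pi.pow_apply, Pi.mul_apply]
    module
  have hQ : ∀ t ∈ Icc a b, HasDerivWithinAt (fun t => p t + ε • B t + ε ^ 2 • C t) _
    (Icc a b) t := fun t ht => ((hp t ht).add ((hB' t ht).const_smul ε)).add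
      ((hC' t ht).const_smul (ε ^ 2))
  -- `P` is an exact solution, while the approximation solves the equation up to `N ε²`. The term
  -- `ε² C` serves only to obtain this residual and is discarded afterwards, at the cost `5 * Mg` in
  -- the final constant.
  have res := dist_le_of_approx_trajectories_ODE (εf := 0) (εg := N * ε ^ 2) (δ := 0)
    (fun t => lipschitzWith_trig hK₀ hK₁ hK₂ t (Real.abs_cos_le_one ((t - a) / ε))
      (Real.abs_sin_le_one ((t - a) / ε))) cP
    (fun t ht => hasDerivWithinAt_Ici_of_Icc ht (hP t (Ico_subset_Icc_self ht)))
    (fun t ht => by rw [dist_self]) (fun t ht => (hQ t ht).continuousWithinAt)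
    (fun t ht => hasDerivWithinAt_Ici_of_Icc ht (hQ t (Ico_subset_Icc_self ht)))
    (fun t ht => ?_) (by simp [eB, eC, hq0, hPa]) t ht
  · rw [zero_add, gronwallBound_zero_mul, dist_eq_norm] at res
    have hsplit : P t - (p t + ε • (q t + Real.sin ((t - a) / ε) • f₁ (t, p t)
        + (1 - Real.cos ((t - a) / ε)) • f₂ (t, p t)))
        = (P t - (p t + ε • B t + ε ^ 2 • C t)) + ε ^ 2 • C t := by
      rw [eB]; module
    rw [hsplit, add_mul]
    refine (norm_add_le _ _).trans (add_le_add (res.trans ?_) ?_)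
    · exact mul_le_mul_of_nonneg_right (gronwallBound_mono le_rfl hN (NNReal.coe_nonneg _)
        (by linarith [ht.2])) (sq_nonneg ε)
    · rw [norm_smul, norm_pow, Real.norm_of_nonneg hε.le, mul_comm]
      exact mul_le_mul_of_nonneg_right (nC t ht) (sq_nonneg ε)
  · have ht' := Ico_subset_Icc_self ht
    obtain ⟨h, eh⟩ : ∃ h, h = ε • B t + ε ^ 2 • C t := ⟨_, rfl⟩
    have hnorm : ‖((0 : ℝ), h)‖ ≤ ε * Mh := by
      have : ‖h‖ ≤ ε * Mh := by
        have e1 : ‖ε • B t‖ ≤ ε * (M₅ + M₆ + 2 * M₇) := by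
          rw [norm_smul, Real.norm_of_nonneg hε.le]
          exact mul_le_mul_of_nonneg_left (nB t ht') hε.le
        have e2 : ‖ε ^ 2 • C t‖ ≤ ε * (5 * Mg) := by
          rw [norm_smul, norm_pow, Real.norm_of_nonneg hε.le, pow_two, mul_assoc]
          exact mul_le_mul_of_nonneg_left
            ((mul_le_of_le_one_left (norm_nonneg _) hε1).trans (nC t ht')) hε.le
        rw [eh, eMh, mul_add]
        exact (norm_add_le _ _).trans (add_le_add e1 e2)
      simpa [Prod.norm_def] using this
    have hsq : ‖((0 : ℝ), h)‖ ^ 2 ≤ Mh ^ 2 * ε ^ 2 := by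
      rw [← mul_pow, mul_comm Mh]
      exact pow_le_pow_left₀ (norm_nonneg _) hnorm 2
    have hR : ∀ (f : ℝ × W → W) (T : ℝ), 0 ≤ T →
        (∀ z h : ℝ × W, ‖f (z + h) - f z - fderiv ℝ f z h‖ ≤ T * ‖h‖ ^ 2) → ∃ R : W,
        f (t, p t + h) = f (t, p t) + (ε • (fderiv ℝ f (t, p t) (0, q t)
          + Real.sin ((t - a) / ε) • fderiv ℝ f (t, p t) (0, f₁ (t, p t))
          + (1 - Real.cos ((t - a) / ε)) • fderiv ℝ f (t, p t) (0, f₂ (t, p t)))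
          + ε ^ 2 • fderiv ℝ f (t, p t) (0, C t)) + R ∧ ‖R‖ ≤ T * Mh ^ 2 * ε ^ 2 := by
      intro f T hT hf
      refine ⟨_, ?_, (hf (t, p t) (0, h)).trans
        ((mul_le_mul_of_nonneg_left hsq hT).trans_eq (by ring))⟩
      have e1 : (t, p t + h) = (t, p t) + ((0 : ℝ), h) := by simp
      have e2 : ((0 : ℝ), h) = ε • (((0 : ℝ), q t) + Real.sin ((t - a) / ε) • ((0 : ℝ), f₁ (t, p t))
          + (1 - Real.cos ((t - a) / ε)) • ((0 : ℝ), f₂ (t, p t))) + ε ^ 2 • ((0 : ℝ), C t) := by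
        rw [eh, eB]; simp
      rw [e1]
      conv_rhs => arg 1; arg 2; rw [← map_smul, ← map_smul, ← map_add, ← map_add, ← map_smul, ← map_smul, ← map_add, ← e2]
      abel
    have hD : ∀ (f : ℝ × W → W) (K : ℝ≥0), LipschitzWith K f → ∀ k : ℝ, |k| ≤ 1 →
        ‖k • fderiv ℝ f (t, p t) (0, C t)‖ ≤ K * (5 * Mg) := by
      intro f K hf k hk
      rw [norm_smul]
      refine (mul_le_of_le_one_left (norm_nonneg _) hk).trans ?_
      refine ((fderiv ℝ f (t, p t)).le_opNorm _).trans ?_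
      refine mul_le_mul (norm_fderiv_le_of_lipschitz ℝ hf) ?_ (norm_nonneg _) K.2
      simpa [Prod.norm_def] using nC t ht'
    obtain ⟨R₀, eR₀, nR₀⟩ := hR f₀ T₀ hT₀0 hT₀
    obtain ⟨R₁, eR₁, nR₁⟩ := hR f₁ T₁ hT₁0 hT₁
    obtain ⟨R₂, eR₂, nR₂⟩ := hR f₂ T₂ hT₂0 hT₂
    have hCD : ‖C' t - (1 : ℝ) • fderiv ℝ f₀ (t, p t) (0, C t)
        - Real.cos ((t - a) / ε) • fderiv ℝ f₁ (t, p t) (0, C t)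
        - Real.sin ((t - a) / ε) • fderiv ℝ f₂ (t, p t) (0, C t)‖
        ≤ 5 * Mg + K₀ * (5 * Mg) + K₁ * (5 * Mg) + K₂ * (5 * Mg) :=
      (norm_sub_le _ _).trans (add_le_add ((norm_sub_le _ _).trans (add_le_add
        ((norm_sub_le _ _).trans (add_le_add (nC' t ht') (hD f₀ K₀ hK₀ 1 (by simp))))
        (hD f₁ K₁ hK₁ _ (Real.abs_cos_le_one _)))) (hD f₂ K₂ hK₂ _ (Real.abs_sin_le_one _)))
    have hRR : ‖R₀ + Real.cos ((t - a) / ε) • R₁ + Real.sin ((t - a) / ε) • R₂‖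
        ≤ (T₀ + T₁ + T₂) * Mh ^ 2 * ε ^ 2 := by
      refine norm_add₃_le.trans ?_
      rw [norm_smul, norm_smul]
      have := mul_le_of_le_one_left (norm_nonneg R₁) (Real.abs_cos_le_one ((t - a) / ε))
      have := mul_le_of_le_one_left (norm_nonneg R₂) (Real.abs_sin_le_one ((t - a) / ε))
      simp only [Real.norm_eq_abs] at *
      linarith
    have main := corrector_identity (Real.cos_sq_add_sin_sq ((t - a) / ε))
      (fderiv ℝ f₀ (t, p t) (0, q t)) (fderiv ℝ f₀ (t, p t) (0, f₁ (t, p t)))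
      (fderiv ℝ f₀ (t, p t) (0, f₂ (t, p t))) (fderiv ℝ f₁ (t, p t) (0, q t))
      (fderiv ℝ f₁ (t, p t) (0, f₁ (t, p t))) (fderiv ℝ f₁ (t, p t) (0, f₂ (t, p t)))
      (fderiv ℝ f₂ (t, p t) (0, q t)) (fderiv ℝ f₂ (t, p t) (0, f₁ (t, p t)))
      (fderiv ℝ f₂ (t, p t) (0, f₂ (t, p t))) (fderiv ℝ f₁ (t, p t) (1, f₀ (t, p t)))
      (fderiv ℝ f₂ (t, p t) (1, f₀ (t, p t)))
    have havg : avgOne f₀ f₁ f₂ (t, p t) (q t) = fderiv ℝ f₀ (t, p t) (0, q t)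
        + fderiv ℝ f₀ (t, p t) (0, f₂ (t, p t)) - fderiv ℝ f₂ (t, p t) (1, f₀ (t, p t))
        + (1 / 2 : ℝ) • (fderiv ℝ f₂ (t, p t) (0, f₁ (t, p t))
          - fderiv ℝ f₁ (t, p t) (0, f₂ (t, p t))) := by
      rw [avgOne, ← map_add]; simp
    have hε0 : ε • (1 / ε) • (Real.cos ((t - a) / ε) • f₁ (t, p t)
        + Real.sin ((t - a) / ε) • f₂ (t, p t)) = Real.cos ((t - a) / ε) • f₁ (t, p t)
        + Real.sin ((t - a) / ε) • f₂ (t, p t) := by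
      rw [smul_smul, mul_one_div_cancel hε.ne', one_smul]
    have hε2 : ∀ w : W, ε ^ 2 • (1 / ε) • w = ε • w := fun w => by
      rw [smul_smul]; congr 1; field_simp
    rw [dist_eq_norm, add_assoc (p t), ← eh, eR₀, eR₁, eR₂, havg, smul_add, smul_add (ε ^ 2), hε0,
      hε2, eg₁, eg₂, eg₃, eg₄]
    dsimp only
    -- Subtracting `ε` times this vanishing quantity cancels all terms of order `ε`, leaving the
    -- contribution of `C` and the Taylor remainders.
    have m0 := sub_eq_zero.2 main.symm
    have hCD' : ‖ε ^ 2 • (C' t - (1 : ℝ) • fderiv ℝ f₀ (t, p t) (0, C t)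
        - Real.cos ((t - a) / ε) • fderiv ℝ f₁ (t, p t) (0, C t)
        - Real.sin ((t - a) / ε) • fderiv ℝ f₂ (t, p t) (0, C t))‖
        ≤ ε ^ 2 * (5 * Mg + K₀ * (5 * Mg) + K₁ * (5 * Mg) + K₂ * (5 * Mg)) := by
      rw [norm_smul, norm_pow, Real.norm_of_nonneg hε.le]
      exact mul_le_mul_of_nonneg_left hCD (sq_nonneg ε)
    have hfin := (norm_sub_le _ _).trans (add_le_add hCD' hRR)
    have hle : ε ^ 2 * (5 * Mg + K₀ * (5 * Mg) + K₁ * (5 * Mg) + K₂ * (5 * Mg))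
        + (T₀ + T₁ + T₂) * Mh ^ 2 * ε ^ 2 = N * ε ^ 2 := by
      rw [eN]; push_cast; ring
    rw [hle] at hfin
    refine le_of_eq_of_le (congrArg norm ?_) hfin
    rw [← sub_eq_zero, ← smul_zero (A := W) ε, ← m0]
    module

end Averaging

noncomputable section

/-! ### The moving frame -/

theorem rad_sq (y : Fin 3 → ℝ) : rad y ^ 2 = y 0 ^ 2 + y 1 ^ 2 := Real.sq_sqrt (by positivity)

theorem rad_pos {y : Fin 3 → ℝ} (hy : y 0 ^ 2 + y 1 ^ 2 ≠ 0) : 0 < rad y :=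
  Real.sqrt_pos.2 (lt_of_le_of_ne (by positivity) hy.symm)

theorem rad_ne_zero {y : Fin 3 → ℝ} (hy : y 0 ^ 2 + y 1 ^ 2 ≠ 0) : rad y ≠ 0 := (rad_pos hy).ne'

theorem ct_eq (y w : Fin 3 → ℝ) : ct y w = (w 1 * y 0 - w 0 * y 1) / rad y := by
  simp [ct, tor, dotProduct, Fin.sum_univ_three]; ring

theorem cr_eq (y w : Fin 3 → ℝ) : cr y w = (w 0 * y 0 + w 1 * y 1) / rad y := by
  simp [cr, eRad, dotProduct, Fin.sum_univ_three]; ring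

@[simp] theorem ct_add (y v w : Fin 3 → ℝ) : ct y (v + w) = ct y v + ct y w := add_dotProduct _ _ _
@[simp] theorem cr_add (y v w : Fin 3 → ℝ) : cr y (v + w) = cr y v + cr y w := add_dotProduct _ _ _
@[simp] theorem ct_sub (y v w : Fin 3 → ℝ) : ct y (v - w) = ct y v - ct y w := sub_dotProduct _ _ _
@[simp] theorem cr_sub (y v w : Fin 3 → ℝ) : cr y (v - w) = cr y v - cr y w := sub_dotProduct _ _ _
@[simp] theorem ct_smul (a : ℝ) (y v : Fin 3 → ℝ) : ct y (a • v) = a * ct y v := smul_dotProduct _ _ _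
@[simp] theorem cr_smul (a : ℝ) (y v : Fin 3 → ℝ) : cr y (a • v) = a * cr y v := smul_dotProduct _ _ _
@[simp] theorem ct_zero (y : Fin 3 → ℝ) : ct y 0 = 0 := zero_dotProduct _
@[simp] theorem cr_zero (y : Fin 3 → ℝ) : cr y 0 = 0 := zero_dotProduct _
@[simp] theorem ct_eZ (y : Fin 3 → ℝ) : ct y eZ = 0 := by simp [ct_eq, eZ]
@[simp] theorem cr_eZ (y : Fin 3 → ℝ) : cr y eZ = 0 := by simp [cr_eq, eZ]
@[simp] theorem tor_two (y : Fin 3 → ℝ) : tor y 2 = 0 := by simp [tor]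
@[simp] theorem eRad_two (y : Fin 3 → ℝ) : eRad y 2 = 0 := by simp [eRad]
@[simp] theorem eZ_two : eZ 2 = 1 := by simp [eZ]
@[simp] theorem ct_eRad (y : Fin 3 → ℝ) : ct y (eRad y) = 0 := by
  simp only [ct_eq, eRad, Matrix.cons_val_zero, Matrix.cons_val_one]; ring
@[simp] theorem cr_tor (y : Fin 3 → ℝ) : cr y (tor y) = 0 := by
  simp only [cr_eq, tor, Matrix.cons_val_zero, Matrix.cons_val_one]; ring

theorem ct_tor {y : Fin 3 → ℝ} (hy : y 0 ^ 2 + y 1 ^ 2 ≠ 0) : ct y (tor y) = 1 := by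
  have := rad_ne_zero hy
  simp only [ct_eq, tor, Matrix.cons_val_zero, Matrix.cons_val_one]
  field_simp
  rw [rad_sq]; ring

theorem cr_eRad {y : Fin 3 → ℝ} (hy : y 0 ^ 2 + y 1 ^ 2 ≠ 0) : cr y (eRad y) = 1 := by
  have := rad_ne_zero hy
  simp only [cr_eq, eRad, Matrix.cons_val_zero, Matrix.cons_val_one]
  field_simp
  rw [rad_sq]

theorem frame_decomp {y : Fin 3 → ℝ} (hy : y 0 ^ 2 + y 1 ^ 2 ≠ 0) (w : Fin 3 → ℝ) :
    w = cr y w • eRad y + ct y w • tor y + w 2 • eZ := by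
  have := rad_ne_zero hy
  have h2 := rad_sq y
  ext i
  fin_cases i <;> simp [ct_eq, cr_eq, eRad, tor, eZ] <;> field_simp <;> rw [h2] <;> ring

/-- Comparing components in the frame replaces identities in Cartesian coordinates, which need `Ω² =
y₁² + y₂²`, by identities in the symbols `cr`, `ct` and the third coordinate. -/
theorem frame_ext {y : Fin 3 → ℝ} (hy : y 0 ^ 2 + y 1 ^ 2 ≠ 0) {v w : Fin 3 → ℝ}
    (hr : cr y v = cr y w) (ht : ct y v = ct y w) (hz : v 2 = w 2) : v = w := by
  rw [frame_decomp hy v, frame_decomp hy w, hr, ht, hz]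

theorem gyro_mulVec (θ : ℝ) (y w : Fin 3 → ℝ) :
    gyro θ y *ᵥ w = ct y w • tor y + Real.cos θ • (cr y w • eRad y + w 2 • eZ)
      + Real.sin θ • (cr y w • eZ - w 2 • eRad y) := by
  ext i
  fin_cases i <;>
  simp [gyro, rho, rotOne, Matrix.mulVec, dotProduct, Fin.sum_univ_three, Matrix.mul_apply,
    ct_eq, cr_eq, eRad, tor, eZ, Matrix.vecHead, Matrix.vecTail] <;> ring

theorem cross_eZ {y : Fin 3 → ℝ} (hy : y 0 ^ 2 + y 1 ^ 2 ≠ 0) (w : Fin 3 → ℝ) :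
    w ⨯₃ eZ = ct y w • eRad y - cr y w • tor y := by
  have := rad_ne_zero hy
  have h2 := rad_sq y
  ext i
  fin_cases i <;> simp [cross_apply, ct_eq, cr_eq, eRad, tor, eZ] <;> field_simp <;>
    rw [h2] <;> ring

/-- This is the generator of the rotation `gyro`: the angular derivative of the rotated vector is
its cross product with `tor`. -/
theorem cross_tor {y : Fin 3 → ℝ} (hy : y 0 ^ 2 + y 1 ^ 2 ≠ 0) (w : Fin 3 → ℝ) :
    w ⨯₃ tor y = cr y w • eZ - w 2 • eRad y := by
  have := rad_ne_zero hy
  have h2 := rad_sq y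
  ext i
  fin_cases i <;> (simp [cross_apply, cr_eq, eRad, tor, eZ]; try field_simp; try ring)

section Deriv

variable {y w : ℝ → Fin 3 → ℝ} {y' w' : Fin 3 → ℝ} {s : ℝ} {S : Set ℝ}

theorem hasDerivWithinAt_rad (hy : HasDerivWithinAt y y' S s) (h0 : y s 0 ^ 2 + y s 1 ^ 2 ≠ 0) :
    HasDerivWithinAt (fun τ => rad (y τ)) (cr (y s) y') S s := by
  have h := hasDerivWithinAt_pi.1 hy
  have := (((h 0).pow 2).add ((h 1).pow 2)).sqrt h0
  refine this.congr_deriv ?_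
  rw [cr_eq]
  change _ / (2 * rad (y s)) = _
  have := rad_ne_zero h0
  field_simp
  simp
  ring

/-- Only the angular motion turns the frame, at the rate `ct y y' / rad y` about the vertical axis;
all curvature terms come from this rotation. -/
theorem hasDerivWithinAt_eRad (hy : HasDerivWithinAt y y' S s) (h0 : y s 0 ^ 2 + y s 1 ^ 2 ≠ 0) :
    HasDerivWithinAt (fun τ => eRad (y τ)) ((ct (y s) y' / rad (y s)) • tor (y s)) S s := by
  have h := hasDerivWithinAt_pi.1 hy
  have hr := hasDerivWithinAt_rad hy h0
  have r0 := rad_ne_zero h0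
  have h2 := rad_sq (y s)
  refine hasDerivWithinAt_pi.2 fun i => ?_
  fin_cases i
  · refine ((h 0).div hr r0).congr_deriv ?_
    simp [ct_eq, cr_eq, tor]
    field_simp
    rw [h2]; ring
  · refine ((h 1).div hr r0).congr_deriv ?_
    simp [ct_eq, cr_eq, tor]
    field_simp
    rw [h2]; ring
  · simpa [eRad] using hasDerivWithinAt_const s S (0 : ℝ)

theorem hasDerivWithinAt_tor (hy : HasDerivWithinAt y y' S s) (h0 : y s 0 ^ 2 + y s 1 ^ 2 ≠ 0) :
    HasDerivWithinAt (fun τ => tor (y τ)) (-(ct (y s) y' / rad (y s)) • eRad (y s)) S s := by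
  have h := hasDerivWithinAt_pi.1 (hasDerivWithinAt_eRad hy h0)
  refine hasDerivWithinAt_pi.2 fun i => ?_
  fin_cases i
  · refine ((h 1).neg.congr_deriv (g' := _) ?_).congr_of_eventuallyEq
      (.of_forall fun τ => ?_) ?_ <;> simp [eRad, tor] <;> ring
  · refine ((h 0).congr_deriv (g' := _) ?_).congr_of_eventuallyEq
      (.of_forall fun τ => ?_) ?_ <;> simp [eRad, tor] <;> ring
  · simpa [tor] using hasDerivWithinAt_const s S (0 : ℝ)

theorem hasDerivWithinAt_dotProduct {v w : ℝ → Fin 3 → ℝ} {v' w' : Fin 3 → ℝ}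
    (hv : HasDerivWithinAt v v' S s) (hw : HasDerivWithinAt w w' S s) :
    HasDerivWithinAt (fun τ => v τ ⬝ᵥ w τ) (v' ⬝ᵥ w s + v s ⬝ᵥ w') S s := by
  have h1 := hasDerivWithinAt_pi.1 hv
  have h2 := hasDerivWithinAt_pi.1 hw
  refine (HasDerivWithinAt.fun_sum (u := Finset.univ) fun i _ => (h1 i).mul (h2 i)).congr_deriv ?_
  simp [dotProduct, Finset.sum_add_distrib]

theorem hasDerivWithinAt_cr (hy : HasDerivWithinAt y y' S s) (hw : HasDerivWithinAt w w' S s)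
    (h0 : y s 0 ^ 2 + y s 1 ^ 2 ≠ 0) :
    HasDerivWithinAt (fun τ => cr (y τ) (w τ))
      (cr (y s) w' + ct (y s) y' / rad (y s) * ct (y s) (w s)) S s := by
  refine (hasDerivWithinAt_dotProduct hw (hasDerivWithinAt_eRad hy h0)).congr_deriv ?_
  rw [dotProduct_smul]; rfl

theorem hasDerivWithinAt_ct (hy : HasDerivWithinAt y y' S s) (hw : HasDerivWithinAt w w' S s)
    (h0 : y s 0 ^ 2 + y s 1 ^ 2 ≠ 0) :
    HasDerivWithinAt (fun τ => ct (y τ) (w τ))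
      (ct (y s) w' - ct (y s) y' / rad (y s) * cr (y s) (w s)) S s := by
  refine (hasDerivWithinAt_dotProduct hw (hasDerivWithinAt_tor hy h0)).congr_deriv ?_
  rw [dotProduct_smul, neg_smul, ← sub_eq_add_neg]; rfl

end Deriv

end

/-! ### The averaging recurrence for a trigonometric polynomial of degree one -/

section TrigRecipe

variable {W : Type*} [NormedAddCommGroup W] [NormedSpace ℝ W] {a Z : ℝ → ℝ → W → W}
  {S : Set W} {c₀ c₁ c₂ : ℝ × W → W}

theorem hasFDerivAt_slice {c : ℝ × W → W} {t : ℝ} {p : W} (hc : DifferentiableAt ℝ c (t, p)) :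
    HasFDerivAt (fun x => c (t, x))
      ((fderiv ℝ c (t, p)).comp (ContinuousLinearMap.inr ℝ ℝ W)) p :=
  hc.hasFDerivAt.comp p (hasFDerivAt_prodMk_right t p)

theorem hasDerivAt_slice {c : ℝ × W → W} {t : ℝ} {p : W} (hc : DifferentiableAt ℝ c (t, p)) :
    HasDerivAt (fun τ => c (τ, p)) (fderiv ℝ c (t, p) (1, 0)) t :=
  hc.hasFDerivAt.comp_hasDerivAt t ((hasDerivAt_id t).prodMk (hasDerivAt_const t p))

variable [CompleteSpace W]

theorem integral_trig (u v w : W) (θ : ℝ) :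
    ∫ σ in (0 : ℝ)..θ, (u + Real.cos σ • v + Real.sin σ • w)
      = θ • u + Real.sin θ • v + (1 - Real.cos θ) • w := by
  have h : ∀ σ ∈ uIcc 0 θ, HasDerivAt
      (fun σ : ℝ => σ • u + Real.sin σ • v + (1 - Real.cos σ) • w)
      (u + Real.cos σ • v + Real.sin σ • w) σ := fun σ _ => by
    refine ((((hasDerivAt_id σ).smul_const u).add ((Real.hasDerivAt_sin σ).smul_const v)).add
      (((Real.hasDerivAt_cos σ).const_sub 1).smul_const w)).congr_deriv ?_
    simp
  rw [intervalIntegral.integral_eq_sub_of_hasDerivAt h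
    (Continuous.intervalIntegrable (by fun_prop) _ _)]
  simp

/-- The harmonics `θ` and `2θ` have mean zero; the shape matches the right-hand side of
`corrector_identity`. -/
theorem integral_corrector (m g₁ g₂ g₃ g₄ : W) :
    ∫ θ in (0 : ℝ)..(2 * Real.pi), (m + Real.cos θ • g₁ + Real.sin θ • g₂
        + (2 * Real.sin θ * Real.cos θ) • g₃ - (Real.cos θ ^ 2 - Real.sin θ ^ 2) • g₄)
      = (2 * Real.pi) • m := by
  have h : ∀ σ ∈ uIcc 0 (2 * Real.pi), HasDerivAt
      (fun σ : ℝ => σ • m + Real.sin σ • g₁ + (-Real.cos σ) • g₂ + (Real.sin σ ^ 2) • g₃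
        - (Real.sin σ * Real.cos σ) • g₄)
      (m + Real.cos σ • g₁ + Real.sin σ • g₂
        + (2 * Real.sin σ * Real.cos σ) • g₃ - (Real.cos σ ^ 2 - Real.sin σ ^ 2) • g₄) σ :=
    fun σ _ => by
    refine ((((((hasDerivAt_id σ).smul_const m).add ((Real.hasDerivAt_sin σ).smul_const g₁)).add
      ((Real.hasDerivAt_cos σ).neg.smul_const g₂)).add
      (((Real.hasDerivAt_sin σ).pow 2).smul_const g₃)).sub
      (((Real.hasDerivAt_sin σ).mul (Real.hasDerivAt_cos σ)).smul_const g₄)).congr_deriv ?_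
    simp
    module
  rw [intervalIntegral.integral_eq_sub_of_hasDerivAt h
    (Continuous.intervalIntegrable (by fun_prop) _ _)]
  simp

theorem aZero_eq_of_trig {t : ℝ} {p : W}
    (hα : ∀ θ, alphaZero a Z t θ p = c₀ (t, p) + Real.cos θ • c₁ (t, p) + Real.sin θ • c₂ (t, p)) :
    aZero a Z t p = c₀ (t, p) := by
  have : (2 * Real.pi) ≠ 0 := by positivity
  simp only [aZero, hα, integral_trig]
  rw [Real.sin_two_pi, Real.cos_two_pi, sub_self, zero_smul, zero_smul, add_zero, add_zero,
    smul_smul, inv_mul_cancel₀ this, one_smul]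

theorem thetaAZero_eq_of_trig {t : ℝ} {p : W}
    (hα : ∀ θ, alphaZero a Z t θ p = c₀ (t, p) + Real.cos θ • c₁ (t, p) + Real.sin θ • c₂ (t, p))
    (θ : ℝ) :
    thetaAZero a Z t θ p = Real.sin θ • c₁ (t, p) + (1 - Real.cos θ) • c₂ (t, p) := by
  rw [thetaAZero, aZero_eq_of_trig hα]
  simp only [hα, integral_trig]
  abel

/-- The averaging recipe when `α⁰` is a trigonometric polynomial of degree one. -/
theorem aOne_eq_of_trig (hS : IsOpen S) (h₀ : ∀ t, ∀ p ∈ S, DifferentiableAt ℝ c₀ (t, p))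
    (h₁ : ∀ t, ∀ p ∈ S, DifferentiableAt ℝ c₁ (t, p))
    (h₂ : ∀ t, ∀ p ∈ S, DifferentiableAt ℝ c₂ (t, p))
    (hα : ∀ t, ∀ p ∈ S, ∀ θ,
      alphaZero a Z t θ p = c₀ (t, p) + Real.cos θ • c₁ (t, p) + Real.sin θ • c₂ (t, p))
    {t : ℝ} {p : W} (hp : p ∈ S) (q : W) :
    aOne a Z t p q = avgOne c₀ c₁ c₂ (t, p) q := by
  have hn : ∀ᶠ x in 𝓝 p, x ∈ S := hS.mem_nhds hp
  have hone : ∀ (c : ℝ × W → W) (w : W),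
      fderiv ℝ c (t, p) (1, w) = fderiv ℝ c (t, p) (1, 0) + fderiv ℝ c (t, p) (0, w) := by
    intro c w; rw [← map_add]; simp
  have hzero : ∀ (c : ℝ × W → W) (v w : W),
      fderiv ℝ c (t, p) (0, v + w) = fderiv ℝ c (t, p) (0, v) + fderiv ℝ c (t, p) (0, w) := by
    intro c v w; rw [← map_add]; simp
  have hsm : ∀ (c : ℝ × W → W) (k : ℝ) (w : W),
      fderiv ℝ c (t, p) (0, k • w) = k • fderiv ℝ c (t, p) (0, w) := by
    intro c k w; rw [← map_smul]; simp
  -- The recurrence subtracts the derivatives of `thetaAZero` along `aZero` and in time, which are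
  -- the `E1` and `E2` terms of `corrector_identity`; the mean and the harmonics of that identity
  -- remain.
  have main : ∀ θ, alphaOne a Z t θ p q = avgOne c₀ c₁ c₂ (t, p) q
      + Real.cos θ • (fderiv ℝ c₁ (t, p) (0, q) + fderiv ℝ c₁ (t, p) (0, c₂ (t, p))
        - fderiv ℝ c₀ (t, p) (0, c₂ (t, p)) + fderiv ℝ c₂ (t, p) (1, c₀ (t, p)))
      + Real.sin θ • (fderiv ℝ c₂ (t, p) (0, q) + fderiv ℝ c₂ (t, p) (0, c₂ (t, p))
        + fderiv ℝ c₀ (t, p) (0, c₁ (t, p)) - fderiv ℝ c₁ (t, p) (1, c₀ (t, p)))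
      + (2 * Real.sin θ * Real.cos θ) • ((1 / 2 : ℝ) •
        (fderiv ℝ c₁ (t, p) (0, c₁ (t, p)) - fderiv ℝ c₂ (t, p) (0, c₂ (t, p))))
      - (Real.cos θ ^ 2 - Real.sin θ ^ 2) • ((1 / 2 : ℝ) •
        (fderiv ℝ c₁ (t, p) (0, c₂ (t, p)) + fderiv ℝ c₂ (t, p) (0, c₁ (t, p)))) := by
    intro θ
    have e1 : fderiv ℝ (alphaZero a Z t θ) p = _ :=
      ((((hasFDerivAt_slice (h₀ t p hp)).add
        ((hasFDerivAt_slice (h₁ t p hp)).const_smul (Real.cos θ))).add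
        ((hasFDerivAt_slice (h₂ t p hp)).const_smul (Real.sin θ))).congr_of_eventuallyEq
        (hn.mono fun x hx => hα t x hx θ)).fderiv
    have e2 : fderiv ℝ (thetaAZero a Z t θ) p = _ :=
      ((((hasFDerivAt_slice (h₁ t p hp)).const_smul (Real.sin θ)).add
        ((hasFDerivAt_slice (h₂ t p hp)).const_smul (1 - Real.cos θ))).congr_of_eventuallyEq
        (hn.mono fun x hx => thetaAZero_eq_of_trig (hα t x hx) θ)).fderiv
    have e3 : deriv (fun τ => thetaAZero a Z τ θ p) t = _ :=
      ((((hasDerivAt_slice (h₁ t p hp)).const_smul (Real.sin θ)).add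
        ((hasDerivAt_slice (h₂ t p hp)).const_smul (1 - Real.cos θ))).congr_of_eventuallyEq
        (.of_forall fun τ => thetaAZero_eq_of_trig (hα τ p hp) θ)).deriv
    have id := corrector_identity (Real.cos_sq_add_sin_sq θ)
      (fderiv ℝ c₀ (t, p) (0, q)) (fderiv ℝ c₀ (t, p) (0, c₁ (t, p)))
      (fderiv ℝ c₀ (t, p) (0, c₂ (t, p))) (fderiv ℝ c₁ (t, p) (0, q))
      (fderiv ℝ c₁ (t, p) (0, c₁ (t, p))) (fderiv ℝ c₁ (t, p) (0, c₂ (t, p)))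
      (fderiv ℝ c₂ (t, p) (0, q)) (fderiv ℝ c₂ (t, p) (0, c₁ (t, p)))
      (fderiv ℝ c₂ (t, p) (0, c₂ (t, p))) (fderiv ℝ c₁ (t, p) (1, c₀ (t, p)))
      (fderiv ℝ c₂ (t, p) (1, c₀ (t, p)))
    rw [alphaOne, e1, e2, e3, aZero_eq_of_trig (hα t p hp), thetaAZero_eq_of_trig (hα t p hp),
      avgOne, hzero]
    refine sub_eq_zero.1 (Eq.trans ?_ (sub_eq_zero.2 id))
    simp only [add_apply, smul_apply,
      ContinuousLinearMap.comp_apply, ContinuousLinearMap.inr_apply, hzero, hsm,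
      hone c₁ (c₀ (t, p)), hone c₂ (c₀ (t, p))]
    module
  have : (2 * Real.pi) ≠ 0 := by positivity
  simp only [aOne, main, integral_corrector]
  rw [smul_smul, inv_mul_cancel₀ this, one_smul]

end TrigRecipe

/-! ### The fields and their derivatives in frame components -/

noncomputable section

/-- The vector with components `a, b, c` in the frame at `y`. -/
def frameVec (y : Fin 3 → ℝ) (a b c : ℝ) : Fin 3 → ℝ := a • eRad y + b • tor y + c • eZ

theorem cr_frameVec {y : Fin 3 → ℝ} (hy : y 0 ^ 2 + y 1 ^ 2 ≠ 0) (a b c : ℝ) :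
    cr y (frameVec y a b c) = a := by simp [frameVec, cr_eRad hy]

theorem ct_frameVec {y : Fin 3 → ℝ} (hy : y 0 ^ 2 + y 1 ^ 2 ≠ 0) (a b c : ℝ) :
    ct y (frameVec y a b c) = b := by simp [frameVec, ct_tor hy]

@[simp] theorem frameVec_two (y : Fin 3 → ℝ) (a b c : ℝ) : frameVec y a b c 2 = c := by
  simp [frameVec]

theorem hasDerivWithinAt_frameVec {y : ℝ → Fin 3 → ℝ} {y' : Fin 3 → ℝ} {s : ℝ} {S : Set ℝ}
    {a b c : ℝ → ℝ} {a' b' c' : ℝ} (hy : HasDerivWithinAt y y' S s)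
    (h0 : y s 0 ^ 2 + y s 1 ^ 2 ≠ 0) (ha : HasDerivWithinAt a a' S s)
    (hb : HasDerivWithinAt b b' S s) (hc : HasDerivWithinAt c c' S s) :
    HasDerivWithinAt (fun τ => frameVec (y τ) (a τ) (b τ) (c τ))
      (frameVec (y s) (a' - ct (y s) y' / rad (y s) * b s) (b' + ct (y s) y' / rad (y s) * a s)
        c') S s := by
  refine (((ha.smul (hasDerivWithinAt_eRad hy h0)).add
    (hb.smul (hasDerivWithinAt_tor hy h0))).add (hc.smul_const eZ)).congr_deriv ?_
  unfold frameVec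
  module

theorem gyro_mulVec_frame (θ : ℝ) (y w : Fin 3 → ℝ) :
    gyro θ y *ᵥ w = frameVec y (Real.cos θ * cr y w - Real.sin θ * w 2) (ct y w)
      (Real.cos θ * w 2 + Real.sin θ * cr y w) := by
  rw [gyro_mulVec, frameVec]; module

/-! ### Coefficients of the trigonometric polynomial `α⁰`

Here `e` is the value of the electric field. -/

/-- The mean of `α⁰`. -/
def meanCoeff (y u e : Fin 3 → ℝ) : (Fin 3 → ℝ) × (Fin 3 → ℝ) :=
  (frameVec y 0 (ct y u) 0,
    frameVec y (-(ct y u * (ct y u / rad y))) (ct y e + cr y u * (ct y u / rad y)) 0)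

/-- The coefficient of `cos θ` in `α⁰`. -/
def cosCoeff (y u e : Fin 3 → ℝ) : (Fin 3 → ℝ) × (Fin 3 → ℝ) :=
  (frameVec y (cr y u) 0 (u 2),
    frameVec y (cr y e + (1 + ct y u / rad y) * ct y u) (-((1 + ct y u / rad y) * cr y u)) (e 2))

/-- The coefficient of `sin θ` in `α⁰`. -/
def sinCoeff (y u e : Fin 3 → ℝ) : (Fin 3 → ℝ) × (Fin 3 → ℝ) :=
  (frameVec y (-u 2) 0 (cr y u),
    frameVec y (e 2) ((1 + ct y u / rad y) * u 2) (-(cr y e + (1 + ct y u / rad y) * ct y u)))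

/-- Derivative of the radial component of a moving vector. -/
def crDeriv (y w h w' : Fin 3 → ℝ) : ℝ := cr y w' + ct y h / rad y * ct y w

/-- Derivative of the toroidal component of a moving vector. -/
def ctDeriv (y w h w' : Fin 3 → ℝ) : ℝ := ct y w' - ct y h / rad y * cr y w

/-- Derivative of the angular velocity `u_φ / Ω`. -/
def angDeriv (y u h k : Fin 3 → ℝ) : ℝ :=
  (ctDeriv y u h k * rad y - ct y u * cr y h) / rad y ^ 2

/-- Derivative of `frameVec`. -/
def frameVecDeriv (y h : Fin 3 → ℝ) (a b a' b' c' : ℝ) : Fin 3 → ℝ :=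
  frameVec y (a' - ct y h / rad y * b) (b' + ct y h / rad y * a) c'

/-- Directional derivative of `meanCoeff`. -/
def meanCoeffDeriv (y u e h k e' : Fin 3 → ℝ) : (Fin 3 → ℝ) × (Fin 3 → ℝ) :=
  (frameVecDeriv y h 0 (ct y u) 0 (ctDeriv y u h k) 0,
    frameVecDeriv y h (-(ct y u * (ct y u / rad y))) (ct y e + cr y u * (ct y u / rad y))
      (-(ctDeriv y u h k * (ct y u / rad y) + ct y u * angDeriv y u h k))
      (ctDeriv y e h e' + (crDeriv y u h k * (ct y u / rad y) + cr y u * angDeriv y u h k)) 0)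

/-- Directional derivative of `cosCoeff`. -/
def cosCoeffDeriv (y u e h k e' : Fin 3 → ℝ) : (Fin 3 → ℝ) × (Fin 3 → ℝ) :=
  (frameVecDeriv y h (cr y u) 0 (crDeriv y u h k) 0 (k 2),
    frameVecDeriv y h (cr y e + (1 + ct y u / rad y) * ct y u) (-((1 + ct y u / rad y) * cr y u))
      (crDeriv y e h e' + (angDeriv y u h k * ct y u + (1 + ct y u / rad y) * ctDeriv y u h k))
      (-(angDeriv y u h k * cr y u + (1 + ct y u / rad y) * crDeriv y u h k)) (e' 2))

/-- Directional derivative of `sinCoeff`. -/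
def sinCoeffDeriv (y u e h k e' : Fin 3 → ℝ) : (Fin 3 → ℝ) × (Fin 3 → ℝ) :=
  (frameVecDeriv y h (-u 2) 0 (-k 2) 0 (crDeriv y u h k),
    frameVecDeriv y h (e 2) ((1 + ct y u / rad y) * u 2) (e' 2)
      (angDeriv y u h k * u 2 + (1 + ct y u / rad y) * k 2)
      (-(crDeriv y e h e' + (angDeriv y u h k * ct y u + (1 + ct y u / rad y) * ctDeriv y u h k))))

section Deriv

variable {y u e : ℝ → Fin 3 → ℝ} {h k e' : Fin 3 → ℝ} {s : ℝ} {S : Set ℝ}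

theorem hasDerivWithinAt_ang (hy : HasDerivWithinAt y h S s) (hu : HasDerivWithinAt u k S s)
    (h0 : y s 0 ^ 2 + y s 1 ^ 2 ≠ 0) :
    HasDerivWithinAt (fun τ => ct (y τ) (u τ) / rad (y τ)) (angDeriv (y s) (u s) h k) S s :=
  (hasDerivWithinAt_ct hy hu h0).div (hasDerivWithinAt_rad hy h0) (rad_ne_zero h0)

theorem hasDerivWithinAt_meanCoeff (hy : HasDerivWithinAt y h S s) (hu : HasDerivWithinAt u k S s)
    (he : HasDerivWithinAt e e' S s) (h0 : y s 0 ^ 2 + y s 1 ^ 2 ≠ 0) :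
    HasDerivWithinAt (fun τ => meanCoeff (y τ) (u τ) (e τ))
      (meanCoeffDeriv (y s) (u s) (e s) h k e') S s := by
  have ha := hasDerivWithinAt_ang hy hu h0
  have hct := hasDerivWithinAt_ct hy hu h0
  exact (hasDerivWithinAt_frameVec hy h0 (hasDerivWithinAt_const ..) hct
    (hasDerivWithinAt_const ..)).prodMk (hasDerivWithinAt_frameVec hy h0 (hct.mul ha).neg
    ((hasDerivWithinAt_ct hy he h0).add ((hasDerivWithinAt_cr hy hu h0).mul ha))
    (hasDerivWithinAt_const ..))

theorem hasDerivWithinAt_cosCoeff (hy : HasDerivWithinAt y h S s) (hu : HasDerivWithinAt u k S s)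
    (he : HasDerivWithinAt e e' S s) (h0 : y s 0 ^ 2 + y s 1 ^ 2 ≠ 0) :
    HasDerivWithinAt (fun τ => cosCoeff (y τ) (u τ) (e τ))
      (cosCoeffDeriv (y s) (u s) (e s) h k e') S s := by
  have ha := (hasDerivWithinAt_ang hy hu h0).const_add 1
  have hct := hasDerivWithinAt_ct hy hu h0
  have hcr := hasDerivWithinAt_cr hy hu h0
  exact (hasDerivWithinAt_frameVec hy h0 hcr (hasDerivWithinAt_const ..)
    (hasDerivWithinAt_pi.1 hu 2)).prodMk (hasDerivWithinAt_frameVec hy h0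
    ((hasDerivWithinAt_cr hy he h0).add (ha.mul hct)) (ha.mul hcr).neg
    (hasDerivWithinAt_pi.1 he 2))

theorem hasDerivWithinAt_sinCoeff (hy : HasDerivWithinAt y h S s) (hu : HasDerivWithinAt u k S s)
    (he : HasDerivWithinAt e e' S s) (h0 : y s 0 ^ 2 + y s 1 ^ 2 ≠ 0) :
    HasDerivWithinAt (fun τ => sinCoeff (y τ) (u τ) (e τ))
      (sinCoeffDeriv (y s) (u s) (e s) h k e') S s := by
  have ha := (hasDerivWithinAt_ang hy hu h0).const_add 1
  have hct := hasDerivWithinAt_ct hy hu h0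
  have hcr := hasDerivWithinAt_cr hy hu h0
  exact (hasDerivWithinAt_frameVec hy h0 (hasDerivWithinAt_pi.1 hu 2).neg
    (hasDerivWithinAt_const ..) hcr).prodMk (hasDerivWithinAt_frameVec hy h0
    (hasDerivWithinAt_pi.1 he 2) (ha.mul (hasDerivWithinAt_pi.1 hu 2))
    ((hasDerivWithinAt_cr hy he h0).add (ha.mul hct)).neg)

/-- Directional derivative of the fast flow. -/
def flowDeriv (θ : ℝ) (y u h k : Fin 3 → ℝ) : (Fin 3 → ℝ) × (Fin 3 → ℝ) :=
  (h, frameVecDeriv y h (Real.cos θ * cr y u - Real.sin θ * u 2) (ct y u)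
    (Real.cos θ * crDeriv y u h k - Real.sin θ * k 2) (ctDeriv y u h k)
    (Real.cos θ * k 2 + Real.sin θ * crDeriv y u h k))

theorem hasDerivWithinAt_flowZ {t θ : ℝ} (hy : HasDerivWithinAt y h S s)
    (hu : HasDerivWithinAt u k S s) (h0 : y s 0 ^ 2 + y s 1 ^ 2 ≠ 0) :
    HasDerivWithinAt (fun τ => flowZ t θ (y τ, u τ)) (flowDeriv θ (y s) (u s) h k) S s := by
  have hcr := hasDerivWithinAt_cr hy hu h0
  have hu2 := hasDerivWithinAt_pi.1 hu 2
  simp only [flowZ, gyro_mulVec_frame]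
  exact hy.prodMk (hasDerivWithinAt_frameVec hy h0 ((hcr.const_mul _).sub (hu2.const_mul _))
    (hasDerivWithinAt_ct hy hu h0) ((hu2.const_mul _).add (hcr.const_mul _)))

end Deriv

/-! ### Regularity off the axis -/

/-- Phase space without the axis. -/
def offAxis : Set ((Fin 3 → ℝ) × (Fin 3 → ℝ)) := {p | p.1 0 ^ 2 + p.1 1 ^ 2 ≠ 0}

theorem isOpen_offAxis : IsOpen offAxis := by
  have : Continuous fun p : (Fin 3 → ℝ) × (Fin 3 → ℝ) => p.1 0 ^ 2 + p.1 1 ^ 2 := by fun_prop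
  exact isOpen_ne_fun this continuous_const

section Smooth

variable {V : Type*} [NormedAddCommGroup V] [NormedSpace ℝ V] {n : WithTop ℕ∞}
  {y u e : V → Fin 3 → ℝ} {z : V}

theorem contDiffAt_rad (hy : ContDiffAt ℝ n y z) (h0 : y z 0 ^ 2 + y z 1 ^ 2 ≠ 0) :
    ContDiffAt ℝ n (fun v => rad (y v)) z := by
  have h := contDiffAt_pi.1 hy
  exact (((h 0).pow 2).add ((h 1).pow 2)).sqrt h0

theorem contDiffAt_cr (hy : ContDiffAt ℝ n y z) (hu : ContDiffAt ℝ n u z)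
    (h0 : y z 0 ^ 2 + y z 1 ^ 2 ≠ 0) : ContDiffAt ℝ n (fun v => cr (y v) (u v)) z := by
  have h := contDiffAt_pi.1 hy
  have h' := contDiffAt_pi.1 hu
  simp only [cr_eq]
  exact (((h' 0).mul (h 0)).add ((h' 1).mul (h 1))).div (contDiffAt_rad hy h0) (rad_ne_zero h0)

theorem contDiffAt_ct (hy : ContDiffAt ℝ n y z) (hu : ContDiffAt ℝ n u z)
    (h0 : y z 0 ^ 2 + y z 1 ^ 2 ≠ 0) : ContDiffAt ℝ n (fun v => ct (y v) (u v)) z := by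
  have h := contDiffAt_pi.1 hy
  have h' := contDiffAt_pi.1 hu
  simp only [ct_eq]
  exact (((h' 1).mul (h 0)).sub ((h' 0).mul (h 1))).div (contDiffAt_rad hy h0) (rad_ne_zero h0)

theorem contDiffAt_eRad (hy : ContDiffAt ℝ n y z) (h0 : y z 0 ^ 2 + y z 1 ^ 2 ≠ 0) :
    ContDiffAt ℝ n (fun v => eRad (y v)) z := by
  have h := contDiffAt_pi.1 hy
  have hr := contDiffAt_rad hy h0
  refine contDiffAt_pi.2 fun i => ?_
  fin_cases i
  · exact (h 0).div hr (rad_ne_zero h0)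
  · exact (h 1).div hr (rad_ne_zero h0)
  · exact contDiffAt_const

theorem contDiffAt_tor (hy : ContDiffAt ℝ n y z) (h0 : y z 0 ^ 2 + y z 1 ^ 2 ≠ 0) :
    ContDiffAt ℝ n (fun v => tor (y v)) z := by
  have h := contDiffAt_pi.1 hy
  have hr := contDiffAt_rad hy h0
  refine contDiffAt_pi.2 fun i => ?_
  fin_cases i
  · exact (h 1).neg.div hr (rad_ne_zero h0)
  · exact (h 0).div hr (rad_ne_zero h0)
  · exact contDiffAt_const

theorem contDiffAt_frameVec {a b c : V → ℝ} (hy : ContDiffAt ℝ n y z)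
    (h0 : y z 0 ^ 2 + y z 1 ^ 2 ≠ 0) (ha : ContDiffAt ℝ n a z) (hb : ContDiffAt ℝ n b z)
    (hc : ContDiffAt ℝ n c z) : ContDiffAt ℝ n (fun v => frameVec (y v) (a v) (b v) (c v)) z :=
  ((ha.smul (contDiffAt_eRad hy h0)).add (hb.smul (contDiffAt_tor hy h0))).add
    (hc.smul contDiffAt_const)

theorem contDiffAt_meanCoeff (hy : ContDiffAt ℝ n y z) (hu : ContDiffAt ℝ n u z)
    (he : ContDiffAt ℝ n e z) (h0 : y z 0 ^ 2 + y z 1 ^ 2 ≠ 0) :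
    ContDiffAt ℝ n (fun v => meanCoeff (y v) (u v) (e v)) z := by
  have hct := contDiffAt_ct hy hu h0
  have ha := hct.div (contDiffAt_rad hy h0) (rad_ne_zero h0)
  exact (contDiffAt_frameVec hy h0 contDiffAt_const hct contDiffAt_const).prodMk
    (contDiffAt_frameVec hy h0 (hct.mul ha).neg
      ((contDiffAt_ct hy he h0).add ((contDiffAt_cr hy hu h0).mul ha)) contDiffAt_const)

theorem contDiffAt_cosCoeff (hy : ContDiffAt ℝ n y z) (hu : ContDiffAt ℝ n u z)
    (he : ContDiffAt ℝ n e z) (h0 : y z 0 ^ 2 + y z 1 ^ 2 ≠ 0) :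
    ContDiffAt ℝ n (fun v => cosCoeff (y v) (u v) (e v)) z := by
  have hct := contDiffAt_ct hy hu h0
  have hcr := contDiffAt_cr hy hu h0
  have ha := contDiffAt_const (c := (1 : ℝ)).add
    (hct.div (contDiffAt_rad hy h0) (rad_ne_zero h0))
  exact (contDiffAt_frameVec hy h0 hcr contDiffAt_const (contDiffAt_pi.1 hu 2)).prodMk
    (contDiffAt_frameVec hy h0 ((contDiffAt_cr hy he h0).add (ha.mul hct)) (ha.mul hcr).neg
      (contDiffAt_pi.1 he 2))

theorem contDiffAt_sinCoeff (hy : ContDiffAt ℝ n y z) (hu : ContDiffAt ℝ n u z)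
    (he : ContDiffAt ℝ n e z) (h0 : y z 0 ^ 2 + y z 1 ^ 2 ≠ 0) :
    ContDiffAt ℝ n (fun v => sinCoeff (y v) (u v) (e v)) z := by
  have hct := contDiffAt_ct hy hu h0
  have hcr := contDiffAt_cr hy hu h0
  have ha := contDiffAt_const (c := (1 : ℝ)).add
    (hct.div (contDiffAt_rad hy h0) (rad_ne_zero h0))
  exact (contDiffAt_frameVec hy h0 (contDiffAt_pi.1 hu 2).neg contDiffAt_const hcr).prodMk
    (contDiffAt_frameVec hy h0 (contDiffAt_pi.1 he 2) (ha.mul (contDiffAt_pi.1 hu 2))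
      ((contDiffAt_cr hy he h0).add (ha.mul hct)).neg)

end Smooth

end

/-! ### Derivatives on phase space and transport of the slow field by the fast flow -/

noncomputable section

/-- Fréchet derivatives are evaluated along straight lines, so that the one-variable rules for
moving frames suffice. -/
theorem fderiv_apply_eq_of_line {V W : Type*} [NormedAddCommGroup V] [NormedSpace ℝ V]
    [NormedAddCommGroup W] [NormedSpace ℝ W] {f : V → W} {z v : V} {w : W}
    (hf : DifferentiableAt ℝ f z)
    (h : HasDerivWithinAt (fun τ : ℝ => f (z + τ • v)) w univ 0) : fderiv ℝ f z v = w := by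
  have h1 : HasDerivAt (fun τ : ℝ => z + τ • v) v 0 := by
    simpa using ((hasDerivAt_id (0 : ℝ)).smul_const v).const_add z
  have h2 : HasFDerivAt f (fderiv ℝ f z) (z + (0 : ℝ) • v) := by simpa using hf.hasFDerivAt
  exact (h2.comp_hasDerivAt (0 : ℝ) h1).unique (hasDerivWithinAt_univ.1 h)

theorem hasDerivWithinAt_line {V : Type*} [NormedAddCommGroup V] [NormedSpace ℝ V] (z v : V) :
    HasDerivWithinAt (fun τ : ℝ => z + τ • v) v univ 0 := by
  simpa using ((hasDerivWithinAt_id (0 : ℝ) univ).smul_const v).const_add z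

section Field

variable {E : ℝ → (Fin 3 → ℝ) → (Fin 3 → ℝ)}

theorem hasDerivWithinAt_field_line (hE : ContDiff ℝ 2 (fun p : ℝ × (Fin 3 → ℝ) => E p.1 p.2))
    (t δ : ℝ) (y h : Fin 3 → ℝ) :
    HasDerivWithinAt (fun τ : ℝ => E (t + τ • δ) (y + τ • h))
      (δ • deriv (fun τ => E τ y) t + fderiv ℝ (E t) y h) univ 0 := by
  have hd : DifferentiableAt ℝ (fun p : ℝ × (Fin 3 → ℝ) => E p.1 p.2) (t, y) :=
    hE.differentiable two_ne_zero _
  have e1 : deriv (fun τ => E τ y) t = _ := (hasDerivAt_slice hd).deriv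
  have e2 : fderiv ℝ (E t) y = _ := (hasFDerivAt_slice hd).fderiv
  have hd' : HasFDerivAt (fun p : ℝ × (Fin 3 → ℝ) => E p.1 p.2)
      (fderiv ℝ (fun p : ℝ × (Fin 3 → ℝ) => E p.1 p.2) (t, y)) (t + (0 : ℝ) • δ, y + (0 : ℝ) • h) :=
    by simpa using hd.hasFDerivAt
  refine (hd'.comp_hasDerivWithinAt (0 : ℝ)
    ((hasDerivWithinAt_line t δ).prodMk (hasDerivWithinAt_line y h))).congr_deriv ?_
  rw [e1, e2, ContinuousLinearMap.comp_apply, ContinuousLinearMap.inr_apply, ← map_smul, ← map_add]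
  simp

/-- The three coefficients as functions on extended phase space. -/
def meanField (E : ℝ → (Fin 3 → ℝ) → (Fin 3 → ℝ)) (z : ℝ × (Fin 3 → ℝ) × (Fin 3 → ℝ)) :
    (Fin 3 → ℝ) × (Fin 3 → ℝ) := meanCoeff z.2.1 z.2.2 (E z.1 z.2.1)

/-- See `meanField`. -/
def cosField (E : ℝ → (Fin 3 → ℝ) → (Fin 3 → ℝ)) (z : ℝ × (Fin 3 → ℝ) × (Fin 3 → ℝ)) :
    (Fin 3 → ℝ) × (Fin 3 → ℝ) := cosCoeff z.2.1 z.2.2 (E z.1 z.2.1)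

/-- See `meanField`. -/
def sinField (E : ℝ → (Fin 3 → ℝ) → (Fin 3 → ℝ)) (z : ℝ × (Fin 3 → ℝ) × (Fin 3 → ℝ)) :
    (Fin 3 → ℝ) × (Fin 3 → ℝ) := sinCoeff z.2.1 z.2.2 (E z.1 z.2.1)

variable (hE : ContDiff ℝ 2 (fun p : ℝ × (Fin 3 → ℝ) => E p.1 p.2))
  {z : ℝ × (Fin 3 → ℝ) × (Fin 3 → ℝ)} (hz : z.2 ∈ offAxis)
include hE

theorem contDiff_field_comp :
    ContDiff ℝ 2 (fun z : ℝ × (Fin 3 → ℝ) × (Fin 3 → ℝ) => E z.1 z.2.1) :=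
  hE.comp (contDiff_fst.prodMk (contDiff_fst.comp contDiff_snd))

include hz

theorem contDiffAt_meanField : ContDiffAt ℝ 2 (meanField E) z :=
  contDiffAt_meanCoeff (contDiff_fst.comp contDiff_snd).contDiffAt
    (contDiff_snd.comp contDiff_snd).contDiffAt (contDiff_field_comp hE).contDiffAt hz

theorem contDiffAt_cosField : ContDiffAt ℝ 2 (cosField E) z :=
  contDiffAt_cosCoeff (contDiff_fst.comp contDiff_snd).contDiffAt
    (contDiff_snd.comp contDiff_snd).contDiffAt (contDiff_field_comp hE).contDiffAt hz

theorem contDiffAt_sinField : ContDiffAt ℝ 2 (sinField E) z :=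
  contDiffAt_sinCoeff (contDiff_fst.comp contDiff_snd).contDiffAt
    (contDiff_snd.comp contDiff_snd).contDiffAt (contDiff_field_comp hE).contDiffAt hz

theorem fderiv_meanField (δ : ℝ) (h k : Fin 3 → ℝ) :
    fderiv ℝ (meanField E) z (δ, h, k) = meanCoeffDeriv z.2.1 z.2.2 (E z.1 z.2.1) h k
      (δ • deriv (fun τ => E τ z.2.1) z.1 + fderiv ℝ (E z.1) z.2.1 h) := by
  refine fderiv_apply_eq_of_line ((contDiffAt_meanField hE hz).differentiableAt two_ne_zero) ?_
  refine (hasDerivWithinAt_meanCoeff (hasDerivWithinAt_line z.2.1 h)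
    (hasDerivWithinAt_line z.2.2 k) (hasDerivWithinAt_field_line hE z.1 δ z.2.1 h)
    (by simpa using show z.2.1 0 ^ 2 + z.2.1 1 ^ 2 ≠ 0 from hz)).congr_deriv ?_
  simp

theorem fderiv_cosField (δ : ℝ) (h k : Fin 3 → ℝ) :
    fderiv ℝ (cosField E) z (δ, h, k) = cosCoeffDeriv z.2.1 z.2.2 (E z.1 z.2.1) h k
      (δ • deriv (fun τ => E τ z.2.1) z.1 + fderiv ℝ (E z.1) z.2.1 h) := by
  refine fderiv_apply_eq_of_line ((contDiffAt_cosField hE hz).differentiableAt two_ne_zero) ?_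
  refine (hasDerivWithinAt_cosCoeff (hasDerivWithinAt_line z.2.1 h)
    (hasDerivWithinAt_line z.2.2 k) (hasDerivWithinAt_field_line hE z.1 δ z.2.1 h)
    (by simpa using show z.2.1 0 ^ 2 + z.2.1 1 ^ 2 ≠ 0 from hz)).congr_deriv ?_
  simp

theorem fderiv_sinField (δ : ℝ) (h k : Fin 3 → ℝ) :
    fderiv ℝ (sinField E) z (δ, h, k) = sinCoeffDeriv z.2.1 z.2.2 (E z.1 z.2.1) h k
      (δ • deriv (fun τ => E τ z.2.1) z.1 + fderiv ℝ (E z.1) z.2.1 h) := by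
  refine fderiv_apply_eq_of_line ((contDiffAt_sinField hE hz).differentiableAt two_ne_zero) ?_
  refine (hasDerivWithinAt_sinCoeff (hasDerivWithinAt_line z.2.1 h)
    (hasDerivWithinAt_line z.2.2 k) (hasDerivWithinAt_field_line hE z.1 δ z.2.1 h)
    (by simpa using show z.2.1 0 ^ 2 + z.2.1 1 ^ 2 ≠ 0 from hz)).congr_deriv ?_
  simp

end Field

section Flow

variable {t θ : ℝ} {y u : Fin 3 → ℝ} (hy : y 0 ^ 2 + y 1 ^ 2 ≠ 0)
include hy

theorem contDiffAt_flowZ {n : WithTop ℕ∞} : ContDiffAt ℝ n (flowZ t θ) (y, u) := by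
  have h1 : ContDiffAt ℝ n (fun p : (Fin 3 → ℝ) × (Fin 3 → ℝ) => p.1) (y, u) := contDiffAt_fst
  have h2 : ContDiffAt ℝ n (fun p : (Fin 3 → ℝ) × (Fin 3 → ℝ) => p.2) (y, u) := contDiffAt_snd
  have e : flowZ t θ = fun p => (p.1, gyro θ p.1 *ᵥ p.2) := rfl
  have hcr := contDiffAt_cr h1 h2 hy
  have hu2 := contDiffAt_pi.1 h2 2
  simp only [e, gyro_mulVec_frame]
  exact h1.prodMk (contDiffAt_frameVec h1 hy
    ((contDiffAt_const.mul hcr).sub (contDiffAt_const.mul hu2)) (contDiffAt_ct h1 h2 hy)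
    ((contDiffAt_const.mul hu2).add (contDiffAt_const.mul hcr)))

theorem fderiv_flowZ (h k : Fin 3 → ℝ) :
    fderiv ℝ (flowZ t θ) (y, u) (h, k) = flowDeriv θ y u h k := by
  refine fderiv_apply_eq_of_line ((contDiffAt_flowZ hy (n := 1)).differentiableAt one_ne_zero) ?_
  refine (hasDerivWithinAt_flowZ (t := t) (hasDerivWithinAt_line y h)
    (hasDerivWithinAt_line u k) (by simpa using hy)).congr_deriv ?_
  simp

/-- The derivative is block triangular: its position part is the identity, and with `h = 0` the
velocity part is the rotation of `k`, which is undone by the inverse rotation. -/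
theorem fderiv_flowZ_injective : Function.Injective (fderiv ℝ (flowZ t θ) (y, u)) := by
  rw [injective_iff_map_eq_zero]
  rintro ⟨h, k⟩ hhk
  rw [fderiv_flowZ hy, flowDeriv, Prod.mk_eq_zero] at hhk
  obtain ⟨rfl, h2⟩ := hhk
  have h0 := Real.cos_sq_add_sin_sq θ
  have hr := congrArg (cr y) h2
  have ht := congrArg (ct y) h2
  have hz := congrFun h2 2
  simp only [frameVecDeriv, crDeriv, ctDeriv, cr_frameVec hy, ct_frameVec hy, frameVec_two, ct_zero,
    cr_zero, zero_div, zero_mul, add_zero, sub_zero, Pi.zero_apply] at hr ht hz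
  refine Prod.ext rfl (frame_ext hy ?_ ?_ ?_)
  · change cr y k = cr y 0
    rw [cr_zero]
    linear_combination Real.cos θ * hr + Real.sin θ * hz - cr y k * h0
  · simpa using ht
  · change k 2 = 0
    linear_combination Real.cos θ * hz - Real.sin θ * hr - k 2 * h0

end Flow

theorem inverse_apply_eq_of_injective {V : Type*} [NormedAddCommGroup V] [NormedSpace ℝ V]
    [FiniteDimensional ℝ V] {L : V →L[ℝ] V} (hL : Function.Injective L) {v w : V} (h : L v = w) :
    L.inverse w = v := by
  let e := (LinearEquiv.ofInjectiveEndo (L : V →ₗ[ℝ] V) hL).toContinuousLinearEquiv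
  have he : (e : V →L[ℝ] V) = L := by ext x; rfl
  rw [← he, ContinuousLinearMap.inverse_equiv, ← h, ← he]
  exact e.symm_apply_apply v

/-- The trigonometric polynomial `α⁰` is the slow field transported by the fast flow. -/
theorem flowDeriv_alphaZero (E : ℝ → (Fin 3 → ℝ) → (Fin 3 → ℝ)) (t θ : ℝ) {y u : Fin 3 → ℝ}
    (hy : y 0 ^ 2 + y 1 ^ 2 ≠ 0) :
    flowDeriv θ y u (meanField E (t, y, u) + Real.cos θ • cosField E (t, y, u)
      + Real.sin θ • sinField E (t, y, u)).1 (meanField E (t, y, u)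
      + Real.cos θ • cosField E (t, y, u) + Real.sin θ • sinField E (t, y, u)).2
      = slowField E t θ (flowZ t θ (y, u)) := by
  have r0 := rad_ne_zero hy
  have h0 := Real.cos_sq_add_sin_sq θ
  simp only [meanField, cosField, sinField, meanCoeff, cosCoeff, sinCoeff, Prod.smul_mk,
    Prod.mk_add_mk, flowDeriv, slowField, flowZ, cross_eZ hy, frameVecDeriv, crDeriv, ctDeriv]
  refine Prod.ext (frame_ext hy ?_ ?_ ?_) (frame_ext hy ?_ ?_ ?_) <;>
  simp only [cr_add, ct_add, cr_sub, ct_sub, cr_smul, ct_smul, cr_frameVec hy, ct_frameVec hy,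
    cr_eRad hy, ct_tor hy, cr_tor, ct_eRad, Pi.add_apply, Pi.smul_apply, smul_eq_mul, frameVec_two,
    gyro_mulVec_frame, Pi.sub_apply, eRad_two, tor_two]
  · ring
  · ring
  · ring
  · linear_combination (cr y (E t y) + (1 + ct y u / rad y) * ct y u) * h0
  · ring
  · linear_combination E t y 2 * h0

/-- As the derivative of the flow is invertible, it suffices to push the candidate forward. The time
derivative in the recipe vanishes because `flowZ` does not depend on `t`. -/
theorem alphaZero_eq (E : ℝ → (Fin 3 → ℝ) → (Fin 3 → ℝ)) (t θ : ℝ) {y u : Fin 3 → ℝ}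
    (hy : y 0 ^ 2 + y 1 ^ 2 ≠ 0) :
    alphaZero (slowField E) flowZ t θ (y, u) = meanField E (t, y, u)
      + Real.cos θ • cosField E (t, y, u) + Real.sin θ • sinField E (t, y, u) := by
  refine inverse_apply_eq_of_injective (fderiv_flowZ_injective hy) ?_
  have hconst : deriv (fun τ => flowZ τ θ (y, u)) t = 0 := deriv_const t (flowZ t θ (y, u))
  rw [hconst, sub_zero, ← flowDeriv_alphaZero E t θ hy]
  exact fderiv_flowZ hy _ _

end

/-! ### Identification with the Cartesian formulas of the statement -/

noncomputable section

theorem meanCoeff_eq {y : Fin 3 → ℝ} (hy : y 0 ^ 2 + y 1 ^ 2 ≠ 0) (u e : Fin 3 → ℝ) :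
    meanCoeff y u e = (rhsYZero y u, rhsUZero y u e) := by
  have r0 := rad_ne_zero hy
  have h2 := rad_sq y
  refine Prod.ext (funext fun i => ?_) (funext fun i => ?_) <;> fin_cases i <;>
  simp [meanCoeff, frameVec, rhsYZero, rhsUZero, Abar, betaBar, parallelPart, ct_eq, cr_eq, tor,
    eRad, eZ, ← h2, Matrix.mulVec, dotProduct, Fin.sum_univ_three, cross_apply, Matrix.vecHead,
    Matrix.vecTail] <;>
  field_simp <;> ring_nf <;> (try simp only [h2]) <;> ring

theorem flowDeriv_eq {y : Fin 3 → ℝ} (hy : y 0 ^ 2 + y 1 ^ 2 ≠ 0) (θ : ℝ) (u η μ e : Fin 3 → ℝ) :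
    flowDeriv θ y u
      (η + (Real.sin θ • (cosCoeff y u e).1 + (1 - Real.cos θ) • (sinCoeff y u e).1))
      (μ + (Real.sin θ • (cosCoeff y u e).2 + (1 - Real.cos θ) • (sinCoeff y u e).2))
      = (posOne θ y u η, velOne θ y u η μ e) := by
  have r0 := rad_ne_zero hy
  have h2 := rad_sq y
  have h0 := Real.cos_sq_add_sin_sq θ
  simp only [flowDeriv]
  refine Prod.ext ?_ ?_
  · refine funext fun i => ?_
    fin_cases i <;>
    simp [posOne, cosCoeff, sinCoeff, frameVec, ct_eq, cr_eq, tor, eRad, eZ] <;>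
    field_simp <;> ring_nf
  -- The Cartesian expression is first resolved in the frame, using `Ω² = y₁² + y₂²` alone; the
  -- comparison that follows then needs only `cos² + sin² = 1`.
  · have hv : velOne θ y u η μ e = frameVec y
        (Real.cos θ * (cr y μ + ct y η / rad y * ct y u + e 2)
          + Real.sin θ * (cr y e + (1 + ct y u / rad y) * ct y u - μ 2) - e 2
          - ct y η / rad y * ct y u)
        (ct y μ - Real.sin θ * ((1 + ct y u / rad y) * cr y u)
          + (1 - Real.cos θ) * ((1 + ct y u / rad y) * u 2) - ct y η / rad y * cr y u
          + ct y η / rad y * (Real.cos θ * cr y u - Real.sin θ * u 2))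
        (Real.cos θ * (μ 2 - (cr y e + (1 + ct y u / rad y) * ct y u))
          + Real.sin θ * (cr y μ + e 2 + ct y η / rad y * ct y u)
          + (cr y e + (1 + ct y u / rad y) * ct y u)) := by
      have h3 : rad y ^ 3 = (y 0 ^ 2 + y 1 ^ 2) * rad y := by rw [← h2]; ring
      have h4 : rad y ^ 4 = (y 0 ^ 2 + y 1 ^ 2) ^ 2 := by rw [← h2]; ring
      refine funext fun i => ?_
      fin_cases i <;>
      simp [velOne, frameVec, ct_eq, cr_eq, tor, eRad, eZ] <;>
      field_simp <;> ring_nf <;> (try simp only [h2, h3, h4]) <;> ring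
    rw [hv]
    refine frame_ext hy ?_ ?_ ?_ <;>
    simp only [cosCoeff, sinCoeff, frameVecDeriv, crDeriv, ctDeriv, cr_add, ct_add, cr_smul,
      ct_smul, cr_frameVec hy, ct_frameVec hy, Pi.add_apply, Pi.smul_apply, smul_eq_mul,
      frameVec_two]
    · linear_combination -e 2 * h0
    · ring
    · linear_combination (cr y e + (1 + ct y u / rad y) * ct y u) * h0

theorem rhsYOne_eq {y : Fin 3 → ℝ} (hy : y 0 ^ 2 + y 1 ^ 2 ≠ 0) (u η μ e : Fin 3 → ℝ) :
    rhsYOne y u η μ e = frameVec y (-(ct y η / rad y * ct y u) - e 2)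
      (ct y μ + (1 + 2 * (ct y u / rad y)) * u 2 - ct y η / rad y * cr y u)
      (cr y e + (1 + ct y u / rad y) * ct y u) := by
  have r0 := rad_ne_zero hy
  have h2 := rad_sq y
  have h3 : rad y ^ 3 = (y 0 ^ 2 + y 1 ^ 2) * rad y := by rw [← h2]; ring
  refine funext fun i => ?_
  fin_cases i <;>
  simp [rhsYOne, frameVec, ct_eq, cr_eq, tor, eRad, eZ] <;>
  field_simp <;> ring_nf <;> (try simp only [h2, h3]) <;> ring

/-- The three directional derivatives are inserted in `avgOne` and compared by frame components. The
Jacobian is kept as an abstract linear map and expanded on the frame only in the velocity part,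
since the position part does not involve it. -/
theorem avgOne_eq {E : ℝ → (Fin 3 → ℝ) → (Fin 3 → ℝ)}
    (hE : ContDiff ℝ 2 (fun p : ℝ × (Fin 3 → ℝ) => E p.1 p.2)) (t : ℝ) {y : Fin 3 → ℝ}
    (hy : y 0 ^ 2 + y 1 ^ 2 ≠ 0) (u η μ : Fin 3 → ℝ) :
    avgOne (meanField E) (cosField E) (sinField E) (t, y, u) (η, μ) = (rhsYOne y u η μ (E t y),
      rhsUOne y u η μ (E t y) (deriv (fun τ => E τ y) t) (fderiv ℝ (E t) y)) := by
  have r0 := rad_ne_zero hy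
  have hz : ((t, y, u) : ℝ × (Fin 3 → ℝ) × (Fin 3 → ℝ)).2 ∈ offAxis := hy
  rw [avgOne]
  simp only [meanField, cosField, sinField]
  generalize hD : fderiv ℝ (E t) y = D
  generalize hd : deriv (fun τ => E τ y) t = e'
  have key : ∀ v : (Fin 3 → ℝ) × (Fin 3 → ℝ), ∀ δ : ℝ,
      fderiv ℝ (meanField E) (t, y, u) (δ, v)
        = meanCoeffDeriv y u (E t y) v.1 v.2 (δ • e' + D v.1) ∧
      fderiv ℝ (cosField E) (t, y, u) (δ, v)
        = cosCoeffDeriv y u (E t y) v.1 v.2 (δ • e' + D v.1) ∧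
      fderiv ℝ (sinField E) (t, y, u) (δ, v)
        = sinCoeffDeriv y u (E t y) v.1 v.2 (δ • e' + D v.1) := fun v δ => by
    rw [← hD, ← hd]
    exact ⟨fderiv_meanField hE hz δ v.1 v.2, fderiv_cosField hE hz δ v.1 v.2,
      fderiv_sinField hE hz δ v.1 v.2⟩
  change fderiv ℝ (meanField E) (t, y, u) (0, _) - fderiv ℝ (sinField E) (t, y, u) (1, _)
    + (1 / 2 : ℝ) • (fderiv ℝ (sinField E) (t, y, u) (0, _)
      - fderiv ℝ (cosField E) (t, y, u) (0, _)) = _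
  rw [(key _ _).1, (key _ _).2.2, (key _ _).2.2, (key _ _).2.1, rhsYOne_eq hy]
  generalize E t y = e
  refine Prod.ext (frame_ext hy ?_ ?_ ?_) (frame_ext hy ?_ ?_ ?_) <;>
  simp only [rhsUOne, meanCoeff, cosCoeff, sinCoeff, meanCoeffDeriv, cosCoeffDeriv, sinCoeffDeriv,
    angDeriv, frameVecDeriv, crDeriv, ctDeriv, Prod.fst_add, Prod.snd_add, Prod.fst_sub,
    Prod.snd_sub, Prod.smul_fst, Prod.smul_snd,
    cr_add, ct_add, cr_sub, ct_sub, cr_smul, ct_smul, cr_frameVec hy, ct_frameVec hy, cr_eRad hy,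
    ct_tor hy, cr_tor, ct_eRad, cr_eZ, ct_eZ, eZ_two, eRad_two, tor_two, Pi.sub_apply,
    Pi.add_apply, Pi.smul_apply, smul_eq_mul, frameVec_two, zero_smul, zero_add, one_smul, map_add]
  · ring
  · ring
  · ring
  all_goals simp only [frameVec, map_add, map_smul, cr_add, ct_add, cr_smul, ct_smul, Pi.add_apply,
    Pi.smul_apply, smul_eq_mul, Pi.zero_apply]
  · field_simp
    ring
  · field_simp
    ring
  · field_simp
    ring

/-- The explicit form of the fields produced by the averaging recipe. -/
theorem recipe_eq {E : ℝ → (Fin 3 → ℝ) → (Fin 3 → ℝ)}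
    (hE : ContDiff ℝ 2 (fun p : ℝ × (Fin 3 → ℝ) => E p.1 p.2)) (t : ℝ) (y u : Fin 3 → ℝ)
    (hy : y 0 ^ 2 + y 1 ^ 2 ≠ 0) :
    aZero (slowField E) flowZ t (y, u) = (rhsYZero y u, rhsUZero y u (E t y)) ∧
      ∀ η μ : Fin 3 → ℝ,
        aOne (slowField E) flowZ t (y, u) (η, μ) =
          (rhsYOne y u η μ (E t y),
            rhsUOne y u η μ (E t y) (deriv (fun τ => E τ y) t) (fderiv ℝ (E t) y)) ∧
        ∀ θ : ℝ, xOne (slowField E) flowZ t θ (y, u) (η, μ) =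
          (posOne θ y u η, velOne θ y u η μ (E t y)) := by
  refine ⟨(aZero_eq_of_trig fun θ => alphaZero_eq E t θ hy).trans (meanCoeff_eq hy u (E t y)),
    fun η μ => ⟨?_, fun θ => ?_⟩⟩
  · rw [← avgOne_eq hE t hy]
    exact aOne_eq_of_trig isOpen_offAxis
      (fun t p hp => (contDiffAt_meanField hE hp).differentiableAt two_ne_zero)
      (fun t p hp => (contDiffAt_cosField hE hp).differentiableAt two_ne_zero)
      (fun t p hp => (contDiffAt_sinField hE hp).differentiableAt two_ne_zero)
      (fun t p hp θ => alphaZero_eq E t θ hp) hy (η, μ)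
  · rw [xOne, thetaAZero_eq_of_trig fun θ => alphaZero_eq E t θ hy, ← flowDeriv_eq hy]
    exact fderiv_flowZ hy _ _

end

/-! ### Localisation of the averaging theorem to an open set -/

section Local

variable {V W X : Type*} [NormedAddCommGroup V] [NormedSpace ℝ V] [NormedAddCommGroup W]
  [NormedSpace ℝ W] [NormedAddCommGroup X] [NormedSpace ℝ X]

theorem exists_contDiff_hasCompactSupport_eqOn [FiniteDimensional ℝ V] {f : V → X} {S K : Set V}
    (hS : IsOpen S) (hf : ContDiffOn ℝ 2 f S) (hK : IsCompact K) (hKS : K ⊆ S) :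
    ∃ g : V → X, ContDiff ℝ 2 g ∧ HasCompactSupport g ∧
      ∃ O, IsOpen O ∧ K ⊆ O ∧ O ⊆ S ∧ EqOn g f O := by
  obtain ⟨χ, hχ, hχc, hχS, -, O, hO, hKO, h1⟩ := exists_contDiff_cutoff hK hS hKS
  refine ⟨fun z => χ z • f z, contDiff_cutoff_smul hS hχ hχS hf, hχc.smul_right, O ∩ S,
    hO.inter hS, subset_inter hKO hKS, inter_subset_right, fun z hz => ?_⟩
  simp only [h1 z hz.1, one_smul]

theorem fderiv_eq_of_eqOn {f g : V → X} {O : Set V} (hO : IsOpen O) (h : EqOn g f O) {z : V}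
    (hz : z ∈ O) : fderiv ℝ g z = fderiv ℝ f z :=
  (h.eventuallyEq_of_mem (hO.mem_nhds hz)).fderiv_eq

/-- First-order expansion of an observable along a curve and a perturbation of it. -/
theorem exists_norm_slope_sub_le [FiniteDimensional ℝ W] {f : ℝ × W → X} {S : Set (ℝ × W)}
    (hS : IsOpen S) (hf : ContDiffOn ℝ 2 f S) {a b : ℝ} {p : ℝ → W}
    (hp : ContinuousOn p (Icc a b)) (hpS : ∀ t ∈ Icc a b, (t, p t) ∈ S) {G M : ℝ} (hG : 0 ≤ G)
    (hM : 0 ≤ M) :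
    ∃ (C ε₀ : ℝ), 0 ≤ C ∧ 0 < ε₀ ∧ ∀ ε, 0 < ε → ε < ε₀ → ∀ t ∈ Icc a b, ∀ w g : W, ‖g‖ ≤ G →
      ‖w - (p t + ε • g)‖ ≤ M * ε ^ 2 →
      ‖ε⁻¹ • (f (t, w) - f (t, p t)) - fderiv ℝ f (t, p t) (0, g)‖ ≤ C * ε := by
  have hK : IsCompact ((fun t => (t, p t)) '' Icc a b) :=
    isCompact_Icc.image_of_continuousOn (continuousOn_id.prodMk hp)
  obtain ⟨φ, hφ, hφc, O, hO, hKO, -, hφO⟩ := exists_contDiff_hasCompactSupport_eqOn hS hf hK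
    (by rintro _ ⟨t, ht, rfl⟩; exact hpS t ht)
  obtain ⟨δ, hδ, hδO⟩ := hK.exists_thickening_subset_open hO hKO
  obtain ⟨T, hT, hTay⟩ := exists_norm_taylor_le hφ hφc
  obtain ⟨K, hKL⟩ := ContDiff.lipschitzWith_of_hasCompactSupport (𝕂 := ℝ) hφc hφ two_ne_zero
  -- For `ε < 1` the displacement is at most `ε (G + M)`, and the second condition on `ε` keeps `w`
  -- where `φ = f`. The first term of the constant is the Taylor error, the second the effect of the
  -- `M ε²` discrepancy on the linear part.
  refine ⟨T * (G + M) ^ 2 + K * M, min 1 (δ / (G + M + 1)), by positivity, by positivity,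
    fun ε hε hε0 t ht w g hg hw => ?_⟩
  have hε1 : ε < 1 := hε0.trans_le (min_le_left _ _)
  have hε2 : ε * (G + M + 1) < δ :=
    (lt_div_iff₀ (by positivity)).1 (hε0.trans_le (min_le_right _ _))
  have hmem : (t, p t) ∈ (fun t => (t, p t)) '' Icc a b := ⟨t, ht, rfl⟩
  have hd : w - p t = ε • g + (w - (p t + ε • g)) := by abel
  have hnorm : ‖w - p t‖ ≤ ε * (G + M) := by
    rw [hd]
    refine (norm_add_le _ _).trans ?_
    rw [norm_smul, Real.norm_of_nonneg hε.le, mul_add]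
    refine add_le_add (mul_le_mul_of_nonneg_left hg hε.le) (hw.trans ?_)
    nlinarith [mul_nonneg hM hε.le]
  have hnorm' : ‖((0 : ℝ), w - p t)‖ ≤ ε * (G + M) := by simpa [Prod.norm_def] using hnorm
  have hwO : (t, w) ∈ O := by
    refine hδO (mem_thickening_iff.2 ⟨_, hmem, ?_⟩)
    have : dist (t, w) (t, p t) = ‖w - p t‖ := by simp [dist_eq_norm]
    rw [this]
    nlinarith
  have hpO := hKO hmem
  rw [← hφO hwO, ← hφO hpO, ← fderiv_eq_of_eqOn hO hφO hpO]
  have h1 : ‖φ (t, w) - φ (t, p t) - fderiv ℝ φ (t, p t) (0, w - p t)‖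
      ≤ T * (ε * (G + M)) ^ 2 := by
    have := hTay (t, p t) (0, w - p t)
    simp only [Prod.mk_add_mk, add_zero, add_sub_cancel] at this
    exact this.trans (mul_le_mul_of_nonneg_left (pow_le_pow_left₀ (norm_nonneg _) hnorm' 2) hT)
  have h2 : ‖ε⁻¹ • (w - p t) - g‖ ≤ M * ε := by
    have : ε⁻¹ • (w - p t) - g = ε⁻¹ • (w - (p t + ε • g)) := by
      rw [← sub_sub, smul_sub _ (w - p t), smul_smul, inv_mul_cancel₀ hε.ne', one_smul]
    rw [this, norm_smul, norm_inv, Real.norm_of_nonneg hε.le, inv_mul_le_iff₀ hε]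
    linarith [hw]
  have h3 : ‖fderiv ℝ φ (t, p t) (0, ε⁻¹ • (w - p t) - g)‖ ≤ K * (M * ε) := by
    refine ((fderiv ℝ φ (t, p t)).le_opNorm _).trans ?_
    refine mul_le_mul (norm_fderiv_le_of_lipschitz ℝ hKL) ?_ (norm_nonneg _) K.2
    simpa [Prod.norm_def] using h2
  have h4 : ε⁻¹ • (φ (t, w) - φ (t, p t)) - fderiv ℝ φ (t, p t) (0, g)
      = ε⁻¹ • (φ (t, w) - φ (t, p t) - fderiv ℝ φ (t, p t) (0, w - p t))
        + fderiv ℝ φ (t, p t) (0, ε⁻¹ • (w - p t) - g) := by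
    have e1 : ((0 : ℝ), ε⁻¹ • (w - p t) - g) = ε⁻¹ • ((0 : ℝ), w - p t) - ((0 : ℝ), g) := by simp
    rw [e1, map_sub, map_smul]
    module
  rw [h4, add_mul]
  refine (norm_add_le _ _).trans (add_le_add ?_ (h3.trans_eq (by ring)))
  rw [norm_smul, norm_inv, Real.norm_of_nonneg hε.le, inv_mul_le_iff₀ hε]
  exact h1.trans_eq (by ring)

variable [FiniteDimensional ℝ W] {S : Set (ℝ × W)} {c₀ c₁ c₂ : ℝ × W → W}

/-- `avgOne` is affine in `q`, with linear part the spatial derivative of `c₀`, and its coefficients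
are continuous along `p`. -/
theorem exists_orderOne (hS : IsOpen S) (h₀ : ContDiffOn ℝ 2 c₀ S) (h₁ : ContDiffOn ℝ 2 c₁ S)
    (h₂ : ContDiffOn ℝ 2 c₂ S) {a b : ℝ} (hab : a ≤ b) {p : ℝ → W}
    (hp : ContinuousOn p (Icc a b)) (hpS : ∀ t ∈ Icc a b, (t, p t) ∈ S) :
    ∃ q : ℝ → W, q a = 0 ∧
      ∀ t ∈ Icc a b, HasDerivWithinAt q (avgOne c₀ c₁ c₂ (t, p t) (q t)) (Icc a b) t := by
  have hz : ContinuousOn (fun t => (t, p t)) (Icc a b) := continuousOn_id.prodMk hp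
  have hc : ∀ c : ℝ × W → W, ContDiffOn ℝ 2 c S →
      ContinuousOn (fun t => c (t, p t)) (Icc a b) := fun c h =>
    h.continuousOn.comp hz hpS
  have hd : ∀ c : ℝ × W → W, ContDiffOn ℝ 2 c S →
      ContinuousOn (fun t => fderiv ℝ c (t, p t)) (Icc a b) := fun c h =>
    (h.continuousOn_fderiv_of_isOpen hS (by norm_num)).comp hz hpS
  obtain ⟨q, hq0, hq⟩ := exists_hasDerivWithinAt_linear hab
    (A := fun t => (fderiv ℝ c₀ (t, p t)).comp (ContinuousLinearMap.inr ℝ ℝ W))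
    (g := fun t => fderiv ℝ c₀ (t, p t) (0, c₂ (t, p t)) - fderiv ℝ c₂ (t, p t) (1, c₀ (t, p t))
      + (1 / 2 : ℝ) • (fderiv ℝ c₂ (t, p t) (0, c₁ (t, p t))
        - fderiv ℝ c₁ (t, p t) (0, c₂ (t, p t))))
    ((hd c₀ h₀).clm_comp continuousOn_const)
    ((((hd c₀ h₀).clm_apply (continuousOn_const.prodMk (hc c₂ h₂))).sub
      ((hd c₂ h₂).clm_apply (continuousOn_const.prodMk (hc c₀ h₀)))).add
      ((((hd c₂ h₂).clm_apply (continuousOn_const.prodMk (hc c₁ h₁))).sub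
      ((hd c₁ h₁).clm_apply (continuousOn_const.prodMk (hc c₂ h₂)))).const_smul _)) 0
  refine ⟨q, hq0, fun t ht => (hq t ht).congr_deriv ?_⟩
  have e : ((0 : ℝ), q t + c₂ (t, p t)) = ((0 : ℝ), q t) + ((0 : ℝ), c₂ (t, p t)) := by simp
  rw [avgOne, e, map_add, ContinuousLinearMap.comp_apply, ContinuousLinearMap.inr_apply]
  abel

omit [FiniteDimensional ℝ W] in
theorem orderOne_eqOn (hS : IsOpen S) (h₀ : ContDiffOn ℝ 2 c₀ S) {a b : ℝ} {p : ℝ → W}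
    (hp : ContinuousOn p (Icc a b)) (hpS : ∀ t ∈ Icc a b, (t, p t) ∈ S) {q q' : ℝ → W}
    (hq : ∀ t ∈ Icc a b, HasDerivWithinAt q (avgOne c₀ c₁ c₂ (t, p t) (q t)) (Icc a b) t)
    (hq' : ∀ t ∈ Icc a b, HasDerivWithinAt q' (avgOne c₀ c₁ c₂ (t, p t) (q' t)) (Icc a b) t)
    (h : q' a = q a) : EqOn q' q (Icc a b) := by
  have hz : ContinuousOn (fun t => (t, p t)) (Icc a b) := continuousOn_id.prodMk hp
  obtain ⟨K, hK⟩ := isCompact_Icc.exists_bound_of_continuousOn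
    ((h₀.continuousOn_fderiv_of_isOpen hS (by norm_num)).comp hz hpS)
  have := eq_zero_of_abs_deriv_le_mul_abs_self_of_eq_zero_right (K := K)
    (f := fun t => q' t - q t) (a := a) (b := b)
    (fun t ht => ((hq' t ht).sub (hq t ht)).continuousWithinAt)
    (fun t ht => hasDerivWithinAt_Ici_of_Icc ht
      ((hq' t (Ico_subset_Icc_self ht)).sub (hq t (Ico_subset_Icc_self ht))))
    (by simp [h]) (fun t ht => ?_)
  · exact fun t ht => sub_eq_zero.1 (this t ht)
  · have e : avgOne c₀ c₁ c₂ (t, p t) (q' t) - avgOne c₀ c₁ c₂ (t, p t) (q t)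
        = fderiv ℝ c₀ (t, p t) (0, q' t - q t) := by
      have e1 : ((0 : ℝ), q' t - q t)
          = ((0 : ℝ), q' t + c₂ (t, p t)) - ((0 : ℝ), q t + c₂ (t, p t)) := by simp
      rw [avgOne, avgOne, e1, map_sub]
      abel
    rw [e]
    refine ((fderiv ℝ c₀ (t, p t)).le_opNorm _).trans ?_
    have : ‖((0 : ℝ), q' t - q t)‖ = ‖q' t - q t‖ := by simp [Prod.norm_def]
    rw [this]
    exact mul_le_mul_of_nonneg_right (hK t (Ico_subset_Icc_self ht)) (norm_nonneg _)

/-- Second-order averaging for coefficients which are smooth on an open set: for small `ε` the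
oscillating equation has a solution, with the expected expansion. -/
theorem exists_averaging (hS : IsOpen S) (h₀ : ContDiffOn ℝ 2 c₀ S) (h₁ : ContDiffOn ℝ 2 c₁ S)
    (h₂ : ContDiffOn ℝ 2 c₂ S) {a b : ℝ} (hab : a < b) {p q : ℝ → W}
    (hp : ∀ t ∈ Icc a b, HasDerivWithinAt p (c₀ (t, p t)) (Icc a b) t)
    (hpS : ∀ t ∈ Icc a b, (t, p t) ∈ S)
    (hq : ∀ t ∈ Icc a b, HasDerivWithinAt q (avgOne c₀ c₁ c₂ (t, p t) (q t)) (Icc a b) t)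
    (hq0 : q a = 0) :
    ∃ M G ε₀ : ℝ, 0 ≤ M ∧ 0 ≤ G ∧ 0 < ε₀ ∧
      (∀ t ∈ Icc a b, ∀ θ, ‖q t + Real.sin θ • c₁ (t, p t)
        + (1 - Real.cos θ) • c₂ (t, p t)‖ ≤ G) ∧
      ∀ ε : ℝ, 0 < ε → ε < ε₀ → ∃ P : ℝ → W, P a = p a ∧ ∀ t ∈ Icc a b, (t, P t) ∈ S ∧
        HasDerivWithinAt P (c₀ (t, P t) + Real.cos ((t - a) / ε) • c₁ (t, P t)
          + Real.sin ((t - a) / ε) • c₂ (t, P t)) (Icc a b) t ∧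
        ‖P t - (p t + ε • (q t + Real.sin ((t - a) / ε) • c₁ (t, p t)
          + (1 - Real.cos ((t - a) / ε)) • c₂ (t, p t)))‖ ≤ M * ε ^ 2 := by
  have := FiniteDimensional.complete ℝ W
  have cp : ContinuousOn p (Icc a b) := fun t ht => (hp t ht).continuousWithinAt
  have cq : ContinuousOn q (Icc a b) := fun t ht => (hq t ht).continuousWithinAt
  have hK : IsCompact ((fun t => (t, p t)) '' Icc a b) :=
    isCompact_Icc.image_of_continuousOn (continuousOn_id.prodMk cp)
  have hKS : (fun t => (t, p t)) '' Icc a b ⊆ S := by rintro _ ⟨t, ht, rfl⟩; exact hpS t ht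
  obtain ⟨f₀, hf₀, hc₀, O₀, hO₀, hK₀, hOS, e₀⟩ :=
    exists_contDiff_hasCompactSupport_eqOn hS h₀ hK hKS
  obtain ⟨f₁, hf₁, hc₁, O₁, hO₁, hK₁, -, e₁⟩ :=
    exists_contDiff_hasCompactSupport_eqOn hS h₁ hK hKS
  obtain ⟨f₂, hf₂, hc₂, O₂, hO₂, hK₂, -, e₂⟩ :=
    exists_contDiff_hasCompactSupport_eqOn hS h₂ hK hKS
  obtain ⟨δ, hδ, hδO⟩ := hK.exists_thickening_subset_open ((hO₀.inter hO₁).inter hO₂)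
    (subset_inter (subset_inter hK₀ hK₁) hK₂)
  obtain ⟨L₀, hL₀⟩ := ContDiff.lipschitzWith_of_hasCompactSupport (𝕂 := ℝ) hc₀ hf₀ two_ne_zero
  obtain ⟨L₁, hL₁⟩ := ContDiff.lipschitzWith_of_hasCompactSupport (𝕂 := ℝ) hc₁ hf₁ two_ne_zero
  obtain ⟨L₂, hL₂⟩ := ContDiff.lipschitzWith_of_hasCompactSupport (𝕂 := ℝ) hc₂ hf₂ two_ne_zero
  obtain ⟨C₀, hC₀⟩ := hc₀.exists_bound_of_continuous hf₀.continuous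
  obtain ⟨C₁, hC₁⟩ := hc₁.exists_bound_of_continuous hf₁.continuous
  obtain ⟨C₂, hC₂⟩ := hc₂.exists_bound_of_continuous hf₂.continuous
  obtain ⟨Cq, hCq⟩ := isCompact_Icc.exists_bound_of_continuousOn cq
  have hC₀' : 0 ≤ C₀ := (norm_nonneg _).trans (hC₀ 0)
  have hC₁' : 0 ≤ C₁ := (norm_nonneg _).trans (hC₁ 0)
  have hC₂' : 0 ≤ C₂ := (norm_nonneg _).trans (hC₂ 0)
  have hCq' : 0 ≤ Cq := (norm_nonneg _).trans (hCq a (left_mem_Icc.2 hab.le))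
  have ep : ∀ t ∈ Icc a b, f₀ (t, p t) = c₀ (t, p t) ∧ f₁ (t, p t) = c₁ (t, p t) ∧
      f₂ (t, p t) = c₂ (t, p t) := fun t ht =>
    ⟨e₀ (hK₀ ⟨t, ht, rfl⟩), e₁ (hK₁ ⟨t, ht, rfl⟩), e₂ (hK₂ ⟨t, ht, rfl⟩)⟩
  obtain ⟨M, hM, hfin⟩ := exists_norm_sub_averaging_le hf₀ hf₁ hf₂ hc₀ hc₁ hc₂ hab (p := p) (q := q)
    (fun t ht => (hp t ht).congr_deriv (ep t ht).1.symm)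
    (fun t ht => (hq t ht).congr_deriv (by
      rw [avgOne, avgOne, fderiv_eq_of_eqOn hO₀ e₀ (hK₀ ⟨t, ht, rfl⟩),
        fderiv_eq_of_eqOn hO₁ e₁ (hK₁ ⟨t, ht, rfl⟩), fderiv_eq_of_eqOn hO₂ e₂ (hK₂ ⟨t, ht, rfl⟩),
        (ep t ht).1, (ep t ht).2.1, (ep t ht).2.2])) hq0
  have hG : ∀ t ∈ Icc a b, ∀ θ, ‖q t + Real.sin θ • c₁ (t, p t)
      + (1 - Real.cos θ) • c₂ (t, p t)‖ ≤ Cq + C₁ + 2 * C₂ := fun t ht θ => by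
    rw [← (ep t ht).2.1, ← (ep t ht).2.2]
    refine norm_add₃_le.trans (add_le_add (add_le_add (hCq t ht) ?_) ?_)
    · rw [norm_smul]
      exact (mul_le_of_le_one_left (norm_nonneg _) (Real.abs_sin_le_one _)).trans (hC₁ _)
    · rw [norm_smul]
      refine mul_le_mul ?_ (hC₂ _) (norm_nonneg _) zero_le_two
      have := Real.neg_one_le_cos θ
      rw [Real.norm_of_nonneg (by linarith [Real.cos_le_one θ])]
      linarith
  -- With this bound on `ε`, the expansion of the truncated solution puts it within `δ` of `p`,
  -- where truncated and original coefficients agree. No continuation argument is needed.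
  refine ⟨M, Cq + C₁ + 2 * C₂, min 1 (δ / (Cq + C₁ + 2 * C₂ + M + 1)), hM, by positivity,
    by positivity, hG, fun ε hε hε0 => ?_⟩
  have hε1 : ε < 1 := hε0.trans_le (min_le_left _ _)
  have hε2 : ε * (Cq + C₁ + 2 * C₂ + M + 1) < δ :=
    (lt_div_iff₀ (by positivity)).1 (hε0.trans_le (min_le_right _ _))
  obtain ⟨P, hP0, hP⟩ := exists_hasDerivWithinAt_of_lipschitzWith_of_norm_le
    (F := fun t x => f₀ (t, x) + Real.cos ((t - a) / ε) • f₁ (t, x)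
      + Real.sin ((t - a) / ε) • f₂ (t, x)) (L := ⟨C₀ + C₁ + C₂, by positivity⟩) hab.le
    (fun t _ => lipschitzWith_trig hL₀ hL₁ hL₂ t (Real.abs_cos_le_one ((t - a) / ε))
      (Real.abs_sin_le_one ((t - a) / ε)))
    (fun x => by
      have := hf₀.continuous
      have := hf₁.continuous
      have := hf₂.continuous
      exact Continuous.continuousOn (by fun_prop))
    (fun t _ x => by
      refine norm_add₃_le.trans (add_le_add (add_le_add (hC₀ _) ?_) ?_)
      · rw [norm_smul]
        exact (mul_le_of_le_one_left (norm_nonneg _) (Real.abs_cos_le_one _)).trans (hC₁ _)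
      · rw [norm_smul]
        exact (mul_le_of_le_one_left (norm_nonneg _) (Real.abs_sin_le_one _)).trans (hC₂ _))
    (p a)
  refine ⟨P, hP0, fun t ht => ?_⟩
  have hb := hfin ε hε hε1.le P hP0 hP t ht
  rw [(ep t ht).2.1, (ep t ht).2.2] at hb
  have hPO : (t, P t) ∈ O₀ ∩ O₁ ∩ O₂ := by
    refine hδO (mem_thickening_iff.2 ⟨_, ⟨t, ht, rfl⟩, ?_⟩)
    have hd : dist (t, P t) (t, p t) = ‖P t - p t‖ := by simp [dist_eq_norm]
    have hs : P t - p t = (P t - (p t + ε • (q t + Real.sin ((t - a) / ε) • c₁ (t, p t)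
        + (1 - Real.cos ((t - a) / ε)) • c₂ (t, p t)))) + ε • (q t
        + Real.sin ((t - a) / ε) • c₁ (t, p t) + (1 - Real.cos ((t - a) / ε)) • c₂ (t, p t)) := by
      abel
    rw [hd, hs]
    refine (norm_add_le _ _).trans_lt ?_
    rw [norm_smul, Real.norm_of_nonneg hε.le]
    have h1 := mul_le_mul_of_nonneg_left (hG t ht ((t - a) / ε)) hε.le
    nlinarith [mul_nonneg hM hε.le]
  refine ⟨hOS hPO.1.1, ?_, hb⟩
  rw [← e₀ hPO.1.1, ← e₁ hPO.1.2, ← e₂ hPO.2]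
  exact hP t ht

end Local

/-! ### Global existence at order zero -/

section OrderZero

theorem eq_of_hasDerivWithinAt_zero {W : Type*} [NormedAddCommGroup W] [NormedSpace ℝ W]
    {f f' : ℝ → W} {a b : ℝ} (h : ∀ t ∈ Icc a b, HasDerivWithinAt f (f' t) (Icc a b) t)
    (h' : ∀ t ∈ Icc a b, f' t = 0) : ∀ t ∈ Icc a b, f t = f a :=
  constant_of_has_deriv_right_zero (fun t ht => (h t ht).continuousWithinAt) fun t ht => by
    have := hasDerivWithinAt_Ici_of_Icc ht (h t (Ico_subset_Icc_self ht))
    rwa [h' t (Ico_subset_Icc_self ht)] at this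

theorem abs_apply_zero_le_rad (y : Fin 3 → ℝ) : |y 0| ≤ rad y :=
  Real.abs_le_sqrt (by nlinarith [sq_nonneg (y 1)])

theorem abs_apply_one_le_rad (y : Fin 3 → ℝ) : |y 1| ≤ rad y :=
  Real.abs_le_sqrt (by nlinarith [sq_nonneg (y 0)])

theorem norm_eRad_le (y : Fin 3 → ℝ) : ‖eRad y‖ ≤ 1 := by
  have h : 0 ≤ rad y := Real.sqrt_nonneg _
  refine (pi_norm_le_iff_of_nonneg zero_le_one).2 fun i => ?_
  fin_cases i
  · simpa [eRad, abs_div, abs_of_nonneg h] using div_le_one_of_le₀ (abs_apply_zero_le_rad y) h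
  · simpa [eRad, abs_div, abs_of_nonneg h] using div_le_one_of_le₀ (abs_apply_one_le_rad y) h
  · simp [eRad]

theorem norm_tor_le (y : Fin 3 → ℝ) : ‖tor y‖ ≤ 1 := by
  have h : 0 ≤ rad y := Real.sqrt_nonneg _
  refine (pi_norm_le_iff_of_nonneg zero_le_one).2 fun i => ?_
  fin_cases i
  · simpa [tor, abs_div, abs_of_nonneg h] using div_le_one_of_le₀ (abs_apply_one_le_rad y) h
  · simpa [tor, abs_div, abs_of_nonneg h] using div_le_one_of_le₀ (abs_apply_zero_le_rad y) h
  · simp [tor]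

theorem norm_eZ_le : ‖eZ‖ ≤ 1 := by
  refine (pi_norm_le_iff_of_nonneg zero_le_one).2 fun i => ?_
  fin_cases i <;> simp [eZ]

theorem abs_ct_le (y e : Fin 3 → ℝ) : |ct y e| ≤ 3 * ‖e‖ := by
  have h : ∀ i, |e i * tor y i| ≤ ‖e‖ := fun i => by
    rw [abs_mul]
    exact (mul_le_mul (norm_le_pi_norm e i) ((norm_le_pi_norm (tor y) i).trans (norm_tor_le y))
      (abs_nonneg _) (norm_nonneg _)).trans_eq (mul_one _)
  rw [ct, dotProduct, Fin.sum_univ_three]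
  exact (abs_add_three _ _ _).trans (by linarith [h 0, h 1, h 2])

theorem norm_le_rad (y : Fin 3 → ℝ) : ‖y‖ ≤ rad y + |y 2| := by
  have h : 0 ≤ rad y := Real.sqrt_nonneg _
  refine (pi_norm_le_iff_of_nonneg (by positivity)).2 fun i => ?_
  fin_cases i
  · exact (abs_apply_zero_le_rad y).trans (le_add_of_nonneg_right (abs_nonneg _))
  · exact (abs_apply_one_le_rad y).trans (le_add_of_nonneg_right (abs_nonneg _))
  · exact le_add_of_nonneg_left h

theorem norm_le_components {y : Fin 3 → ℝ} (hy : y 0 ^ 2 + y 1 ^ 2 ≠ 0) (w : Fin 3 → ℝ) :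
    ‖w‖ ≤ |ct y w| + |cr y w| + |w 2| := by
  have h : ∀ (c : ℝ) {e : Fin 3 → ℝ}, ‖e‖ ≤ 1 → ‖c • e‖ ≤ |c| := fun c e he => by
    rw [norm_smul]; exact mul_le_of_le_one_right (norm_nonneg _) he
  conv_lhs => rw [frame_decomp hy w]
  exact norm_add₃_le.trans (by
    linarith [h (ct y w) (norm_tor_le y), h (cr y w) (norm_eRad_le y), h (w 2) norm_eZ_le])

/-- Conservation laws of the order-zero system, for an arbitrary scalar reparametrization. -/
theorem orderZero_bounds {E : ℝ → (Fin 3 → ℝ) → (Fin 3 → ℝ)} {C : ℝ}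
    (hC : ∀ t y, ‖E t y‖ ≤ C) {a b : ℝ} {c : ℝ → ℝ} (hc : ∀ t, c t ∈ Icc (0 : ℝ) 1)
    {Y U : ℝ → Fin 3 → ℝ} (h0 : Y a 0 ^ 2 + Y a 1 ^ 2 ≠ 0)
    (h : ∀ t ∈ Icc a b, HasDerivWithinAt (fun t => (Y t, U t)) (c t • meanField E (t, Y t, U t))
      (Icc a b) t) {t : ℝ} (ht : t ∈ Icc a b) :
    Y t 0 ^ 2 + Y t 1 ^ 2 = Y a 0 ^ 2 + Y a 1 ^ 2 ∧ ‖Y t‖ ≤ rad (Y a) + |Y a 2| ∧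
      ‖U t‖ ≤ (|ct (Y a) (U a)| + 3 * C * (b - a)) + |cr (Y a) (U a)| + |U a 2| := by
  have hC0 : 0 ≤ C := (norm_nonneg _).trans (hC 0 0)
  have hY : ∀ t ∈ Icc a b, HasDerivWithinAt Y (c t • frameVec (Y t) 0 (ct (Y t) (U t)) 0)
      (Icc a b) t := fun t ht => (h t ht).fst
  have hU : ∀ t ∈ Icc a b, HasDerivWithinAt U (c t • frameVec (Y t)
      (-(ct (Y t) (U t) * (ct (Y t) (U t) / rad (Y t))))
      (ct (Y t) (E t (Y t)) + cr (Y t) (U t) * (ct (Y t) (U t) / rad (Y t))) 0)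
      (Icc a b) t := fun t ht => (h t ht).snd
  -- The position moves in the toroidal direction only, hence on a horizontal circle around the
  -- axis.
  have e1 : ∀ t ∈ Icc a b, Y t 0 ^ 2 + Y t 1 ^ 2 = Y a 0 ^ 2 + Y a 1 ^ 2 := by
    refine eq_of_hasDerivWithinAt_zero (f := fun t => Y t 0 ^ 2 + Y t 1 ^ 2) (fun t ht =>
      ((hasDerivWithinAt_pi.1 (hY t ht) 0).pow 2).add
        ((hasDerivWithinAt_pi.1 (hY t ht) 1).pow 2)) fun t _ => ?_
    simp [frameVec, tor, eRad, eZ]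
    ring
  have hne : ∀ t ∈ Icc a b, Y t 0 ^ 2 + Y t 1 ^ 2 ≠ 0 := fun t ht => by rwa [e1 t ht]
  -- The centrifugal term in `U'` cancels the rotation of the frame. In the same way only the
  -- electric field changes the toroidal component.
  have e2 : ∀ t ∈ Icc a b, cr (Y t) (U t) = cr (Y a) (U a) :=
    eq_of_hasDerivWithinAt_zero (f := fun t => cr (Y t) (U t)) (fun t ht =>
      hasDerivWithinAt_cr (hY t ht) (hU t ht) (hne t ht)) fun t ht => by
        simp only [cr_smul, ct_smul, cr_frameVec (hne t ht), ct_frameVec (hne t ht)]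
        ring
  have e3 : ∀ t ∈ Icc a b, Y t 2 = Y a 2 :=
    eq_of_hasDerivWithinAt_zero (f := fun t => Y t 2) (fun t ht =>
      hasDerivWithinAt_pi.1 (hY t ht) 2) fun t ht => by simp
  have e4 : ∀ t ∈ Icc a b, U t 2 = U a 2 :=
    eq_of_hasDerivWithinAt_zero (f := fun t => U t 2) (fun t ht =>
      hasDerivWithinAt_pi.1 (hU t ht) 2) fun t ht => by simp
  have e5 : |ct (Y t) (U t)| ≤ |ct (Y a) (U a)| + 3 * C * (b - a) := by
    have hd : ∀ t ∈ Icc a b, HasDerivWithinAt (fun t => ct (Y t) (U t))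
        (c t * ct (Y t) (E t (Y t))) (Icc a b) t := fun t ht => by
      refine (hasDerivWithinAt_ct (hY t ht) (hU t ht) (hne t ht)).congr_deriv ?_
      simp only [ct_smul, ct_frameVec (hne t ht)]
      ring
    have := norm_image_sub_le_of_norm_deriv_le_segment' (C := 3 * C) hd (fun t _ => by
      rw [norm_mul, Real.norm_of_nonneg (hc t).1]
      refine (mul_le_of_le_one_left (norm_nonneg _) (hc t).2).trans ((abs_ct_le _ _).trans ?_)
      linarith [hC t (Y t)]) t ht
    rw [Real.norm_eq_abs] at this
    have h3 := abs_sub_abs_le_abs_sub (ct (Y t) (U t)) (ct (Y a) (U a))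
    have h4 : 3 * C * (t - a) ≤ 3 * C * (b - a) :=
      mul_le_mul_of_nonneg_left (by linarith [ht.2]) (by positivity)
    linarith
  refine ⟨e1 t ht, ?_, ?_⟩
  · have := norm_le_rad (Y t)
    rwa [rad, e1 t ht, e3 t ht] at this
  · have := norm_le_components (hne t ht) (U t)
    rw [e2 t ht, e4 t ht] at this
    linarith

/-- Extended phase space without the axis. -/
def extOffAxis : Set (ℝ × (Fin 3 → ℝ) × (Fin 3 → ℝ)) := {z | z.2 ∈ offAxis}

theorem isOpen_extOffAxis : IsOpen extOffAxis := isOpen_offAxis.preimage continuous_snd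

/-- The bounds of `orderZero_bounds` tolerate a scalar factor in `[0, 1]`, so they hold for the
truncated equation. They confine its solution to a compact part of a cylinder off the axis, near
which the cut-off equals one. -/
theorem exists_orderZero {E : ℝ → (Fin 3 → ℝ) → (Fin 3 → ℝ)}
    (hE : ContDiff ℝ 2 (fun p : ℝ × (Fin 3 → ℝ) => E p.1 p.2)) {C : ℝ}
    (hC : ∀ t y, ‖E t y‖ ≤ C) {a b : ℝ} (hab : a ≤ b) {x v : Fin 3 → ℝ}
    (hx : x 0 ^ 2 + x 1 ^ 2 ≠ 0) :
    ∃ p : ℝ → (Fin 3 → ℝ) × (Fin 3 → ℝ), p a = (x, v) ∧ ∀ t ∈ Icc a b, (t, p t) ∈ extOffAxis ∧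
      HasDerivWithinAt p (meanField E (t, p t)) (Icc a b) t := by
  set R := max (rad x + |x 2|) ((|ct x v| + 3 * C * (b - a)) + |cr x v| + |v 2|) with hR
  have hcl : IsClosed {p : (Fin 3 → ℝ) × (Fin 3 → ℝ) | p.1 0 ^ 2 + p.1 1 ^ 2
      = x 0 ^ 2 + x 1 ^ 2} := isClosed_eq (by fun_prop) continuous_const
  have hK : IsCompact (Icc a b ×ˢ (closedBall (0 : (Fin 3 → ℝ) × (Fin 3 → ℝ)) R
      ∩ {p | p.1 0 ^ 2 + p.1 1 ^ 2 = x 0 ^ 2 + x 1 ^ 2})) :=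
    isCompact_Icc.prod ((isCompact_closedBall _ _).inter_right hcl)
  have hF : ContDiffOn ℝ 2 (meanField E) extOffAxis := fun z hz =>
    (contDiffAt_meanField hE hz).contDiffWithinAt
  obtain ⟨χ, hχ, hχc, hχS, hχ01, O, -, hKO, h1⟩ := exists_contDiff_cutoff hK isOpen_extOffAxis
    (by rintro ⟨t, p⟩ ⟨-, -, hp⟩
        change p.1 0 ^ 2 + p.1 1 ^ 2 ≠ 0
        rwa [show p.1 0 ^ 2 + p.1 1 ^ 2 = _ from hp])
  have hG := contDiff_cutoff_smul isOpen_extOffAxis hχ hχS hF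
  have hGc : HasCompactSupport (fun z => χ z • meanField E z) := hχc.smul_right
  obtain ⟨L, hL⟩ := ContDiff.lipschitzWith_of_hasCompactSupport (𝕂 := ℝ) hGc hG two_ne_zero
  obtain ⟨B, hB⟩ := hGc.exists_bound_of_continuous hG.continuous
  obtain ⟨p, hp0, hp⟩ := exists_hasDerivWithinAt_of_lipschitzWith_of_norm_le
    (F := fun t w => χ (t, w) • meanField E (t, w)) (K := L)
    (L := ⟨B, (norm_nonneg _).trans (hB 0)⟩) hab
    (fun t _ => LipschitzWith.of_dist_le_mul fun w w' =>
      (hL.dist_le_mul (t, w) (t, w')).trans (by simp [Prod.dist_eq]))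
    (fun w => (hG.continuous.comp (continuous_id.prodMk continuous_const)).continuousOn)
    (fun t _ w => hB (t, w)) (x, v)
  have hb := fun t (ht : t ∈ Icc a b) => orderZero_bounds (c := fun t => χ (t, p t))
    (Y := fun t => (p t).1) (U := fun t => (p t).2) hC (fun t => hχ01 _) (by simpa [hp0] using hx)
    hp ht
  simp only [hp0] at hb
  refine ⟨p, hp0, fun t ht => ⟨?_, ?_⟩⟩
  · change (p t).1 0 ^ 2 + (p t).1 1 ^ 2 ≠ 0
    rwa [(hb t ht).1]
  · have hm : (t, p t) ∈ O := hKO ⟨ht, mem_closedBall_zero_iff.2 (norm_prod_le_iff.2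
      ⟨(hb t ht).2.1.trans (le_max_left _ _), (hb t ht).2.2.trans (le_max_right _ _)⟩),
      (hb t ht).1⟩
    simpa [h1 _ hm] using hp t ht

end OrderZero

/-! ### Trajectories as rotated solutions of the slow equation -/

section Trajectory

/-- Differentiating the angle contributes `ε⁻¹` times the generator of the rotation, which is
exactly the strong magnetic force. -/
theorem hasDerivWithinAt_gyro {y u : ℝ → Fin 3 → ℝ} {h k : Fin 3 → ℝ} {t : ℝ} {S : Set ℝ}
    (hy : HasDerivWithinAt y h S t) (hu : HasDerivWithinAt u k S t)
    (h0 : y t 0 ^ 2 + y t 1 ^ 2 ≠ 0) (a ε : ℝ) :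
    HasDerivWithinAt (fun τ => gyro ((τ - a) / ε) (y τ) *ᵥ u τ)
      ((flowDeriv ((t - a) / ε) (y t) (u t) h k).2
        + ε⁻¹ • ((gyro ((t - a) / ε) (y t) *ᵥ u t) ⨯₃ tor (y t))) S t := by
  have hθ : HasDerivWithinAt (fun τ => (τ - a) / ε) ε⁻¹ S t := by
    simpa using ((hasDerivWithinAt_id t S).sub_const a).div_const ε
  have hcr := hasDerivWithinAt_cr hy hu h0
  have hu2 := hasDerivWithinAt_pi.1 hu 2
  simp only [gyro_mulVec_frame]
  refine (hasDerivWithinAt_frameVec hy h0 ((hθ.cos.mul hcr).sub (hθ.sin.mul hu2))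
    (hasDerivWithinAt_ct hy hu h0) ((hθ.cos.mul hu2).add (hθ.sin.mul hcr))).congr_deriv ?_
  rw [cross_tor h0]
  refine frame_ext h0 ?_ ?_ ?_ <;>
  simp only [flowDeriv, frameVecDeriv, crDeriv, ctDeriv, cr_add, ct_add, cr_sub, ct_sub, cr_smul,
    ct_smul, cr_frameVec h0, ct_frameVec h0, cr_eRad h0, ct_eRad, cr_eZ, ct_eZ, eRad_two, eZ_two,
    Pi.add_apply, Pi.sub_apply, Pi.smul_apply, Pi.mul_apply, smul_eq_mul, frameVec_two] <;>
  ring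

variable {E : ℝ → (Fin 3 → ℝ) → (Fin 3 → ℝ)}

/-- Undoing the change of variables of the averaging recipe. -/
theorem isTrajectory_of_averaged {s T ε : ℝ} (hT : 0 ≤ T)
    {P : ℝ → (Fin 3 → ℝ) × (Fin 3 → ℝ)}
    (hP : ∀ t ∈ Icc s (s + T), (t, P t) ∈ extOffAxis ∧
      HasDerivWithinAt P (meanField E (t, P t) + Real.cos ((t - s) / ε) • cosField E (t, P t)
        + Real.sin ((t - s) / ε) • sinField E (t, P t)) (Icc s (s + T)) t) :
    IsTrajectory E s T (P s).1 (P s).2 ε (fun t => (P t).1)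
      (fun t => gyro ((t - s) / ε) (P t).1 *ᵥ (P t).2) := by
  have hα : ∀ t ∈ Icc s (s + T), ∃ α, HasDerivWithinAt P α (Icc s (s + T)) t ∧
      flowDeriv ((t - s) / ε) (P t).1 (P t).2 α.1 α.2
        = slowField E t ((t - s) / ε) (flowZ t ((t - s) / ε) ((P t).1, (P t).2)) := fun t ht =>
    ⟨_, (hP t ht).2, flowDeriv_alphaZero E t ((t - s) / ε) (hP t ht).1⟩
  refine ⟨rfl, ?_, fun t ht => (hP t ht).1, fun t ht => ?_, fun t ht => ?_⟩
  · have h : (P s).1 0 ^ 2 + (P s).1 1 ^ 2 ≠ 0 := (hP s (left_mem_Icc.2 (by linarith))).1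
    simp only [sub_self, zero_div, gyro_mulVec, Real.cos_zero, Real.sin_zero, one_smul, zero_smul,
      add_zero, ← add_assoc]
    rw [add_comm (ct _ _ • _)]
    exact (frame_decomp h (P s).2).symm
  · obtain ⟨α, h, e⟩ := hα t ht
    exact HasDerivWithinAt.congr_deriv h.fst (congrArg Prod.fst e)
  · obtain ⟨α, h, e⟩ := hα t ht
    refine (hasDerivWithinAt_gyro h.fst h.snd (hP t ht).1 s ε).congr_deriv ?_
    rw [congrArg Prod.snd e]
    rfl

variable (hE : ContDiff ℝ 2 (fun p : ℝ × (Fin 3 → ℝ) => E p.1 p.2))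
include hE

theorem isTrajectory_eqOn {s T ε : ℝ} {x v : Fin 3 → ℝ} {X V X' V' : ℝ → Fin 3 → ℝ}
    (h : IsTrajectory E s T x v ε X V) (h' : IsTrajectory E s T x v ε X' V') :
    EqOn X' X (Icc s (s + T)) ∧ EqOn V' V (Icc s (s + T)) := by
  -- The cross products are written in the frame, so that smoothness off the axis follows from that
  -- of the frame and its components.
  let F : ℝ × (Fin 3 → ℝ) × (Fin 3 → ℝ) → (Fin 3 → ℝ) × (Fin 3 → ℝ) := fun z =>
    (z.2.2, E z.1 z.2.1 + (ct z.2.1 z.2.2 • eRad z.2.1 - cr z.2.1 z.2.2 • tor z.2.1)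
      + ε⁻¹ • (cr z.2.1 z.2.2 • eZ - z.2.2 2 • eRad z.2.1))
  have hF : ContDiffOn ℝ 1 F extOffAxis := fun z hz => by
    have h1 : ContDiffAt ℝ 1 (fun z : ℝ × (Fin 3 → ℝ) × (Fin 3 → ℝ) => z.2.1) z :=
      (contDiff_fst.comp contDiff_snd).contDiffAt
    have h2 : ContDiffAt ℝ 1 (fun z : ℝ × (Fin 3 → ℝ) × (Fin 3 → ℝ) => z.2.2) z :=
      (contDiff_snd.comp contDiff_snd).contDiffAt
    have hcr := contDiffAt_cr h1 h2 hz
    have he := contDiffAt_eRad h1 hz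
    have hE' : ContDiffAt ℝ 1 (fun z : ℝ × (Fin 3 → ℝ) × (Fin 3 → ℝ) => E z.1 z.2.1) z :=
      ((contDiff_field_comp hE).of_le (by norm_num)).contDiffAt
    have h3 := ((contDiffAt_ct h1 h2 hz).smul he).sub (hcr.smul (contDiffAt_tor h1 hz))
    have h4 := (hcr.smul (contDiffAt_const (c := eZ))).sub ((contDiffAt_pi.1 h2 2).smul he)
    exact (h2.prodMk ((hE'.add h3).add (h4.const_smul ε⁻¹))).contDiffWithinAt
  have key : ∀ X V : ℝ → Fin 3 → ℝ, IsTrajectory E s T x v ε X V → ∀ t ∈ Icc s (s + T),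
      HasDerivWithinAt (fun t => (X t, V t)) (F (t, X t, V t)) (Icc s (s + T)) t :=
    fun X V h t ht => ((h.pos_deriv t ht).prodMk (h.vel_deriv t ht)).congr_deriv (by
      rw [cross_eZ (h.off_axis t ht), cross_tor (h.off_axis t ht)])
  have := eqOn_of_hasDerivWithinAt_of_contDiffOn isOpen_extOffAxis hF (key X' V' h') h'.off_axis
    (key X V h) h.off_axis (by simp [h.pos_init, h.vel_init, h'.pos_init, h'.vel_init])
  exact ⟨fun t ht => congrArg Prod.fst (this ht), fun t ht => congrArg Prod.snd (this ht)⟩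

omit hE in
-- The slow field moves the position with the velocity, and the flow fixes positions, so the rotated
-- velocity is the position part of `α⁰`. Its dependence on `θ` is thus carried by bounded scalars,
-- which makes Taylor estimates uniform in `θ`.
theorem gyro_mulVec_eq_fields (t θ : ℝ) (y u : Fin 3 → ℝ) :
    gyro θ y *ᵥ u = (meanField E (t, y, u)).1 + Real.cos θ • (cosField E (t, y, u)).1
      + Real.sin θ • (sinField E (t, y, u)).1 := by
  rw [gyro_mulVec_frame]
  simp only [meanField, cosField, sinField, meanCoeff, cosCoeff, sinCoeff, frameVec]
  module

theorem flowDeriv_eq_fields {t : ℝ} (θ : ℝ) {y u : Fin 3 → ℝ} (hy : y 0 ^ 2 + y 1 ^ 2 ≠ 0)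
    (h k : Fin 3 → ℝ) :
    (flowDeriv θ y u h k).2 = (fderiv ℝ (meanField E) (t, y, u) (0, h, k)).1
      + Real.cos θ • (fderiv ℝ (cosField E) (t, y, u) (0, h, k)).1
      + Real.sin θ • (fderiv ℝ (sinField E) (t, y, u) (0, h, k)).1 := by
  have hz : ((t, y, u) : ℝ × (Fin 3 → ℝ) × (Fin 3 → ℝ)).2 ∈ offAxis := hy
  rw [fderiv_meanField hE hz, fderiv_cosField hE hz, fderiv_sinField hE hz]
  simp only [flowDeriv, meanCoeffDeriv, cosCoeffDeriv, sinCoeffDeriv, frameVecDeriv, frameVec]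
  module

end Trajectory

/-! ### Expansion of position and velocity -/

section Expansion

variable {E : ℝ → (Fin 3 → ℝ) → (Fin 3 → ℝ)}
  (hE : ContDiff ℝ 2 (fun p : ℝ × (Fin 3 → ℝ) => E p.1 p.2))
include hE

theorem contDiffOn_meanField : ContDiffOn ℝ 2 (meanField E) extOffAxis := fun _ hz =>
  (contDiffAt_meanField hE hz).contDiffWithinAt

theorem contDiffOn_cosField : ContDiffOn ℝ 2 (cosField E) extOffAxis := fun _ hz =>
  (contDiffAt_cosField hE hz).contDiffWithinAt

theorem contDiffOn_sinField : ContDiffOn ℝ 2 (sinField E) extOffAxis := fun _ hz =>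
  (contDiffAt_sinField hE hz).contDiffWithinAt

omit hE in
theorem norm_trig_le {V : Type*} [NormedAddCommGroup V] [NormedSpace ℝ V] {a b c : V}
    {A B C : ℝ} (ha : ‖a‖ ≤ A) (hb : ‖b‖ ≤ B) (hc : ‖c‖ ≤ C) (θ : ℝ) :
    ‖a + Real.cos θ • b + Real.sin θ • c‖ ≤ A + B + C := by
  refine norm_add₃_le.trans (add_le_add (add_le_add ha ?_) ?_)
  · rw [norm_smul]
    exact (mul_le_of_le_one_left (norm_nonneg _) (Real.abs_cos_le_one θ)).trans hb
  · rw [norm_smul]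
    exact (mul_le_of_le_one_left (norm_nonneg _) (Real.abs_sin_le_one θ)).trans hc

theorem exists_norm_velocity_sub_le {a b : ℝ} {p : ℝ → (Fin 3 → ℝ) × (Fin 3 → ℝ)}
    (hp : ContinuousOn p (Icc a b)) (hpS : ∀ t ∈ Icc a b, (t, p t) ∈ extOffAxis) {G M : ℝ}
    (hG : 0 ≤ G) (hM : 0 ≤ M) :
    ∃ C D ε₀ : ℝ, 0 ≤ C ∧ 0 ≤ D ∧ 0 < ε₀ ∧ ∀ t ∈ Icc a b, ∀ g : (Fin 3 → ℝ) × (Fin 3 → ℝ),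
      ‖g‖ ≤ G → ∀ θ, ‖(flowDeriv θ (p t).1 (p t).2 g.1 g.2).2‖ ≤ D ∧
        ∀ ε, 0 < ε → ε < ε₀ → ∀ w, ‖w - (p t + ε • g)‖ ≤ M * ε ^ 2 →
          ‖ε⁻¹ • (gyro θ w.1 *ᵥ w.2 - gyro θ (p t).1 *ᵥ (p t).2)
            - (flowDeriv θ (p t).1 (p t).2 g.1 g.2).2‖ ≤ C * ε := by
  have hz : ContinuousOn (fun t => (t, p t)) (Icc a b) := continuousOn_id.prodMk hp
  have hd : ∀ f : ℝ × (Fin 3 → ℝ) × (Fin 3 → ℝ) → (Fin 3 → ℝ) × (Fin 3 → ℝ),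
      ContDiffOn ℝ 2 f extOffAxis → ∃ D, ∀ t ∈ Icc a b, ‖fderiv ℝ f (t, p t)‖ ≤ D := fun f h =>
    isCompact_Icc.exists_bound_of_continuousOn
      ((h.continuousOn_fderiv_of_isOpen isOpen_extOffAxis (by norm_num)).comp hz hpS)
  have hb : ∀ (f : ℝ × (Fin 3 → ℝ) × (Fin 3 → ℝ) → (Fin 3 → ℝ) × (Fin 3 → ℝ)) {D t : ℝ}
      {g : (Fin 3 → ℝ) × (Fin 3 → ℝ)}, ‖fderiv ℝ f (t, p t)‖ ≤ D → ‖g‖ ≤ G →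
      -- The bound `D` has no sign when the interval is empty, hence the maximum with `0`.
      ‖(fderiv ℝ f (t, p t) (0, g)).1‖ ≤ max D 0 * G := fun f D t g h hg => by
    refine (norm_fst_le _).trans ((ContinuousLinearMap.le_opNorm _ _).trans
      (mul_le_mul (h.trans (le_max_left _ _)) ?_ (norm_nonneg _) (le_max_right _ _)))
    simpa [Prod.norm_def] using hg
  obtain ⟨D₀, hD₀⟩ := hd _ (contDiffOn_meanField hE)
  obtain ⟨D₁, hD₁⟩ := hd _ (contDiffOn_cosField hE)
  obtain ⟨D₂, hD₂⟩ := hd _ (contDiffOn_sinField hE)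
  obtain ⟨C₀, ε₀, hC₀, hε₀, h₀⟩ := exists_norm_slope_sub_le isOpen_extOffAxis
    (contDiffOn_meanField hE) hp hpS hG hM
  obtain ⟨C₁, ε₁, hC₁, hε₁, h₁⟩ := exists_norm_slope_sub_le isOpen_extOffAxis
    (contDiffOn_cosField hE) hp hpS hG hM
  obtain ⟨C₂, ε₂, hC₂, hε₂, h₂⟩ := exists_norm_slope_sub_le isOpen_extOffAxis
    (contDiffOn_sinField hE) hp hpS hG hM
  refine ⟨C₀ + C₁ + C₂, max D₀ 0 * G + max D₁ 0 * G + max D₂ 0 * G, min ε₀ (min ε₁ ε₂),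
    by positivity, by positivity, by positivity, fun t ht g hg θ => ?_⟩
  have e := flowDeriv_eq_fields hE (t := t) θ (y := (p t).1) (u := (p t).2) (hpS t ht) g.1 g.2
  rw [e]
  refine ⟨norm_trig_le (hb _ (hD₀ t ht) hg) (hb _ (hD₁ t ht) hg) (hb _ (hD₂ t ht) hg) θ,
    fun ε hε hlt w hw => ?_⟩
  obtain ⟨l₀, l₁, l₂⟩ : ε < ε₀ ∧ ε < ε₁ ∧ ε < ε₂ := by simpa using hlt
  have := norm_trig_le ((norm_fst_le _).trans (h₀ ε hε l₀ t ht w g hg hw))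
    ((norm_fst_le _).trans (h₁ ε hε l₁ t ht w g hg hw))
    ((norm_fst_le _).trans (h₂ ε hε l₂ t ht w g hg hw)) θ
  rw [gyro_mulVec_eq_fields (E := E) t, gyro_mulVec_eq_fields (E := E) t]
  refine (le_of_eq ?_).trans (this.trans_eq (by ring))
  congr 1
  simp only [Prod.fst_sub, Prod.smul_fst, Prod.mk.eta]
  module

/-- Existence of trajectories for small `ε`, with their expansion. -/
theorem exists_trajectory {s T : ℝ} (hT : 0 ≤ T) {p q : ℝ → (Fin 3 → ℝ) × (Fin 3 → ℝ)}
    (hpS : ∀ t ∈ Icc s (s + (T + 1)), (t, p t) ∈ extOffAxis)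
    (hp : ∀ t ∈ Icc s (s + (T + 1)),
      HasDerivWithinAt p (meanField E (t, p t)) (Icc s (s + (T + 1))) t)
    (hq0 : q s = 0)
    (hq : ∀ t ∈ Icc s (s + (T + 1)), HasDerivWithinAt q
      (avgOne (meanField E) (cosField E) (sinField E) (t, p t) (q t)) (Icc s (s + (T + 1))) t) :
    ∃ C ε₀ : ℝ, 0 < ε₀ ∧ ∀ ε, 0 < ε → ε < ε₀ → ∃ X V : ℝ → Fin 3 → ℝ,
      IsTrajectory E s T (p s).1 (p s).2 ε X V ∧ ∀ t ∈ Icc s (s + T),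
        ‖X t - (p t).1‖ ≤ C * ε ∧ ‖V t - gyro ((t - s) / ε) (p t).1 *ᵥ (p t).2‖ ≤ C * ε ∧
        ‖ε⁻¹ • (X t - (p t).1) - posOne ((t - s) / ε) (p t).1 (p t).2 (q t).1‖ ≤ C * ε ∧
        ‖ε⁻¹ • (V t - gyro ((t - s) / ε) (p t).1 *ᵥ (p t).2)
          - velOne ((t - s) / ε) (p t).1 (p t).2 (q t).1 (q t).2 (E t (p t).1)‖ ≤ C * ε := by
  obtain ⟨M, G, ε₁, hM, hG, hε₁, hB, hP⟩ := exists_averaging isOpen_extOffAxis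
    (contDiffOn_meanField hE) (contDiffOn_cosField hE) (contDiffOn_sinField hE)
    (show s < s + (T + 1) by linarith) hp hpS hq hq0
  obtain ⟨C, D, ε₂, hC, hD, hε₂, hV⟩ := exists_norm_velocity_sub_le hE
    (fun t ht => (hp t ht).continuousWithinAt) hpS hG hM
  refine ⟨M + G + C + D, min 1 (min ε₁ ε₂), by positivity, fun ε hε hlt => ?_⟩
  obtain ⟨l₀, l₁, l₂⟩ : ε < 1 ∧ ε < ε₁ ∧ ε < ε₂ := by simpa using hlt
  obtain ⟨P, hP0, hP⟩ := hP ε hε l₁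
  have hsub : Icc s (s + T) ⊆ Icc s (s + (T + 1)) := Icc_subset_Icc_right (by linarith)
  have htraj := isTrajectory_of_averaged (E := E) (ε := ε) hT (P := P) fun t ht =>
    ⟨(hP t (hsub ht)).1, (hP t (hsub ht)).2.1.mono hsub⟩
  rw [hP0] at htraj
  refine ⟨_, _, htraj, fun t ht => ?_⟩
  have ht' := hsub ht
  set θ := (t - s) / ε
  set g := q t + Real.sin θ • cosField E (t, p t) + (1 - Real.cos θ) • sinField E (t, p t)
    with hg
  have hgG : ‖g‖ ≤ G := hB t ht' θ
  have hw : ‖P t - (p t + ε • g)‖ ≤ M * ε ^ 2 := (hP t ht').2.2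
  -- `g` is the order-one term of the slow variable; its image under the derivative of the fast flow
  -- is the announced pair.
  have hflow : flowDeriv θ (p t).1 (p t).2 g.1 g.2 = (posOne θ (p t).1 (p t).2 (q t).1,
      velOne θ (p t).1 (p t).2 (q t).1 (q t).2 (E t (p t).1)) := by
    rw [← flowDeriv_eq (hpS t ht'), hg, add_assoc]
    rfl
  have hg1 : g.1 = posOne θ (p t).1 (p t).2 (q t).1 := congrArg Prod.fst hflow
  obtain ⟨v1, v2⟩ := hV t ht' g hgG θ
  have v3 := v2 ε hε l₂ (P t) hw
  rw [hflow] at v1 v3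
  have x3 : ‖ε⁻¹ • ((P t).1 - (p t).1) - posOne θ (p t).1 (p t).2 (q t).1‖ ≤ M * ε := by
    rw [← hg1]
    have e : ε⁻¹ • ((P t).1 - (p t).1) - g.1 = (ε⁻¹ • (P t - (p t + ε • g))).1 := by
      simp only [Prod.smul_fst, Prod.fst_sub, Prod.fst_add]
      rw [← sub_sub, smul_sub _ ((P t).1 - (p t).1), smul_smul, inv_mul_cancel₀ hε.ne', one_smul]
    rw [e]
    refine (norm_fst_le _).trans ?_
    rw [norm_smul, norm_inv, Real.norm_of_nonneg hε.le, inv_mul_le_iff₀ hε]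
    linarith [hw]
  have x1 : ‖posOne θ (p t).1 (p t).2 (q t).1‖ ≤ G := hg1 ▸ (norm_fst_le g).trans hgG
  -- The order-zero estimates follow from the order-one estimates and the boundedness of the
  -- order-one terms, using `ε < 1`.
  have scale : ∀ {z z' : Fin 3 → ℝ} {A B : ℝ}, 0 ≤ A → ‖z'‖ ≤ B → ‖ε⁻¹ • z - z'‖ ≤ A * ε →
      ‖z‖ ≤ (A + B) * ε := fun {z z' A B} hA h1 h2 => by
    have h3 : ‖ε⁻¹ • z‖ ≤ A * ε + B :=
      (norm_le_norm_add_norm_sub z' _).trans (by rw [norm_sub_rev]; linarith)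
    rw [norm_smul, norm_inv, Real.norm_of_nonneg hε.le, inv_mul_le_iff₀ hε] at h3
    nlinarith [mul_nonneg hA hε.le, mul_nonneg (mul_nonneg hA hε.le) (sub_nonneg.2 l₀.le)]
  have le : ∀ {r A : ℝ}, r ≤ A * ε → A ≤ M + G + C + D → r ≤ (M + G + C + D) * ε :=
    fun h h' => h.trans (mul_le_mul_of_nonneg_right h' hε.le)
  exact ⟨le (scale hM x1 x3) (by linarith), le (scale hC v1 v3) (by linarith),
    le x3 (by linarith), le v3 (by linarith)⟩

end Expansion

end GuidingCentre

/-! ### Assembly of the theorem -/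

open GuidingCentre in
theorem mainTheorem9
    (E : ℝ → (Fin 3 → ℝ) → (Fin 3 → ℝ))
    (hE : IsCbTwo (fun p : ℝ × (Fin 3 → ℝ) => E p.1 p.2))
    (s T : ℝ) (hT : 0 ≤ T) (x v : Fin 3 → ℝ) (hx : x 0 ^ 2 + x 1 ^ 2 ≠ 0) :
    -- the fields produced by the averaging recipe have the announced explicit expressions
    (∀ (t : ℝ) (y u : Fin 3 → ℝ), y 0 ^ 2 + y 1 ^ 2 ≠ 0 →
      aZero (slowField E) flowZ t (y, u) = (rhsYZero y u, rhsUZero y u (E t y)) ∧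
      ∀ η μ : Fin 3 → ℝ,
        aOne (slowField E) flowZ t (y, u) (η, μ) =
          (rhsYOne y u η μ (E t y),
            rhsUOne y u η μ (E t y) (deriv (fun τ => E τ y) t) (fderiv ℝ (E t) y)) ∧
        ∀ θ : ℝ, xOne (slowField E) flowZ t θ (y, u) (η, μ) =
          (posOne θ y u η, velOne θ y u η μ (E t y))) ∧
    -- for all small `ε` the trajectory exists on `[s, s+T]` and is unique
    (∀ᶠ ε in 𝓝[>] (0 : ℝ), ∃ X V : ℝ → Fin 3 → ℝ, IsTrajectory E s T x v ε X V ∧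
      ∀ X' V' : ℝ → Fin 3 → ℝ, IsTrajectory E s T x v ε X' V' →
        Set.EqOn X' X (Set.Icc s (s + T)) ∧ Set.EqOn V' V (Set.Icc s (s + T))) ∧
    -- the order-zero and order-one systems are uniquely solvable, and give the expansion
    ∃ Y U η μ : ℝ → Fin 3 → ℝ,
      IsOrderZero E s T x v Y U ∧
      (∀ Y' U' : ℝ → Fin 3 → ℝ, IsOrderZero E s T x v Y' U' →
        Set.EqOn Y' Y (Set.Icc s (s + T)) ∧ Set.EqOn U' U (Set.Icc s (s + T))) ∧
      IsOrderOne E s T Y U η μ ∧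
      (∀ η' μ' : ℝ → Fin 3 → ℝ, IsOrderOne E s T Y U η' μ' →
        Set.EqOn η' η (Set.Icc s (s + T)) ∧ Set.EqOn μ' μ (Set.Icc s (s + T))) ∧
      ∀ X V : ℝ → ℝ → Fin 3 → ℝ,
        (∀ᶠ ε in 𝓝[>] (0 : ℝ), IsTrajectory E s T x v ε (X ε) (V ε)) →
        TendstoUniformlyOn (fun ε t => X ε t - Y t)
          0 (𝓝[>] (0 : ℝ)) (Set.Icc s (s + T)) ∧
        TendstoUniformlyOn (fun ε t => V ε t - gyro ((t - s) / ε) (Y t) *ᵥ U t)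
          0 (𝓝[>] (0 : ℝ)) (Set.Icc s (s + T)) ∧
        TendstoUniformlyOn
          (fun ε t => ε⁻¹ • (X ε t - Y t) - posOne ((t - s) / ε) (Y t) (U t) (η t))
          0 (𝓝[>] (0 : ℝ)) (Set.Icc s (s + T)) ∧
        TendstoUniformlyOn
          (fun ε t => ε⁻¹ • (V ε t - gyro ((t - s) / ε) (Y t) *ᵥ U t)
            - velOne ((t - s) / ε) (Y t) (U t) (η t) (μ t) (E t (Y t)))
          0 (𝓝[>] (0 : ℝ)) (Set.Icc s (s + T)) := by
  obtain ⟨C, hC⟩ := hE.2 0 zero_le_two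
  have hC' : ∀ t y, ‖E t y‖ ≤ C := fun t y => by simpa using hC (t, y)
  -- The averaging theorem needs an interval of positive length. Working up to `s + (T + 1)` and
  -- restricting afterwards covers `T = 0`.
  obtain ⟨p, hp0, hp⟩ := exists_orderZero hE.1 hC' (show s ≤ s + (T + 1) by linarith) (v := v) hx
  have hpc : ContinuousOn p (Set.Icc s (s + (T + 1))) := fun t ht =>
    (hp t ht).2.continuousWithinAt
  obtain ⟨q, hq0, hq⟩ := exists_orderOne isOpen_extOffAxis (contDiffOn_meanField hE.1)
    (contDiffOn_cosField hE.1) (contDiffOn_sinField hE.1)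
    (show s ≤ s + (T + 1) by linarith) hpc fun t ht => (hp t ht).1
  obtain ⟨C, ε₀, hε₀, htraj⟩ := exists_trajectory hE.1 hT (fun t ht => (hp t ht).1)
    (fun t ht => (hp t ht).2) hq0 hq
  simp only [hp0] at htraj
  have hsub : Set.Icc s (s + T) ⊆ Set.Icc s (s + (T + 1)) :=
    Set.Icc_subset_Icc_right (by linarith)
  have hp' : ∀ t ∈ Set.Icc s (s + T), HasDerivWithinAt p (meanField E (t, p t))
      (Set.Icc s (s + T)) t := fun t ht => (hp t (hsub ht)).2.mono hsub
  have hq' : ∀ t ∈ Set.Icc s (s + T), HasDerivWithinAt q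
      (avgOne (meanField E) (cosField E) (sinField E) (t, p t) (q t)) (Set.Icc s (s + T)) t :=
    fun t ht => (hq t (hsub ht)).mono hsub
  have hoff : ∀ t ∈ Set.Icc s (s + T), (p t).1 0 ^ 2 + (p t).1 1 ^ 2 ≠ 0 := fun t ht =>
    (hp t (hsub ht)).1
  have hmean : ∀ t ∈ Set.Icc s (s + T), meanField E (t, p t)
      = (rhsYZero (p t).1 (p t).2, rhsUZero (p t).1 (p t).2 (E t (p t).1)) := fun t ht =>
    meanCoeff_eq (hoff t ht) _ _
  have havg : ∀ t ∈ Set.Icc s (s + T), ∀ η μ, avgOne (meanField E) (cosField E) (sinField E)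
      (t, p t) (η, μ) = _ := fun t ht => avgOne_eq hE.1 t (hoff t ht) (p t).2
  have hev : ∀ᶠ ε in 𝓝[>] (0 : ℝ), 0 < ε ∧ ε < ε₀ := Ioo_mem_nhdsGT hε₀
  refine ⟨recipe_eq hE.1, ?_, fun t => (p t).1, fun t => (p t).2, fun t => (q t).1,
    fun t => (q t).2, ?_, fun Y U h => ?_, ?_, fun η μ h => ?_, fun X V hXV => ?_⟩
  · filter_upwards [hev] with ε hε
    obtain ⟨X, V, h, -⟩ := htraj ε hε.1 hε.2
    exact ⟨X, V, h, fun X' V' h' => isTrajectory_eqOn hE.1 h h'⟩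
  · exact ⟨by simp [hp0], by simp [hp0], hoff,
      fun t ht => ((hp' t ht).congr_deriv (hmean t ht)).fst,
      fun t ht => ((hp' t ht).congr_deriv (hmean t ht)).snd⟩
  · have := eqOn_of_hasDerivWithinAt_of_contDiffOn isOpen_extOffAxis
      ((contDiffOn_meanField hE.1).of_le (by norm_num)) (γ := fun t => (Y t, U t)) (δ := p)
      (fun t ht => ((h.pos_deriv t ht).prodMk (h.vel_deriv t ht)).congr_deriv
        (meanCoeff_eq (h.off_axis t ht) _ _).symm) h.off_axis hp' hoff
      (by simp [h.pos_init, h.vel_init, hp0])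
    exact ⟨fun t ht => congrArg Prod.fst (this ht), fun t ht => congrArg Prod.snd (this ht)⟩
  · exact ⟨by simp [hq0], by simp [hq0],
      fun t ht => ((hq' t ht).congr_deriv (havg t ht _ _)).fst,
      fun t ht => ((hq' t ht).congr_deriv (havg t ht _ _)).snd⟩
  · have := orderOne_eqOn isOpen_extOffAxis (contDiffOn_meanField hE.1) (hpc.mono hsub) hoff hq'
      (q' := fun t => (η t, μ t))
      (fun t ht => ((h.pos_deriv t ht).prodMk (h.vel_deriv t ht)).congr_deriv
        (havg t ht _ _).symm) (by simp [h.pos_init, h.vel_init, hq0])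
    exact ⟨fun t ht => congrArg Prod.fst (this ht), fun t ht => congrArg Prod.snd (this ht)⟩
  · have hb : ∀ᶠ ε in 𝓝[>] (0 : ℝ), ∀ t ∈ Set.Icc s (s + T),
        ‖X ε t - (p t).1‖ ≤ C * ε ∧ ‖V ε t - gyro ((t - s) / ε) (p t).1 *ᵥ (p t).2‖ ≤ C * ε ∧
        ‖ε⁻¹ • (X ε t - (p t).1) - posOne ((t - s) / ε) (p t).1 (p t).2 (q t).1‖ ≤ C * ε ∧
        ‖ε⁻¹ • (V ε t - gyro ((t - s) / ε) (p t).1 *ᵥ (p t).2)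
          - velOne ((t - s) / ε) (p t).1 (p t).2 (q t).1 (q t).2 (E t (p t).1)‖ ≤ C * ε := by
      filter_upwards [hev, hXV] with ε hε h'
      -- The estimates are known for the trajectory constructed by averaging; uniqueness transfers
      -- them to the given family.
      obtain ⟨X', V', h, hb⟩ := htraj ε hε.1 hε.2
      obtain ⟨eX, eV⟩ := isTrajectory_eqOn hE.1 h h'
      intro t ht
      have := hb t ht
      rwa [← eX ht, ← eV ht] at this
    have lim : ∀ F : ℝ → ℝ → Fin 3 → ℝ, (∀ᶠ ε in 𝓝[>] (0 : ℝ), ∀ t ∈ Set.Icc s (s + T),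
        ‖F ε t‖ ≤ C * ε) → TendstoUniformlyOn F 0 (𝓝[>] (0 : ℝ)) (Set.Icc s (s + T)) :=
      fun F hF => by
        refine Metric.tendstoUniformlyOn_iff.2 fun δ hδ => ?_
        have h0 : Filter.Tendsto (fun ε : ℝ => C * ε) (𝓝[>] (0 : ℝ)) (𝓝 0) := by
          have : Filter.Tendsto (fun ε : ℝ => C * ε) (𝓝 0) (𝓝 (C * 0)) :=
            (continuous_const_mul C).tendsto 0
          rw [mul_zero] at this
          exact this.mono_left nhdsWithin_le_nhds
        filter_upwards [hF, h0.eventually_lt_const hδ] with ε h1 h2 t ht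
        simpa using (h1 t ht).trans_lt h2
    exact ⟨lim _ (hb.mono fun ε h t ht => (h t ht).1), lim _ (hb.mono fun ε h t ht => (h t ht).2.1),
      lim _ (hb.mono fun ε h t ht => (h t ht).2.2.1),
      lim _ (hb.mono fun ε h t ht => (h t ht).2.2.2)⟩
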